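/- **Setting.** For $n\ge 0$ let $\mathbb M$ be the $2^n\times 2^n$ complex matrices, $H\in\mathbb M$ Hermitian, $\beta\in\mathbb R$, $\rho_\beta=e^{-\beta H}/\operatorname{tr}e^{-\beta H}$, $s\in[0,1]$, and $\langle A,B\rangle_s=\operatorname{tr}(A^\dagger\rho_\beta^{1-s}B\rho_\beta^{s})$. A quantum channel $\mathcal N$ (with Hilbert–Schmidt dual $\mathcal N^\dagger$) is called a *Gibbs sampler* if it satisfies $s$-detailed balance, $\langle A,\mathcal N^\dagger(B)\rangle_s=\langle\mathcal N^\dagger(A),B\rangle_s$ for all $A,B$, has $\rho_\beta$ as its unique fixed state, and has its spectrum in $[0,1]$. Let $gap(\mathcal N)$ be $1$ minus its largest eigenvalue other than $1$, let $t_{mix}(\eta)$ be the least $t\in\mathbb N$ such that $\|\mathcal N^t(\rho)-\rho_\beta\|_1\le\eta$ for all states $\rho$, and let $\mathbb V_{\rho_\beta}[O]=\operatorname{tr}(O^2\rho_\beta)-(\operatorname{tr}(O\rho_\beta))^2$. A *measurement* $\mathcal M$ with $m$ ancilla qubits is a circuit that starts with the ancillas in $|0\rangle$, applies a list of operations, each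 of them either a unitary on the ancillas alone or a controlled Hamiltonian evolution $\sum_{\ell=0}^{2^m-1}e^{-i\theta(\ell-2^{m}/2)O}\otimes|\ell\rangle\langle\ell|$ (which costs evolution time $|\theta|\,2^m/2$), measures the ancillas in the computational basis, and reports a fixed real function of the result. A *single-trajectory protocol* applies $\mathcal N$ to the initial state $T_{burn}$ times, then performs $K$ rounds, each consisting of $\mathcal M$ (with outcome $e_t$ recorded), $r$ applications of $\mathcal N$, and $\mathcal M$ again (with outcome discarded), and outputs $\frac1K\sum_{t=1}^K e_t$. It uses $t_{\mathcal N}=T_{burn}+Kr$ applications of $\mathcal N$, and its controlled evolution time $t_{\mathcal M}$ of $O$ is $2K$ times that of one run of $\mathcal M$. **Corollary 6.4 (Thermal expectation estimation for commuting observables).** There are absolute constants $C>0$ and $a\in\mathbb N$ such that for all $\kappa\ge2$, $0<\epsilon\le\frac12$, $\eta>0$, $V\ge0$, $\Delta>0$, $T\in\mathbb N$ there are two single-trajectory protocols, which depend on these numbers only, with the following property. For every $n$, $H$, $\beta$, $s$, every Gibbs sampler $\mathcal N$ with $t_{mix}(\eta)\le T$ and $gap(\mathcal N)\ge\Delta$,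 every Hermitian $O$ that commutes with $H$ and satisfies $\|O\|\le\kappa$ and $\mathbb V_{\rho_\beta}[O]\le V$, and every initial state, the output of either protocol differs from $\operatorname{tr}(O\rho_\beta)$ by less than $\epsilon$ with probability at least $1-2\eta$. The costs are as follows. 1. The first protocol measures after every application of $\mathcal N$ ($r=1$), and $$m\le C\left(\log\kappa+\log\log\epsilon^{-1}\right),\qquad t_{\mathcal N}\le T+C\,\frac{V+1}{\epsilon^2\eta\,\Delta},\qquad t_{\mathcal M}\le C\,\frac{V+1}{\epsilon^2\eta\,\Delta}\left((\log\epsilon^{-1})^a+(\log\kappa)^a\right).$$ 2. The second protocol uses the same measurement $\mathcal M$ but skips measurements, taking $r=\lceil1/\Delta\rceil$, and $$t_{\mathcal N}\le T+C\,\frac{V+1}{\epsilon^2\eta\,\Delta},\qquad t_{\mathcal M}\le C\,\frac{V+1}{\epsilon^2\eta}\left((\log\epsilon^{-1})^a+(\log\kappa)^a\right).$$ -/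

import Mathlib

open scoped Kronecker ComplexOrder

noncomputable section

namespace ThermalEst

/-- Operators on a `d`-dimensional Hilbert space. -/
abbrev Op (d : ℕ) := Matrix (Fin d) (Fin d) ℂ

/-! ### States, Gibbs states, norms -/

/-- Density matrices. -/
def IsState {d : ℕ} (ρ : Op d) : Prop := ρ.PosSemidef ∧ ρ.trace = 1

/-- The Gibbs state `exp (-β H) / tr (exp (-β H))`. -/
def gibbs {d : ℕ} (H : Op d) (β : ℝ) : Op d :=
  (NormedSpace.exp ((-(β : ℂ)) • H)).trace⁻¹ • NormedSpace.exp ((-(β : ℂ)) • H)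

/-- Real power `ρ ^ s` of a Hermitian matrix, by functional calculus. -/
def rpow {d : ℕ} (ρ : Op d) (s : ℝ) : Op d := cfc (fun x : ℝ => x ^ s) ρ

/-- Operator norm, with respect to the Euclidean norm. -/
def opNorm {d : ℕ} (A : Op d) : ℝ := ‖Matrix.toEuclideanCLM (𝕜 := ℂ) A‖

/-- Trace norm: the sum of the singular values. -/
def traceNorm {d : ℕ} (A : Op d) : ℝ :=
  ∑ i, Real.sqrt ((Matrix.isHermitian_conjTranspose_mul_self A).eigenvalues i)

/-- The expectation `tr (O ρ)`. -/
def expect {d : ℕ} (ρ O : Op d) : ℝ := (O * ρ).trace.re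

/-- The variance `tr (O² ρ) - (tr (O ρ))²`. -/
def variance {d : ℕ} (ρ O : Op d) : ℝ := expect ρ (O * O) - expect ρ O ^ 2

/-! ### Channels, detailed balance, spectral gap, mixing time -/

/-- Linear maps on operators. -/
abbrev SuperOp (d : ℕ) := Module.End ℂ (Op d)

/-- Quantum channels (completely positive and trace preserving maps), in Kraus form. -/
def IsChannel {d : ℕ} (T : SuperOp d) : Prop :=
  ∃ (k : ℕ) (K : Fin k → Op d),
    (∀ X, T X = ∑ u, K u * X * (K u).conjTranspose) ∧ ∑ u, (K u).conjTranspose * K u = 1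

/-- The dual (Heisenberg picture) of `T` for the Hilbert-Schmidt inner product
`tr (A† B)`; see `trace_conjTranspose_mul_dual` for the defining property. -/
def dual {d : ℕ} (T : SuperOp d) (B : Op d) : Op d :=
  Matrix.of fun i j => ((T (Matrix.single i j 1)).conjTranspose * B).trace

theorem trace_conjTranspose_mul_dual {d : ℕ} (T : SuperOp d) (A B : Op d) :
    (A.conjTranspose * dual T B).trace = ((T A).conjTranspose * B).trace := by
  have h : T A = ∑ i, ∑ j, A i j • T (Matrix.single i j 1) := by
    conv_lhs => rw [Matrix.matrix_eq_sum_single A]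
    simp only [map_sum]
    refine Finset.sum_congr rfl fun i _ => Finset.sum_congr rfl fun j _ => ?_
    rw [← map_smul, Matrix.smul_single, smul_eq_mul, mul_one]
  rw [h]
  simp only [Matrix.conjTranspose_sum, Matrix.conjTranspose_smul, Matrix.sum_mul,
    Matrix.trace_sum, Matrix.smul_mul, Matrix.trace_smul, smul_eq_mul]
  rw [Finset.sum_comm]
  simp only [Matrix.trace, Matrix.diag_apply, Matrix.mul_apply, Matrix.conjTranspose_apply, dual,
    Matrix.of_apply]

/-- The weighted inner product `⟨M, N⟩_s = tr (M† ρ^(1-s) N ρ^s)`. -/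
def weighted {d : ℕ} (ρ : Op d) (s : ℝ) (M N : Op d) : ℂ :=
  (M.conjTranspose * rpow ρ (1 - s) * N * rpow ρ s).trace

/-- `s`-detailed balance with respect to `ρ`. -/
def DetailedBalance {d : ℕ} (ρ : Op d) (s : ℝ) (T : SuperOp d) : Prop :=
  ∀ A B : Op d, weighted ρ s A (dual T B) = weighted ρ s (dual T A) B

/-- `N` is a channel that satisfies `s`-detailed balance with respect to `ρ`, has `ρ` as its unique
fixed state, and has its spectrum in `[0, 1]`. -/
structure IsGibbsSampler {d : ℕ} (ρ : Op d) (s : ℝ) (N : SuperOp d) : Prop where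
  channel : IsChannel N
  balance : DetailedBalance ρ s N
  fixed : N ρ = ρ
  unique : ∀ σ : Op d, IsState σ → N σ = σ → σ = ρ
  spectrum_subset : spectrum ℂ N ⊆ (fun x : ℝ => (x : ℂ)) '' Set.Icc 0 1

/-- The spectral gap: the distance from the eigenvalue `1` to the largest other eigenvalue (for maps
with real spectrum and simple largest eigenvalue `1`). -/
def gap {d : ℕ} (N : SuperOp d) : ℝ :=
  1 - sSup {x : ℝ | x ≠ 1 ∧ Module.End.HasEigenvalue N (x : ℂ)}

/-- The mixing time: the least number of applications of `N` that brings every initial state within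
trace norm distance `η` of `ρ`. -/
def mixingTime {d : ℕ} (ρ : Op d) (N : SuperOp d) (η : ℝ) : ℕ :=
  sInf {t : ℕ | ∀ σ : Op d, IsState σ → traceNorm ((N ^ t) σ - ρ) ≤ η}

/-! ### Measurement circuits -/

/-- Operations on a system together with `m` ancilla qubits. -/
inductive Gate (m : ℕ) where
  /-- A unitary on the ancilla register only. -/
  | ancilla (U : Matrix.unitaryGroup (Fin (2 ^ m)) ℂ)
  /-- Controlled Hamiltonian evolution of the observable: with the ancilla register in the basis
  state `ℓ`, the system evolves under `O` for the time `θ * (ℓ - 2 ^ m / 2)`. -/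
  | evolve (θ : ℝ)

/-- The matrix of a gate when the observable is `O`; system first, ancilla second. For `evolve θ` it
is `∑ ℓ, exp (-i θ (ℓ - 2 ^ m / 2) O) ⊗ |ℓ⟩⟨ℓ|`. -/
def Gate.toMatrix {m d : ℕ} (O : Op d) :
    Gate m → Matrix (Fin d × Fin (2 ^ m)) (Fin d × Fin (2 ^ m)) ℂ
  | .ancilla U => (1 : Op d) ⊗ₖ (U : Matrix (Fin (2 ^ m)) (Fin (2 ^ m)) ℂ)
  | .evolve θ => Matrix.blockDiagonal fun ℓ : Fin (2 ^ m) =>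
      NormedSpace.exp
        ((-Complex.I * ((θ * (((ℓ : ℕ) : ℝ) - 2 ^ m / 2) : ℝ) : ℂ)) • O)

/-- The controlled evolution time of a gate: the maximum of `|θ * (ℓ - 2 ^ m / 2)|` over `ℓ`. -/
def Gate.time {m : ℕ} : Gate m → ℝ
  | .ancilla _ => 0
  | .evolve θ => |θ| * (2 ^ m / 2)

/-- A measurement: ancillas are prepared in the zero state, the gates are applied from left to
right, the ancillas are measured in the computational basis with result `j`, and the real number
`readout j` is reported. Nothing here refers to the observable or to the system; the observable
enters only through the `evolve` gates. -/
structure Measurement where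
  ancillas : ℕ
  gates : List (Gate ancillas)
  readout : Fin (2 ^ ancillas) → ℝ

namespace Measurement

/-- The unitary of the whole circuit. -/
def unitary (M : Measurement) {d : ℕ} (O : Op d) :
    Matrix (Fin d × Fin (2 ^ M.ancillas)) (Fin d × Fin (2 ^ M.ancillas)) ℂ :=
  M.gates.foldl (fun A g => g.toMatrix O * A) 1

/-- The Kraus operator `(I ⊗ ⟨j|) U (I ⊗ |0⟩)` on the system that goes with the result `j`. -/
def kraus (M : Measurement) {d : ℕ} (O : Op d) (j : Fin (2 ^ M.ancillas)) : Op d :=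
  Matrix.of fun a b => M.unitary O (a, j) (b, ⟨0, by positivity⟩)

/-- The (unnormalized) system state after the result `j`. -/
def branch (M : Measurement) {d : ℕ} (O : Op d) (j : Fin (2 ^ M.ancillas)) (X : Op d) : Op d :=
  M.kraus O j * X * (M.kraus O j).conjTranspose

/-- The measurement channel, with the result forgotten. -/
def channel (M : Measurement) {d : ℕ} (O : Op d) (X : Op d) : Op d := ∑ j, M.branch O j X

/-- The controlled evolution time used by one run of the measurement. -/
def time (M : Measurement) : ℝ := (M.gates.map Gate.time).sum

end Measurement

/-! ### Single-trajectory estimation -/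

/-- A single-trajectory estimation protocol: apply the sampler `burnIn` times, then perform `rounds`
rounds, each of which consists of a measurement (whose result is recorded), `spacing` applications of
the sampler, and a second measurement (whose result is discarded). -/
structure Protocol where
  meas : Measurement
  burnIn : ℕ
  rounds : ℕ
  spacing : ℕ

namespace Protocol

/-- The number of ancilla qubits. -/
def ancillas (P : Protocol) : ℕ := P.meas.ancillas

/-- The total number of applications of the sampler. -/
def samplerTime (P : Protocol) : ℕ := P.burnIn + P.rounds * P.spacing

/-- The total controlled evolution time of the observable, two measurements per round. -/
def evolutionTime (P : Protocol) : ℝ := 2 * P.rounds * P.meas.time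

/-- One round in which the recorded result is `j`. -/
def round (P : Protocol) {d : ℕ} (O : Op d) (N : SuperOp d) (j : Fin (2 ^ P.meas.ancillas))
    (X : Op d) : Op d :=
  P.meas.channel O ((N ^ P.spacing) (P.meas.branch O j X))

/-- The rounds with a given list of recorded results. -/
def run (P : Protocol) {d : ℕ} (O : Op d) (N : SuperOp d) :
    List (Fin (2 ^ P.meas.ancillas)) → Op d → Op d
  | [], X => X
  | j :: js, X => run P O N js (round P O N j X)

/-- The probability of the sequence `e` of recorded results, from the initial state `σ`. -/
def prob (P : Protocol) {d : ℕ} (O : Op d) (N : SuperOp d) (σ : Op d)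
    (e : Fin P.rounds → Fin (2 ^ P.meas.ancillas)) : ℝ :=
  (P.run O N (List.ofFn e) ((N ^ P.burnIn) σ)).trace.re

/-- The output: the empirical average of the recorded outcomes. -/
def output (P : Protocol) (e : Fin P.rounds → Fin (2 ^ P.meas.ancillas)) : ℝ :=
  (∑ t, P.meas.readout (e t)) / P.rounds

open Classical in
/-- The probability that the output is within `ε` of `v`. -/
def successProb (P : Protocol) {d : ℕ} (O : Op d) (N : SuperOp d) (σ : Op d) (v ε : ℝ) : ℝ :=
  ∑ e with |P.output e - v| < ε, P.prob O N σ e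

end Protocol

/-- `P` estimates `tr (O ρ_β)` to precision `ε` with probability at least `1 - 2 η`, from every initial
state, for all systems of `n` qubits, all Hamiltonians `H`, all Gibbs samplers `N` with mixing time at
most `T` and gap at least `Δ`, and all observables `O` that commute with `H`, have norm at most `κ`
and thermal variance at most `V`. -/
def Estimates (P : Protocol) (κ ε η V Δ : ℝ) (T : ℕ) : Prop :=
  ∀ (n : ℕ) (H O : Op (2 ^ n)) (β s : ℝ) (N : SuperOp (2 ^ n)),
    H.IsHermitian → O.IsHermitian → Commute O H → opNorm O ≤ κ →
    0 ≤ s → s ≤ 1 → IsGibbsSampler (gibbs H β) s N →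
    variance (gibbs H β) O ≤ V → Δ ≤ gap N → mixingTime (gibbs H β) N η ≤ T →
    ∀ σ : Op (2 ^ n), IsState σ →
      1 - 2 * η ≤ P.successProb O N σ (expect (gibbs H β) O) ε

end ThermalEst

end

open scoped Kronecker ComplexOrder

noncomputable section

namespace ThermalEst

/-! ### Real powers of positive definite matrices -/

section Powers

variable {d : ℕ} {ρ : Op d}

/-! Measurement. Only the bias of a single outcome has to be of order `ε`; its mean square error may
stay of order one, because averaging pays for the variance `V` anyway. The ancillas start in a
slowly varying window on `2 ^ m` points. On an eigenvector of `O` with eigenvalue `x`, one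
controlled evolution with `θ = 1 / (2κ)` imprints a plane wave of frequency `θ x`. Translations act
on a plane wave as phases, so a Hermitian band matrix on the ancillas acts almost like a
trigonometric polynomial in `θ x`. Taking its coefficients from a Taylor polynomial of the logarithm
makes this polynomial equal to `x` up to an error exponentially small in its degree `D`. Dividing
each diagonal by the overlap of the window with its translate makes the mean outcome exactly the
polynomial, so `D` of order `log (κ / ε)` suffices for the bias. The smoothness of the window keeps
the mean square error below `2` once `2 ^ m` is of order `κ D ^ 2`. The evolution time is then of
order `D ^ 2`, with no factor `1 / ε` (`exists_isAccurate`, `exists_pointer`).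

Decay of correlations. The Kraus operators are functions of `O`, hence normal and commuting with
`ρ`. The measurement channel therefore fixes `ρ` and does not increase the weighted norm
(`weightedNorm_sum_conjBy_le`). Detailed balance makes the sampler similar to a symmetric operator,
and uniqueness of the fixed state makes it contract traceless operators by `1 - Δ`
(`IsGibbsSampler.weightedNorm_apply_le`). A whole round contracts by `(1 - Δ) ^ r`, so
autocorrelations decay geometrically (`norm_autocorrelation_le`), and for `(1 - Δ) ^ r ≤ q < 1` the
sum of `K` stationary outcomes has variance at most `K v (1 + 2 q / (1 - q))`
(`norm_secondMoment_roundMap_le`).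

Probability. Chebyshev's inequality in the stationary state costs one `η`, and the burn-in, which is
`η`-close to stationarity in trace norm, costs the other (`Protocol.one_sub_le_successProb`). With
`r = 1` the correlation factor is at most `2 / Δ`; with `r = ⌈1 / Δ⌉` one may take `q = 1 / 2` and
the factor is `3`, so `Δ` disappears from the number of measurements. -/

theorem rpow_isHermitian (ρ : Op d) (s : ℝ) : (rpow ρ s).IsHermitian :=
  cfc_predicate (fun x : ℝ => x ^ s) ρ

theorem rpow_commute (hρ : ρ.IsHermitian) {X : Op d} (h : Commute ρ X) (s : ℝ) :
    Commute (rpow ρ s) X :=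
  IsSelfAdjoint.commute_cfc (show IsSelfAdjoint ρ from hρ) h _

theorem spectrum_pos (hρ : ρ.PosDef) {x : ℝ} (hx : x ∈ spectrum ℝ ρ) : 0 < x := by
  rw [hρ.isHermitian.spectrum_real_eq_range_eigenvalues] at hx
  obtain ⟨i, rfl⟩ := hx
  exact hρ.eigenvalues_pos i

/-- The spectrum is finite, so continuity is automatic and the functional calculus covers negative
powers as well. -/
theorem continuousOn_spectrum (ρ : Op d) (f : ℝ → ℝ) : ContinuousOn f (spectrum ℝ ρ) :=
  (Matrix.finite_real_spectrum (A := ρ)).continuousOn f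

theorem rpow_mul_rpow (hρ : ρ.PosDef) (s t : ℝ) : rpow ρ s * rpow ρ t = rpow ρ (s + t) := by
  unfold rpow
  rw [← cfc_mul _ _ ρ (continuousOn_spectrum ρ _) (continuousOn_spectrum ρ _)]
  exact cfc_congr fun x hx => (Real.rpow_add (spectrum_pos hρ hx) s t).symm

theorem rpow_zero (hρ : ρ.PosDef) : rpow ρ 0 = 1 := by
  unfold rpow
  simp only [Real.rpow_zero]
  exact cfc_const_one ℝ ρ (ha := hρ.isHermitian)

theorem rpow_one (hρ : ρ.PosDef) : rpow ρ 1 = ρ := by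
  unfold rpow
  simp only [Real.rpow_one]
  exact cfc_id' ℝ ρ (ha := hρ.isHermitian)

theorem rpow_mul_rpow_neg (hρ : ρ.PosDef) (s : ℝ) : rpow ρ s * rpow ρ (-s) = 1 := by
  rw [rpow_mul_rpow hρ, add_neg_cancel, rpow_zero hρ]

theorem rpow_neg_mul_rpow (hρ : ρ.PosDef) (s : ℝ) : rpow ρ (-s) * rpow ρ s = 1 := by
  rw [rpow_mul_rpow hρ, neg_add_cancel, rpow_zero hρ]

end Powers

/-! ### Gibbs states -/

section Gibbs

variable {d : ℕ}

theorem posDef_exp {A : Op d} (hA : A.IsHermitian) : (NormedSpace.exp A).PosDef := by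
  have h : NormedSpace.exp A =
      (NormedSpace.exp ((1 / 2 : ℂ) • A)).conjTranspose * NormedSpace.exp ((1 / 2 : ℂ) • A) := by
    have hB : ((1 / 2 : ℂ) • A).IsHermitian := by
      unfold Matrix.IsHermitian
      rw [Matrix.conjTranspose_smul, hA.eq]
      simp
    rw [hB.exp.eq, ← Matrix.exp_add_of_commute _ _ (Commute.refl _), ← add_smul]
    norm_num
  rw [h]
  exact Matrix.PosDef.conjTranspose_mul_self _
    (Matrix.mulVec_injective_of_isUnit (Matrix.isUnit_exp _))

theorem neg_smul_isHermitian {H : Op d} (hH : H.IsHermitian) (β : ℝ) :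
    ((-(β : ℂ)) • H).IsHermitian := by
  unfold Matrix.IsHermitian
  rw [Matrix.conjTranspose_smul, hH.eq]
  simp

theorem gibbs_posDef [NeZero d] {H : Op d} (hH : H.IsHermitian) (β : ℝ) : (gibbs H β).PosDef := by
  have h := posDef_exp (neg_smul_isHermitian hH β)
  exact h.smul (inv_pos.2 h.trace_pos)

theorem gibbs_trace [NeZero d] {H : Op d} (hH : H.IsHermitian) (β : ℝ) :
    (gibbs H β).trace = 1 := by
  have h := posDef_exp (neg_smul_isHermitian hH β)
  rw [gibbs, Matrix.trace_smul, smul_eq_mul, inv_mul_cancel₀ h.trace_pos.ne']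

theorem gibbs_commute {H X : Op d} (h : Commute X H) (β : ℝ) : Commute (gibbs H β) X :=
  (((h.symm.smul_left (-(β : ℂ))).exp_left).smul_left _)

end Gibbs

/-! ### The Hilbert-Schmidt norm -/

section HilbertSchmidt

variable {d : ℕ}

/-- The Hilbert-Schmidt norm `√(tr (A† A))`. -/
def hsNorm (A : Op d) : ℝ := Real.sqrt (A.conjTranspose * A).trace.re

/-- Operators as vectors in a Hilbert space. -/
def vec : Op d ≃ₗ[ℂ] EuclideanSpace ℂ (Fin d × Fin d) :=
  (LinearEquiv.curry ℂ ℂ (Fin d) (Fin d)).symm.trans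
    (WithLp.linearEquiv 2 ℂ (Fin d × Fin d → ℂ)).symm

theorem vec_apply (A : Op d) (p : Fin d × Fin d) : vec A p = A p.1 p.2 := rfl

theorem inner_vec (A B : Op d) : inner ℂ (vec A) (vec B) = (A.conjTranspose * B).trace := by
  rw [PiLp.inner_apply, Fintype.sum_prod_type, Finset.sum_comm]
  simp only [vec_apply, Matrix.trace, Matrix.diag_apply, Matrix.mul_apply,
    Matrix.conjTranspose_apply, RCLike.inner_apply]
  exact Finset.sum_congr rfl fun i _ => Finset.sum_congr rfl fun j _ => mul_comm _ _

theorem norm_vec (A : Op d) : ‖vec A‖ = hsNorm A := by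
  rw [@norm_eq_sqrt_re_inner ℂ, inner_vec]
  rfl

theorem hsNorm_nonneg (A : Op d) : 0 ≤ hsNorm A := Real.sqrt_nonneg _

theorem hsNorm_sq (A : Op d) : hsNorm A ^ 2 = (A.conjTranspose * A).trace.re := by
  rw [← inner_vec, ← norm_vec]
  exact (inner_self_eq_norm_sq (𝕜 := ℂ) (vec A)).symm

theorem norm_trace_le (A B : Op d) :
    ‖(A.conjTranspose * B).trace‖ ≤ hsNorm A * hsNorm B := by
  rw [← inner_vec, ← norm_vec, ← norm_vec]
  exact norm_inner_le_norm _ _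

/-- With `Y` the image of `X`, `‖Y‖²` is the sum of the inner products of `K j† Y` and `X K j†`. By
Cauchy-Schwarz it is at most `‖Y‖ ‖X‖`: unitality evaluates the first family of norms, trace
preservation the second. -/
theorem hsNorm_kraus_le {ι : Type*} [Fintype ι] (K : ι → Op d)
    (h₁ : ∑ j, (K j).conjTranspose * K j = 1) (h₂ : ∑ j, K j * (K j).conjTranspose = 1)
    (X : Op d) : hsNorm (∑ j, K j * X * (K j).conjTranspose) ≤ hsNorm X := by
  set Y := ∑ j, K j * X * (K j).conjTranspose with hY
  have e1 : ∀ Z : Op d, ∑ j, hsNorm ((K j).conjTranspose * Z) ^ 2 = hsNorm Z ^ 2 := by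
    intro Z
    simp only [hsNorm_sq, ← Complex.re_sum, ← Matrix.trace_sum]
    congr 2
    calc _ = Z.conjTranspose * (∑ j, K j * (K j).conjTranspose) * Z := by
          rw [Matrix.mul_sum, Matrix.sum_mul]
          refine Finset.sum_congr rfl fun j _ => ?_
          simp [Matrix.mul_assoc]
      _ = _ := by rw [h₂, mul_one]
  have e2 : ∑ j, hsNorm (X * (K j).conjTranspose) ^ 2 = hsNorm X ^ 2 := by
    simp only [hsNorm_sq, ← Complex.re_sum, ← Matrix.trace_sum]
    congr 1
    calc _ = ∑ j, (X.conjTranspose * X * ((K j).conjTranspose * K j)).trace := by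
          rw [Matrix.trace_sum]
          refine Finset.sum_congr rfl fun j _ => ?_
          rw [Matrix.conjTranspose_mul, Matrix.conjTranspose_conjTranspose, Matrix.mul_assoc,
            Matrix.trace_mul_comm, Matrix.mul_assoc, Matrix.mul_assoc, Matrix.mul_assoc]
      _ = _ := by rw [← Matrix.trace_sum, ← Matrix.mul_sum, h₁, mul_one]
  have e3 : hsNorm Y ^ 2 ≤ ∑ j, hsNorm ((K j).conjTranspose * Y) *
      hsNorm (X * (K j).conjTranspose) := by
    rw [hsNorm_sq]
    have : (Y.conjTranspose * Y).trace =
        ∑ j, (((K j).conjTranspose * Y).conjTranspose * (X * (K j).conjTranspose)).trace := by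
      conv_lhs => rw [hY, Matrix.mul_sum, Matrix.trace_sum]
      refine Finset.sum_congr rfl fun j _ => ?_
      simp [Matrix.mul_assoc, hY]
    rw [this, Complex.re_sum]
    exact Finset.sum_le_sum fun j _ => (Complex.re_le_norm _).trans (norm_trace_le _ _)
  have e4 := Finset.sum_mul_sq_le_sq_mul_sq Finset.univ
    (fun j => hsNorm ((K j).conjTranspose * Y)) (fun j => hsNorm (X * (K j).conjTranspose))
  rw [e1, e2] at e4
  have hX := hsNorm_nonneg X
  have hY0 := hsNorm_nonneg Y
  have e5 : (hsNorm Y ^ 2) ^ 2 ≤ hsNorm Y ^ 2 * hsNorm X ^ 2 :=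
    (pow_le_pow_left₀ (sq_nonneg _) e3 2).trans e4
  rcases hY0.eq_or_lt with h | h
  · rw [← h]; exact hX
  · refine le_of_sq_le_sq ?_ hX |>.trans le_rfl
    nlinarith [pow_pos h 2]

end HilbertSchmidt

/-! ### Symmetric operators with a spectral gap -/

/-- In an orthonormal eigenbasis, every basis vector with eigenvalue `1` is a multiple of `v`, so
`w` has no component along it; all other components shrink by `q`. -/
theorem norm_le_of_symmetric_gap {E : Type*} [NormedAddCommGroup E] [InnerProductSpace ℂ E]
    [FiniteDimensional ℂ E] {T : E →ₗ[ℂ] E} (hT : T.IsSymmetric) {v : E} {q : ℝ} (hq : 0 ≤ q)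
    (hfix : ∀ w, T w = w → ∃ c : ℂ, w = c • v)
    (heig : ∀ μ : ℝ, μ ≠ 1 → Module.End.HasEigenvalue T (μ : ℂ) → |μ| ≤ q)
    {w : E} (hw : inner ℂ v w = 0) : ‖T w‖ ≤ q * ‖w‖ := by
  have hn : Module.finrank ℂ E = Module.finrank ℂ E := rfl
  set b := hT.eigenvectorBasis hn with hb
  have h1 : ∀ i, ‖b.repr (T w) i‖ ≤ q * ‖b.repr w i‖ := by
    intro i
    rw [hb, hT.eigenvectorBasis_apply_self_apply hn, norm_mul]
    by_cases h : hT.eigenvalues hn i = 1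
    · have h2 : T (b i) = b i := by
        rw [hb, hT.apply_eigenvectorBasis hn, h]; simp
      obtain ⟨c, hc⟩ := hfix _ h2
      have h3 : b.repr w i = 0 := by
        rw [b.repr_apply_apply, hc, inner_smul_left, hw, mul_zero]
      rw [hb] at h3
      simp [h3]
    · refine mul_le_mul_of_nonneg_right ?_ (norm_nonneg _)
      simpa using heig _ h (hT.hasEigenvalue_eigenvalues hn i)
  rw [← b.repr.norm_map (T w), ← b.repr.norm_map w, EuclideanSpace.norm_eq, EuclideanSpace.norm_eq]
  rw [← Real.sqrt_sq hq, ← Real.sqrt_mul (sq_nonneg q), Finset.mul_sum]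
  refine Real.sqrt_le_sqrt (Finset.sum_le_sum fun i _ => ?_)
  rw [← mul_pow]
  exact pow_le_pow_left₀ (norm_nonneg _) (h1 i) 2

/-! ### Channels and Gibbs samplers -/

section Sampler

variable {d : ℕ} {ρ : Op d} {s : ℝ} {N : SuperOp d}

theorem IsChannel.trace_apply (hN : IsChannel N) (X : Op d) : (N X).trace = X.trace := by
  obtain ⟨k, K, h, h1⟩ := hN
  rw [h, Matrix.trace_sum]
  simp only [fun u => Matrix.trace_mul_cycle (K u) X (K u).conjTranspose]
  rw [← Matrix.trace_sum, ← Matrix.sum_mul, h1, one_mul]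

theorem IsChannel.conjTranspose_apply (hN : IsChannel N) (X : Op d) :
    (N X).conjTranspose = N X.conjTranspose := by
  obtain ⟨k, K, h, h1⟩ := hN
  rw [h, h, Matrix.conjTranspose_sum]
  simp [Matrix.mul_assoc]

theorem IsChannel.posSemidef_apply (hN : IsChannel N) {X : Op d} (hX : X.PosSemidef) :
    (N X).PosSemidef := by
  obtain ⟨k, K, h, h1⟩ := hN
  rw [h]
  exact Matrix.posSemidef_sum _ fun u _ => hX.mul_mul_conjTranspose_same _

theorem IsChannel.pow_trace_apply (hN : IsChannel N) (t : ℕ) (X : Op d) :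
    ((N ^ t) X).trace = X.trace := by
  induction t with
  | zero => simp
  | succ t ih => rw [pow_succ', Module.End.mul_apply, hN.trace_apply, ih]

theorem IsChannel.pow_posSemidef_apply (hN : IsChannel N) (t : ℕ) {X : Op d}
    (hX : X.PosSemidef) : ((N ^ t) X).PosSemidef := by
  induction t with
  | zero => simpa
  | succ t ih => rw [pow_succ', Module.End.mul_apply]; exact hN.posSemidef_apply ih

theorem IsChannel.pow_isState_apply (hN : IsChannel N) (t : ℕ) {σ : Op d} (hσ : IsState σ) :
    IsState ((N ^ t) σ) :=
  ⟨hN.pow_posSemidef_apply t hσ.1, by rw [hN.pow_trace_apply, hσ.2]⟩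

theorem exists_add_smul_one_posSemidef {Y : Op d} (hY : Y.IsHermitian) :
    ∃ c : ℝ, (Y + (c : ℂ) • (1 : Op d)).PosSemidef := by
  refine ⟨∑ i, |hY.eigenvalues i|, ?_⟩
  set c := ∑ i, |hY.eigenvalues i| with hc
  have h : Y + (c : ℂ) • (1 : Op d) = (hY.eigenvectorUnitary : Op d) *
      Matrix.diagonal (fun i => ((hY.eigenvalues i + c : ℝ) : ℂ)) *
      (hY.eigenvectorUnitary : Op d).conjTranspose := by
    have h1 : Matrix.diagonal (fun i => ((hY.eigenvalues i + c : ℝ) : ℂ)) =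
        Matrix.diagonal (RCLike.ofReal ∘ hY.eigenvalues) + (c : ℂ) • (1 : Op d) := by
      ext i j
      by_cases hij : i = j <;> simp [hij]
    have h2 : (hY.eigenvectorUnitary : Op d) * (hY.eigenvectorUnitary : Op d).conjTranspose = 1 :=
      Unitary.coe_mul_star_self _
    conv_lhs => rw [hY.spectral_theorem]
    rw [h1, Unitary.conjStarAlgAut_apply, mul_add, add_mul, mul_smul_comm, smul_mul_assoc, mul_one,
      h2]
    rfl
  rw [h]
  refine Matrix.PosSemidef.mul_mul_conjTranspose_same (Matrix.PosSemidef.diagonal fun i => ?_) _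
  have h3 : |hY.eigenvalues i| ≤ c :=
    Finset.single_le_sum (fun i _ => abs_nonneg (hY.eigenvalues i)) (Finset.mem_univ i)
  have : 0 ≤ hY.eigenvalues i + c := by linarith [neg_abs_le (hY.eigenvalues i)]
  exact Complex.zero_le_real.2 this

/-- Uniqueness of the fixed point is assumed among states only. Adding a multiple of `ρ` turns a
Hermitian fixed point into a positive one, to which it applies. Conjugation by `ρ ^ (-1/2)` reduces
the claim to a shift by the identity. -/
theorem exists_add_smul_posSemidef (hρ : ρ.PosDef) {X : Op d} (hX : X.IsHermitian) :
    ∃ c : ℝ, (X + (c : ℂ) • ρ).PosSemidef := by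
  set R := rpow ρ (1 / 2)
  set R' := rpow ρ (-(1 / 2))
  have hR : R.conjTranspose = R := rpow_isHermitian _ _
  have hR' : R'.conjTranspose = R' := rpow_isHermitian _ _
  have h1 : R * R' = 1 := rpow_mul_rpow_neg hρ _
  have h2 : R' * R = 1 := rpow_neg_mul_rpow hρ _
  have h3 : R * R = ρ := by
    rw [rpow_mul_rpow hρ]; norm_num [rpow_one hρ]
  have hY : (R' * X * R').IsHermitian := by
    unfold Matrix.IsHermitian
    rw [Matrix.conjTranspose_mul, Matrix.conjTranspose_mul, hX.eq, hR', mul_assoc]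
  obtain ⟨c, hc⟩ := exists_add_smul_one_posSemidef hY
  refine ⟨c, ?_⟩
  have h4 := hc.mul_mul_conjTranspose_same R
  have h5 : R * (R' * X * R' + (c : ℂ) • (1 : Op d)) * R.conjTranspose = X + (c : ℂ) • ρ := by
    rw [hR, mul_add, add_mul, mul_smul_comm, smul_mul_assoc, mul_one, h3]
    congr 1
    calc _ = (R * R') * X * (R' * R) := by simp only [mul_assoc]
      _ = X := by rw [h1, h2, one_mul, mul_one]
  rwa [h5] at h4

theorem IsGibbsSampler.exists_eq_smul_of_isHermitian (hN : IsGibbsSampler ρ s N) (hρ : ρ.PosDef)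
    {X : Op d} (hX : X.IsHermitian) (h : N X = X) : ∃ c : ℂ, X = c • ρ := by
  obtain ⟨c, hc⟩ := exists_add_smul_posSemidef hρ hX
  set Z := X + (c : ℂ) • ρ with hZ
  have hXZ : X = Z - (c : ℂ) • ρ := by rw [hZ]; abel
  have hNZ : N Z = Z := by rw [hZ, map_add, map_smul, h, hN.fixed]
  -- Normalizing `Z` to a state needs a nonzero trace; a positive operator of trace zero vanishes.
  by_cases h0 : Z.trace = 0
  · refine ⟨-c, ?_⟩
    rw [hc.trace_eq_zero_iff] at h0
    rw [hXZ, h0, zero_sub, neg_smul]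
  · have hσ : IsState (Z.trace⁻¹ • Z) :=
      ⟨hc.smul (inv_nonneg.2 hc.trace_nonneg), by
        rw [Matrix.trace_smul, smul_eq_mul, inv_mul_cancel₀ h0]⟩
    have h1 := hN.unique _ hσ (by rw [map_smul, hNZ])
    refine ⟨Z.trace - c, ?_⟩
    rw [sub_smul, ← h1, smul_smul, mul_inv_cancel₀ h0, one_smul, h1, hXZ]

/-- A channel commutes with the adjoint, so the Hermitian and anti-Hermitian parts of a fixed point
are fixed separately. -/
theorem IsGibbsSampler.exists_eq_smul (hN : IsGibbsSampler ρ s N) (hρ : ρ.PosDef)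
    {X : Op d} (h : N X = X) : ∃ c : ℂ, X = c • ρ := by
  have hX' : N X.conjTranspose = X.conjTranspose := by
    rw [← hN.channel.conjTranspose_apply, h]
  obtain ⟨a, ha⟩ := hN.exists_eq_smul_of_isHermitian hρ (X := X + X.conjTranspose)
    (by unfold Matrix.IsHermitian; simp [add_comm]) (by rw [map_add, h, hX'])
  obtain ⟨b, hb⟩ := hN.exists_eq_smul_of_isHermitian hρ
    (X := Complex.I • (X - X.conjTranspose))
    (by unfold Matrix.IsHermitian; simp [Matrix.conjTranspose_smul, ← smul_neg])
    (by rw [map_smul, map_sub, h, hX'])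
  refine ⟨a / 2 - b * Complex.I / 2, ?_⟩
  have h1 : (2 : ℂ) • X = (X + X.conjTranspose) - Complex.I • Complex.I • (X - X.conjTranspose) := by
    rw [smul_smul, Complex.I_mul_I, two_smul, neg_smul, one_smul]; abel
  rw [ha, hb] at h1
  have h2 : X = (1 / 2 : ℂ) • ((2 : ℂ) • X) := by rw [smul_smul]; norm_num
  rw [h2, h1, ← sub_eq_zero]
  module

/-- The map `X ↦ A X B`. -/
def sandwich (A B : Op d) : SuperOp d := LinearMap.mulLeft ℂ A ∘ₗ LinearMap.mulRight ℂ B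

theorem sandwich_apply (A B X : Op d) : sandwich A B X = A * X * B := by
  simp [sandwich, mul_assoc]

/-- The similarity that turns detailed balance into symmetry for the Hilbert-Schmidt product. -/
def toWeighted (ρ : Op d) (s : ℝ) : SuperOp d := sandwich (rpow ρ ((1 - s) / 2)) (rpow ρ (s / 2))

/-- The inverse of `toWeighted`. -/
def ofWeighted (ρ : Op d) (s : ℝ) : SuperOp d :=
  sandwich (rpow ρ (-((1 - s) / 2))) (rpow ρ (-(s / 2)))

theorem toWeighted_ofWeighted (hρ : ρ.PosDef) (s : ℝ) (X : Op d) :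
    toWeighted ρ s (ofWeighted ρ s X) = X := by
  rw [toWeighted, ofWeighted, sandwich_apply, sandwich_apply]
  calc _ = (rpow ρ ((1 - s) / 2) * rpow ρ (-((1 - s) / 2))) * X *
        (rpow ρ (-(s / 2)) * rpow ρ (s / 2)) := by simp only [mul_assoc]
    _ = X := by rw [rpow_mul_rpow_neg hρ, rpow_neg_mul_rpow hρ, one_mul, mul_one]

theorem ofWeighted_toWeighted (hρ : ρ.PosDef) (s : ℝ) (X : Op d) :
    ofWeighted ρ s (toWeighted ρ s X) = X := by
  rw [toWeighted, ofWeighted, sandwich_apply, sandwich_apply]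
  calc _ = (rpow ρ (-((1 - s) / 2)) * rpow ρ ((1 - s) / 2)) * X *
        (rpow ρ (s / 2) * rpow ρ (-(s / 2))) := by simp only [mul_assoc]
    _ = X := by rw [rpow_mul_rpow_neg hρ, rpow_neg_mul_rpow hρ, one_mul, mul_one]

theorem ofWeighted_self (hρ : ρ.PosDef) (s : ℝ) : ofWeighted ρ s ρ = rpow ρ (1 / 2) := by
  rw [ofWeighted, sandwich_apply]
  nth_rw 2 [← rpow_one hρ]
  rw [rpow_mul_rpow hρ, rpow_mul_rpow hρ]
  congr 1
  ring

/-- The sampler after the similarity `toWeighted`. -/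
def symmetrized (ρ : Op d) (s : ℝ) (N : SuperOp d) : SuperOp d :=
  ofWeighted ρ s * N * toWeighted ρ s

theorem symmetrized_apply (ρ : Op d) (s : ℝ) (N : SuperOp d) (X : Op d) :
    symmetrized ρ s N X = ofWeighted ρ s (N (toWeighted ρ s X)) := rfl

theorem star_weighted (ρ : Op d) (s : ℝ) (A B : Op d) :
    star (weighted ρ s A B) = weighted ρ s B A := by
  rw [weighted, weighted, ← Matrix.trace_conjTranspose]
  simp only [Matrix.conjTranspose_mul, Matrix.conjTranspose_conjTranspose,
    (rpow_isHermitian ρ _).eq]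
  rw [Matrix.trace_mul_comm]
  simp only [Matrix.mul_assoc]

/-- This carries the Hilbert-Schmidt form of the symmetrized sampler to the weighted form of `dual
N`, where detailed balance can be applied. -/
theorem trace_conjTranspose_mul_symmetrized (hρ : ρ.PosDef) (s : ℝ) (N : SuperOp d) (A B : Op d) :
    (A.conjTranspose * symmetrized ρ s N B).trace =
      weighted ρ s (dual N (ofWeighted ρ s A)) (ofWeighted ρ s B) := by
  set B' := ofWeighted ρ s B with hB'
  set A' := ofWeighted ρ s A with hA'
  have h1 : toWeighted ρ s B = rpow ρ (1 - s) * B' * rpow ρ s := by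
    rw [← toWeighted_ofWeighted hρ s B, ← hB', toWeighted, sandwich_apply, sandwich_apply]
    calc _ = (rpow ρ ((1 - s) / 2) * rpow ρ ((1 - s) / 2)) * B' *
          (rpow ρ (s / 2) * rpow ρ (s / 2)) := by simp only [mul_assoc]
      _ = _ := by rw [rpow_mul_rpow hρ, rpow_mul_rpow hρ, add_halves, add_halves]
  have h2 : (A.conjTranspose * symmetrized ρ s N B).trace =
      (A'.conjTranspose * N (toWeighted ρ s B)).trace := by
    rw [symmetrized_apply, hA', ofWeighted, sandwich_apply, sandwich_apply]
    simp only [Matrix.conjTranspose_mul, (rpow_isHermitian ρ _).eq]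
    rw [← mul_assoc, Matrix.trace_mul_comm]
    simp only [mul_assoc]
  have h3 : star (A'.conjTranspose * N (toWeighted ρ s B)).trace =
      star (weighted ρ s (dual N A') B') := by
    rw [star_weighted, ← Matrix.trace_conjTranspose]
    simp only [Matrix.conjTranspose_mul, Matrix.conjTranspose_conjTranspose]
    rw [← trace_conjTranspose_mul_dual, h1, weighted]
    simp only [Matrix.conjTranspose_mul, (rpow_isHermitian ρ _).eq]
    rw [Matrix.trace_mul_comm]
    simp only [mul_assoc]
    rw [← mul_assoc, Matrix.trace_mul_comm]
    simp only [mul_assoc]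
  rw [h2]
  exact star_injective h3

theorem symmetrized_symmetric (hρ : ρ.PosDef) (hN : DetailedBalance ρ s N) (A B : Op d) :
    ((symmetrized ρ s N A).conjTranspose * B).trace =
      (A.conjTranspose * symmetrized ρ s N B).trace := by
  rw [trace_conjTranspose_mul_symmetrized hρ, ← hN]
  apply star_injective
  rw [star_weighted, ← trace_conjTranspose_mul_symmetrized hρ, ← Matrix.trace_conjTranspose]
  simp

/-- The Hilbert-Schmidt norm after the similarity `ofWeighted`. -/
def weightedNorm (ρ : Op d) (s : ℝ) (X : Op d) : ℝ := hsNorm (ofWeighted ρ s X)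

/-- The fixed vector of the symmetrized sampler is `ρ ^ (1/2)`, so traceless operators become
exactly the vectors orthogonal to it. -/
theorem trace_rpow_mul_ofWeighted (hρ : ρ.PosDef) (s : ℝ) (X : Op d) :
    ((rpow ρ (1 / 2)).conjTranspose * ofWeighted ρ s X).trace = X.trace := by
  rw [(rpow_isHermitian ρ _).eq, ofWeighted, sandwich_apply]
  simp only [← mul_assoc]
  rw [rpow_mul_rpow hρ, Matrix.trace_mul_comm, ← mul_assoc, rpow_mul_rpow hρ]
  have : -(s / 2) + (1 / 2 + -((1 - s) / 2)) = 0 := by ring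
  rw [this, rpow_zero hρ, one_mul]

theorem IsGibbsSampler.eigenvalue_mem (hN : IsGibbsSampler ρ s N) {μ : ℝ}
    (h : Module.End.HasEigenvalue N (μ : ℂ)) : 0 ≤ μ ∧ μ ≤ 1 := by
  obtain ⟨x, hx, hxμ⟩ := hN.spectrum_subset h.mem_spectrum
  have : x = μ := Complex.ofReal_injective hxμ
  subst this
  exact hx

theorem IsGibbsSampler.eigenvalue_le (hN : IsGibbsSampler ρ s N) {μ : ℝ} (h1 : μ ≠ 1)
    (h : Module.End.HasEigenvalue N (μ : ℂ)) : μ ≤ 1 - gap N := by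
  rw [gap, sub_sub_cancel]
  exact le_csSup ⟨1, fun x hx => (hN.eigenvalue_mem hx.2).2⟩ ⟨h1, h⟩

theorem IsGibbsSampler.gap_le_one (hN : IsGibbsSampler ρ s N) : gap N ≤ 1 := by
  rw [gap, sub_le_self_iff]
  -- If `1` is the only eigenvalue, the set is empty and its `sSup` is `0`, which the lemma covers
  -- too.
  exact Real.sSup_nonneg fun x hx => (hN.eigenvalue_mem hx.2).1

/-- Symmetry comes from detailed balance. The similarity transports eigenvectors, so the symmetrized
sampler has only eigenvalues of `N`, those other than `1` lie in `[0, 1 - Δ]`, and its fixed space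
is spanned by `ρ ^ (1/2)`. -/
theorem IsGibbsSampler.weightedNorm_apply_le (hN : IsGibbsSampler ρ s N) (hρ : ρ.PosDef) {Δ : ℝ}
    (hΔ : Δ ≤ gap N) {X : Op d} (hX : X.trace = 0) :
    weightedNorm ρ s (N X) ≤ (1 - Δ) * weightedNorm ρ s X := by
  set T : EuclideanSpace ℂ (Fin d × Fin d) →ₗ[ℂ] EuclideanSpace ℂ (Fin d × Fin d) :=
    vec.toLinearMap ∘ₗ symmetrized ρ s N ∘ₗ vec.symm.toLinearMap with hT
  have hTv : ∀ A, T (vec A) = vec (symmetrized ρ s N A) := by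
    intro A; simp [hT]
  have hS : T.IsSymmetric := by
    intro x y
    obtain ⟨A, rfl⟩ := vec.surjective x
    obtain ⟨B, rfl⟩ := vec.surjective y
    rw [hTv, hTv, inner_vec, inner_vec, symmetrized_symmetric hρ hN.balance]
  have hker : ∀ A : Op d, ∀ c : ℂ, symmetrized ρ s N A = c • A →
      N (toWeighted ρ s A) = c • toWeighted ρ s A := by
    intro A c h
    rw [symmetrized_apply] at h
    rw [← map_smul, ← h, toWeighted_ofWeighted hρ]
  have h1 := norm_le_of_symmetric_gap hS (v := vec (rpow ρ (1 / 2))) (q := 1 - Δ)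
    (by linarith [hN.gap_le_one])
    (by
      intro w hw
      obtain ⟨A, rfl⟩ := vec.surjective w
      rw [hTv] at hw
      have h := hker A 1 (by rw [one_smul]; exact vec.injective hw)
      rw [one_smul] at h
      obtain ⟨c, hc⟩ := hN.exists_eq_smul hρ h
      refine ⟨c, ?_⟩
      rw [← map_smul, ← ofWeighted_self hρ s, ← map_smul, ← hc, ofWeighted_toWeighted hρ])
    (by
      intro μ h1 hμ
      obtain ⟨w, hw⟩ := hμ.exists_hasEigenvector
      obtain ⟨A, rfl⟩ := vec.surjective w
      have h2 := hw.apply_eq_smul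
      rw [hTv, ← map_smul] at h2
      have h3 := hker A μ (vec.injective h2)
      have h4 : Module.End.HasEigenvalue N (μ : ℂ) :=
        Module.End.hasEigenvalue_of_hasEigenvector (x := toWeighted ρ s A) <|
          Module.End.hasEigenvector_iff.2 ⟨Module.End.mem_eigenspace_iff.2 h3, fun h0 => by
            apply hw.2
            rw [← ofWeighted_toWeighted hρ s A, h0, map_zero, map_zero]⟩
      rw [abs_of_nonneg (hN.eigenvalue_mem h4).1]
      linarith [hN.eigenvalue_le h1 h4])
    (w := vec (ofWeighted ρ s X))
    (by rw [inner_vec, trace_rpow_mul_ofWeighted hρ, hX])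
  rw [hTv, norm_vec, norm_vec, symmetrized_apply, toWeighted_ofWeighted hρ] at h1
  exact h1

theorem IsGibbsSampler.weightedNorm_pow_apply_le (hN : IsGibbsSampler ρ s N) (hρ : ρ.PosDef)
    {Δ : ℝ} (hΔ : Δ ≤ gap N) {X : Op d} (hX : X.trace = 0) (t : ℕ) :
    weightedNorm ρ s ((N ^ t) X) ≤ (1 - Δ) ^ t * weightedNorm ρ s X := by
  induction t with
  | zero => simp
  | succ t ih =>
    rw [pow_succ', Module.End.mul_apply, pow_succ', mul_assoc]
    have h1 : 0 ≤ 1 - Δ := by linarith [hN.gap_le_one]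
    exact (hN.weightedNorm_apply_le hρ hΔ (by rw [hN.channel.pow_trace_apply, hX])).trans
      (mul_le_mul_of_nonneg_left ih h1)

theorem IsGibbsSampler.pow_fixed (hN : IsGibbsSampler ρ s N) (t : ℕ) : (N ^ t) ρ = ρ := by
  induction t with
  | zero => simp
  | succ t ih => rw [pow_succ', Module.End.mul_apply, ih, hN.fixed]

end Sampler

/-! ### Trace norm and mixing -/

section TraceNorm

variable {d : ℕ}

theorem trace_cfc {A : Op d} (hA : A.IsHermitian) (f : ℝ → ℝ) :
    (cfc f A).trace = ((∑ i, f (hA.eigenvalues i) : ℝ) : ℂ) := by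
  rw [hA.cfc_eq, Matrix.IsHermitian.cfc, Unitary.conjStarAlgAut_apply, Matrix.trace_mul_cycle,
    Unitary.coe_star_mul_self, one_mul, Matrix.trace_diagonal]
  simp

theorem cfc_sq {A : Op d} (hA : A.IsHermitian) : cfc (fun x : ℝ => x ^ 2) A = A * A := by
  have hA' : IsSelfAdjoint A := hA
  rw [cfc_pow_id (R := ℝ) A 2, pow_two]

theorem traceNorm_of_isHermitian {A : Op d} (hA : A.IsHermitian) :
    traceNorm A = ∑ i, |hA.eigenvalues i| := by
  have hA' : IsSelfAdjoint A := hA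
  have h1 := trace_cfc (Matrix.isHermitian_conjTranspose_mul_self A) Real.sqrt
  have h2 : cfc Real.sqrt (A.conjTranspose * A) = cfc (fun x : ℝ => |x|) A := by
    rw [hA.eq, ← cfc_sq hA, ← cfc_comp' Real.sqrt (fun x : ℝ => x ^ 2) A
      Real.continuous_sqrt.continuousOn (continuousOn_spectrum _ _)]
    simp only [Real.sqrt_sq_eq_abs]
  rw [h2, trace_cfc hA] at h1
  exact (Complex.ofReal_injective h1).symm

theorem traceNorm_le_hsNorm (A : Op d) : traceNorm A ≤ Real.sqrt d * hsNorm A := by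
  set hB := Matrix.isHermitian_conjTranspose_mul_self A
  have h0 : ∀ i, 0 ≤ hB.eigenvalues i :=
    (Matrix.posSemidef_conjTranspose_mul_self A).eigenvalues_nonneg
  have h1 := Finset.sum_mul_sq_le_sq_mul_sq Finset.univ (fun _ : Fin d => (1 : ℝ))
    (fun i => Real.sqrt (hB.eigenvalues i))
  have h2 : ∑ i, hB.eigenvalues i = (A.conjTranspose * A).trace.re := by
    rw [hB.trace_eq_sum_eigenvalues]
    simp
  simp only [one_mul, one_pow, Finset.sum_const, Finset.card_univ, Fintype.card_fin, nsmul_eq_mul,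
    mul_one, Real.sq_sqrt (h0 _), h2] at h1
  rw [hsNorm, ← Real.sqrt_mul (Nat.cast_nonneg d)]
  exact Real.le_sqrt_of_sq_le h1

theorem hsNorm_le_one_of_isState {σ : Op d} (hσ : IsState σ) : hsNorm σ ≤ 1 := by
  have hH := hσ.1.isHermitian
  have h1 : ∑ i, hH.eigenvalues i = 1 := by
    have := hH.trace_eq_sum_eigenvalues
    rw [hσ.2] at this
    exact (Complex.ofReal_injective (by simpa using this)).symm
  rw [hsNorm, hH.eq, ← cfc_sq hH, trace_cfc hH, Complex.ofReal_re, Real.sqrt_le_one]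
  refine le_trans ?_ h1.le
  refine Finset.sum_le_sum fun i _ => ?_
  have h2 : hH.eigenvalues i ≤ 1 := by
    rw [← h1]
    exact Finset.single_le_sum (fun i _ => hσ.1.eigenvalues_nonneg i) (Finset.mem_univ i)
  nlinarith [hσ.1.eigenvalues_nonneg i]

/-- A linear functional with values in `[0, 1]` on states is bounded by the trace norm on Hermitian
operators. -/
theorem abs_re_le_traceNorm (g : Op d →ₗ[ℂ] ℂ) (h0 : ∀ σ, IsState σ → 0 ≤ (g σ).re)
    (h1 : ∀ σ, IsState σ → (g σ).re ≤ 1) {X : Op d} (hX : X.IsHermitian) :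
    |(g X).re| ≤ traceNorm X := by
  set U := (hX.eigenvectorUnitary : Op d) with hU
  have hUU : U.conjTranspose * U = 1 := Unitary.coe_star_mul_self _
  -- The rank-one spectral projections are states, so `g` weights each eigenvalue by a number in
  -- `[0, 1]`.
  set P : Fin d → Op d := fun i => U * Matrix.single i i 1 * U.conjTranspose with hP
  have hPs : ∀ i, IsState (P i) := by
    intro i
    constructor
    · refine Matrix.PosSemidef.mul_mul_conjTranspose_same ?_ _
      rw [← Matrix.diagonal_single]
      refine Matrix.PosSemidef.diagonal fun j => ?_
      by_cases h : j = i
      · subst h; simp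
      · simp [h]
    · rw [hP, Matrix.trace_mul_cycle, hUU, one_mul, Matrix.trace_single_eq_same]
  have hsum : X = ∑ i, (hX.eigenvalues i : ℂ) • P i := by
    have hd : Matrix.diagonal (RCLike.ofReal ∘ hX.eigenvalues) =
        ∑ i, (hX.eigenvalues i : ℂ) • Matrix.single i i (1 : ℂ) := by
      ext a b
      rw [Matrix.sum_apply]
      by_cases hab : a = b
      · subst hab; simp [Matrix.single_apply]
      · rw [Matrix.diagonal_apply_ne _ hab]
        symm
        refine Finset.sum_eq_zero fun i _ => ?_
        simp only [Matrix.smul_apply, Matrix.single_apply]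
        rw [if_neg (fun h => hab (h.1.symm.trans h.2)), smul_zero]
    conv_lhs => rw [hX.spectral_theorem, Unitary.conjStarAlgAut_apply, hd]
    rw [Matrix.mul_sum, Matrix.sum_mul]
    refine Finset.sum_congr rfl fun i _ => ?_
    rw [mul_smul_comm, smul_mul_assoc]
    rfl
  have hg : (g X).re = ∑ i, hX.eigenvalues i * (g (P i)).re := by
    conv_lhs => rw [hsum]
    rw [map_sum, Complex.re_sum]
    refine Finset.sum_congr rfl fun i _ => ?_
    rw [map_smul, smul_eq_mul, Complex.re_ofReal_mul]
  rw [hg, traceNorm_of_isHermitian hX]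
  refine (Finset.abs_sum_le_sum_abs _ _).trans (Finset.sum_le_sum fun i _ => ?_)
  rw [abs_mul, abs_of_nonneg (h0 _ (hPs i))]
  exact mul_le_of_le_one_right (abs_nonneg _) (h1 _ (hPs i))

theorem exists_hsNorm_apply_le (T : SuperOp d) :
    ∃ c : ℝ, 0 < c ∧ ∀ X, hsNorm (T X) ≤ c * hsNorm X := by
  obtain ⟨c, hc, h⟩ := (LinearMap.toContinuousLinearMap
    (vec.toLinearMap ∘ₗ T ∘ₗ vec.symm.toLinearMap :
      EuclideanSpace ℂ (Fin d × Fin d) →ₗ[ℂ] EuclideanSpace ℂ (Fin d × Fin d))).bound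
  refine ⟨c, hc, fun X => ?_⟩
  have := h (vec X)
  simpa [norm_vec] using this

end TraceNorm

section Mixing

variable {d : ℕ} {ρ : Op d} {s : ℝ} {N : SuperOp d}

/-- This makes the set defining `mixingTime` nonempty. Without it the infimum could be the default
value `0`, and a bound on the mixing time would say nothing. -/
theorem IsGibbsSampler.exists_traceNorm_le (hN : IsGibbsSampler ρ s N) (hρ : ρ.PosDef)
    (hρs : IsState ρ) {Δ η : ℝ} (hΔ0 : 0 < Δ) (hΔ : Δ ≤ gap N) (hη : 0 < η) :
    ∃ t : ℕ, ∀ σ : Op d, IsState σ → traceNorm ((N ^ t) σ - ρ) ≤ η := by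
  obtain ⟨a, ha, h1⟩ := exists_hsNorm_apply_le (toWeighted ρ s)
  obtain ⟨b, hb, h2⟩ := exists_hsNorm_apply_le (ofWeighted ρ s)
  have hq0 : 0 ≤ 1 - Δ := by linarith [hN.gap_le_one]
  set c := Real.sqrt d * (a * (b * 2)) with hc
  have hc0 : 0 ≤ c := by positivity
  obtain ⟨t, ht⟩ := exists_pow_lt_of_lt_one (show 0 < η / (c + 1) by positivity)
    (show 1 - Δ < 1 by linarith)
  refine ⟨t, fun σ hσ => ?_⟩
  have h3 : (N ^ t) σ - ρ = (N ^ t) (σ - ρ) := by rw [map_sub, hN.pow_fixed]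
  have h4 : (σ - ρ).trace = 0 := by rw [Matrix.trace_sub, hσ.2, hρs.2, sub_self]
  have h5 : hsNorm (σ - ρ) ≤ 2 := by
    rw [← norm_vec, map_sub]
    refine (norm_sub_le _ _).trans ?_
    rw [norm_vec, norm_vec]
    linarith [hsNorm_le_one_of_isState hσ, hsNorm_le_one_of_isState hρs]
  have h6 := hN.weightedNorm_pow_apply_le hρ hΔ h4 t
  have h7 := h1 (ofWeighted ρ s ((N ^ t) (σ - ρ)))
  rw [toWeighted_ofWeighted hρ] at h7
  have h8 : weightedNorm ρ s (σ - ρ) ≤ b * 2 :=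
    (h2 _).trans (mul_le_mul_of_nonneg_left h5 hb.le)
  have h9 := traceNorm_le_hsNorm ((N ^ t) (σ - ρ))
  rw [h3]
  calc _ ≤ Real.sqrt d * (a * ((1 - Δ) ^ t * (b * 2))) :=
        h9.trans (mul_le_mul_of_nonneg_left (h7.trans (mul_le_mul_of_nonneg_left
          (h6.trans (mul_le_mul_of_nonneg_left h8 (pow_nonneg hq0 t))) ha.le)) (Real.sqrt_nonneg _))
    _ = c * (1 - Δ) ^ t := by rw [hc]; ring
    _ ≤ (c + 1) * (η / (c + 1)) :=
        mul_le_mul (by linarith) ht.le (pow_nonneg hq0 t) (by linarith)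
    _ = η := mul_div_cancel₀ _ (by linarith)

theorem IsGibbsSampler.traceNorm_le_of_mixingTime_le (hN : IsGibbsSampler ρ s N) (hρ : ρ.PosDef)
    (hρs : IsState ρ) {Δ η : ℝ} (hΔ0 : 0 < Δ) (hΔ : Δ ≤ gap N) (hη : 0 < η) {T : ℕ}
    (hT : mixingTime ρ N η ≤ T) {σ : Op d} (hσ : IsState σ) :
    traceNorm ((N ^ T) σ - ρ) ≤ η := by
  have h : ∀ σ : Op d, IsState σ → traceNorm ((N ^ mixingTime ρ N η) σ - ρ) ≤ η :=
    Nat.sInf_mem (s := {t : ℕ | ∀ σ : Op d, IsState σ → traceNorm ((N ^ t) σ - ρ) ≤ η})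
      (hN.exists_traceNorm_le hρ hρs hΔ0 hΔ hη)
  -- The surplus applications are made first; they only change the initial state.
  have h1 := h ((N ^ (T - mixingTime ρ N η)) σ) (hN.channel.pow_isState_apply _ hσ)
  rwa [← Module.End.mul_apply, ← pow_add, Nat.add_sub_cancel' hT] at h1

end Mixing

/-! ### Moments of the outcomes of a trajectory -/

section Trajectory

variable {V J : Type*} [AddCommGroup V] [Module ℂ V] [Fintype J]

/-- The composition of a list of instrument branches, the head acting first. -/
def trajectory (Φ : J → Module.End ℂ V) : List J → Module.End ℂ V
  | [] => 1
  | j :: js => trajectory Φ js * Φ j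

/-- The instrument summed over its outcomes with weights `w`. -/
def weightedSum (Φ : J → Module.End ℂ V) (w : J → ℝ) : Module.End ℂ V :=
  ∑ j, (w j : ℂ) • Φ j

theorem weightedSum_apply (Φ : J → Module.End ℂ V) (w : J → ℝ) (X : V) :
    weightedSum Φ w X = ∑ j, (w j : ℂ) • Φ j X := by
  simp [weightedSum, LinearMap.sum_apply]

theorem sum_trajectory_succ (Φ : J → Module.End ℂ V) (τ : V →ₗ[ℂ] ℂ) (k : ℕ)
    (f : (Fin (k + 1) → J) → ℂ) (X : V) :
    ∑ e, f e * τ (trajectory Φ (List.ofFn e) X) =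
      ∑ j, ∑ e, f (Fin.cons j e) * τ (trajectory Φ (List.ofFn e) (Φ j X)) := by
  rw [← (Fin.consEquiv fun _ : Fin (k + 1) => J).sum_comp, Fintype.sum_prod_type]
  refine Finset.sum_congr rfl fun j _ => Finset.sum_congr rfl fun e _ => ?_
  simp [Fin.consEquiv, trajectory]

variable (Φ : J → Module.End ℂ V) (τ : V →ₗ[ℂ] ℂ) (y : J → ℝ)

/-- The expectation of the sum of `k` outcomes. -/
def firstMoment (k : ℕ) (X : V) : ℂ :=
  ∑ e : Fin k → J, ((∑ t, y (e t) : ℝ) : ℂ) * τ (trajectory Φ (List.ofFn e) X)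

/-- The expectation of the square of the sum of `k` outcomes. -/
def secondMoment (k : ℕ) (X : V) : ℂ :=
  ∑ e : Fin k → J, ((∑ t, y (e t) : ℝ) : ℂ) ^ 2 * τ (trajectory Φ (List.ofFn e) X)

variable {Φ τ} (hτ : ∀ X, τ (weightedSum Φ 1 X) = τ X)

include hτ in
-- Since the summed instrument preserves `τ`, future outcomes can be summed out. This is the
-- normalization of the outcome probabilities.
theorem sum_trajectory (k : ℕ) (X : V) :
    ∑ e : Fin k → J, τ (trajectory Φ (List.ofFn e) X) = τ X := by
  induction k generalizing X with
  | zero => simp [trajectory]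
  | succ k ih =>
    have h := sum_trajectory_succ Φ τ k (fun _ => 1) X
    simp only [one_mul] at h
    rw [h]
    simp only [ih]
    rw [← hτ X, weightedSum_apply, map_sum]
    simp

include hτ in
theorem firstMoment_succ (k : ℕ) (X : V) :
    firstMoment Φ τ y (k + 1) X =
      τ (weightedSum Φ y X) + firstMoment Φ τ y k (weightedSum Φ 1 X) := by
  have hlin : firstMoment Φ τ y k (weightedSum Φ 1 X) = ∑ j, firstMoment Φ τ y k (Φ j X) := by
    simp only [firstMoment, weightedSum_apply, map_sum, Finset.mul_sum]
    rw [Finset.sum_comm]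
    simp
  rw [hlin, firstMoment, sum_trajectory_succ, weightedSum_apply, map_sum, ← Finset.sum_add_distrib]
  refine Finset.sum_congr rfl fun j _ => ?_
  simp only [Fin.sum_univ_succ, Fin.cons_zero, Fin.cons_succ, Complex.ofReal_add, add_mul]
  rw [Finset.sum_add_distrib, ← Finset.mul_sum, sum_trajectory hτ, map_smul, smul_eq_mul,
    firstMoment]

include hτ in
-- The first outcome is separated from the sum `R` of the others: `(y + R)² = y² + 2 y R + R²`.
theorem secondMoment_succ (k : ℕ) (X : V) :
    secondMoment Φ τ y (k + 1) X = τ (weightedSum Φ (fun j => y j ^ 2) X) +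
      2 * firstMoment Φ τ y k (weightedSum Φ y X) +
      secondMoment Φ τ y k (weightedSum Φ 1 X) := by
  have hlin : secondMoment Φ τ y k (weightedSum Φ 1 X) = ∑ j, secondMoment Φ τ y k (Φ j X) := by
    simp only [secondMoment, weightedSum_apply, map_sum, Finset.mul_sum]
    rw [Finset.sum_comm]
    simp
  have hlin' : firstMoment Φ τ y k (weightedSum Φ y X) =
      ∑ j, (y j : ℂ) * firstMoment Φ τ y k (Φ j X) := by
    simp only [firstMoment, weightedSum_apply, map_sum, Finset.mul_sum]
    rw [Finset.sum_comm]
    refine Finset.sum_congr rfl fun j _ => Finset.sum_congr rfl fun e _ => ?_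
    rw [map_smul, map_smul, smul_eq_mul]
    ring
  rw [hlin, hlin', secondMoment, sum_trajectory_succ, weightedSum_apply, map_sum, Finset.mul_sum,
    ← Finset.sum_add_distrib, ← Finset.sum_add_distrib]
  refine Finset.sum_congr rfl fun j _ => ?_
  simp only [Fin.sum_univ_succ, Fin.cons_zero, Fin.cons_succ, Complex.ofReal_add, add_sq, add_mul]
  rw [Finset.sum_add_distrib, Finset.sum_add_distrib, ← Finset.mul_sum, sum_trajectory hτ, map_smul,
    smul_eq_mul, firstMoment, secondMoment, Finset.mul_sum, Finset.mul_sum]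
  congr 1
  congr 1
  · push_cast; ring
  · refine Finset.sum_congr rfl fun e _ => ?_
    ring

include hτ in
theorem firstMoment_eq (k : ℕ) (X : V) :
    firstMoment Φ τ y k X =
      ∑ t ∈ Finset.range k, τ (weightedSum Φ y ((weightedSum Φ 1 ^ t) X)) := by
  induction k generalizing X with
  | zero => simp [firstMoment]
  | succ k ih =>
    rw [firstMoment_succ y hτ, ih, Finset.sum_range_succ', add_comm]
    simp only [pow_succ, Module.End.mul_apply, pow_zero, Module.End.one_apply]

include hτ in
-- Stationarity makes the remaining rounds start from `ρ` again, so each round adds one variance and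
-- twice a geometric series of covariances.
theorem norm_secondMoment_le {ρ : V} (hρ : weightedSum Φ 1 ρ = ρ) {v q : ℝ} (hv0 : 0 ≤ v)
    (hq0 : 0 ≤ q) (hq1 : q < 1) (hv : ‖τ (weightedSum Φ (fun j => y j ^ 2) ρ)‖ ≤ v)
    (hcov : ∀ t : ℕ, ‖τ (weightedSum Φ y ((weightedSum Φ 1 ^ t) (weightedSum Φ y ρ)))‖ ≤
      q ^ (t + 1) * v) (k : ℕ) :
    ‖secondMoment Φ τ y k ρ‖ ≤ k * (v * (1 + 2 * (q / (1 - q)))) := by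
  induction k with
  | zero => simp [secondMoment]
  | succ k ih =>
    rw [secondMoment_succ y hτ, hρ]
    have h1 : ‖firstMoment Φ τ y k (weightedSum Φ y ρ)‖ ≤ q / (1 - q) * v := by
      rw [firstMoment_eq y hτ]
      refine (norm_sum_le _ _).trans ((Finset.sum_le_sum fun t _ => hcov t).trans ?_)
      rw [← Finset.sum_mul]
      refine mul_le_mul_of_nonneg_right ?_ hv0
      simp only [pow_succ']
      rw [← Finset.mul_sum, div_eq_mul_inv]
      refine mul_le_mul_of_nonneg_left ?_ hq0
      rw [← tsum_geometric_of_lt_one hq0 hq1]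
      exact (summable_geometric_of_lt_one hq0 hq1).sum_le_tsum _ fun i _ => pow_nonneg hq0 i
    have h2 : ‖(2 : ℂ) * firstMoment Φ τ y k (weightedSum Φ y ρ)‖ ≤ 2 * (q / (1 - q) * v) := by
      rw [norm_mul]
      simpa using h1
    refine (norm_add_le _ _).trans ((add_le_add ((norm_add_le _ _).trans (add_le_add hv h2))
      ih).trans (le_of_eq ?_))
    push_cast
    ring

end Trajectory

/-- Chebyshev's inequality for a finite probability space. -/
theorem one_sub_le_sum_filter {E : Type*} [Fintype E] (p z : E → ℝ) (hp : ∀ e, 0 ≤ p e)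
    (hp1 : ∑ e, p e = 1) {δ : ℝ} (hδ : 0 < δ) (Q : E → Prop) [DecidablePred Q]
    (hQ : ∀ e, |z e| < δ → Q e) :
    1 - (∑ e, z e ^ 2 * p e) / δ ^ 2 ≤ ∑ e with Q e, p e := by
  have h1 : ∑ e, p e = ∑ e with Q e, p e + ∑ e with ¬ Q e, p e :=
    (Finset.sum_filter_add_sum_filter_not _ _ _).symm
  have h2 : ∑ e with ¬ Q e, p e ≤ (∑ e, z e ^ 2 * p e) / δ ^ 2 := by
    rw [le_div_iff₀ (by positivity), Finset.sum_mul]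
    refine (Finset.sum_le_sum fun e he => ?_).trans
      (Finset.sum_le_sum_of_subset_of_nonneg (Finset.subset_univ _)
        fun e _ _ => mul_nonneg (sq_nonneg (z e)) (hp e))
    have h3 : δ ≤ |z e| := by
      by_contra h
      exact (Finset.mem_filter.1 he).2 (hQ e (not_le.1 h))
    rw [mul_comm]
    refine mul_le_mul_of_nonneg_right ?_ (hp e)
    rw [← sq_abs (z e)]
    exact pow_le_pow_left₀ hδ.le h3 2
  linarith

/-! ### Commuting instruments interleaved with a Gibbs sampler -/

section Instrument

variable {d : ℕ} {J : Type*} [Fintype J]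

/-- The branch `X ↦ K X K†` of an instrument. -/
def conjBy (K : Op d) : SuperOp d := sandwich K K.conjTranspose

theorem conjBy_apply (K X : Op d) : conjBy K X = K * X * K.conjTranspose := sandwich_apply _ _ _

/-- One round with result `j`: the branch `j`, then `r` applications of the sampler, then the whole
instrument with the result forgotten. -/
def roundMap (K : J → Op d) (N : SuperOp d) (r : ℕ) (j : J) : SuperOp d :=
  (∑ i, conjBy (K i)) * N ^ r * conjBy (K j)

/-- Kraus operators of an instrument, normal and commuting with `ρ`. -/
structure IsCommutingInstrument (ρ : Op d) (K : J → Op d) : Prop where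
  sum_eq_one : ∑ j, (K j).conjTranspose * K j = 1
  normal : ∀ j, Commute (K j) (K j).conjTranspose
  commute_state : ∀ j, Commute ρ (K j)

/-- The observable `∑ j, y j K j† K j` whose expectation is that of the outcome `y`. -/
def effect (K : J → Op d) (y : J → ℝ) : Op d := ∑ j, (y j : ℂ) • ((K j).conjTranspose * K j)

theorem effect_isHermitian (K : J → Op d) (y : J → ℝ) : (effect K y).IsHermitian := by
  unfold Matrix.IsHermitian effect
  rw [Matrix.conjTranspose_sum]
  simp [Matrix.conjTranspose_smul]

theorem trace_sum_smul_conjBy (K : J → Op d) (y : J → ℝ) (X : Op d) :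
    (∑ j, (y j : ℂ) • conjBy (K j) X).trace = (effect K y * X).trace := by
  rw [effect, Matrix.sum_mul, Matrix.trace_sum, Matrix.trace_sum]
  refine Finset.sum_congr rfl fun j _ => ?_
  rw [conjBy_apply, smul_mul_assoc, Matrix.trace_smul, Matrix.trace_smul, Matrix.trace_mul_cycle]

variable {ρ : Op d} {K : J → Op d} {s : ℝ} {N : SuperOp d}

namespace IsCommutingInstrument

theorem commute_state_conjTranspose (hK : IsCommutingInstrument ρ K) (hρ : ρ.PosDef) (j : J) :
    Commute ρ (K j).conjTranspose := by
  have h := congrArg Matrix.conjTranspose (hK.commute_state j).eq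
  rw [Matrix.conjTranspose_mul, Matrix.conjTranspose_mul, hρ.isHermitian.eq] at h
  exact h.symm

theorem sum_mul_conjTranspose (hK : IsCommutingInstrument ρ K) :
    ∑ j, K j * (K j).conjTranspose = 1 := by
  rw [← hK.sum_eq_one]
  exact Finset.sum_congr rfl fun j _ => (hK.normal j).eq

theorem commute_state_effect (hK : IsCommutingInstrument ρ K) (hρ : ρ.PosDef) (y : J → ℝ) :
    Commute ρ (effect K y) :=
  Commute.sum_right _ _ _ fun j _ =>
    ((hK.commute_state_conjTranspose hρ j).mul_right (hK.commute_state j)).smul_right _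

theorem sum_conjBy_eq_self (hK : IsCommutingInstrument ρ K) {X : Op d}
    (hX : ∀ j, Commute (K j) X) : ∑ j, conjBy (K j) X = X := by
  simp only [conjBy_apply, fun j => (hX j).eq, mul_assoc]
  rw [← Finset.mul_sum, hK.sum_mul_conjTranspose, mul_one]

theorem sum_smul_conjBy_state (hK : IsCommutingInstrument ρ K) (y : J → ℝ) :
    ∑ j, (y j : ℂ) • conjBy (K j) ρ = ρ * effect K y := by
  rw [effect, Finset.mul_sum]
  refine Finset.sum_congr rfl fun j _ => ?_
  rw [conjBy_apply, ← (hK.commute_state j).eq, mul_smul_comm, mul_assoc,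
    (hK.normal j).eq]

theorem trace_sum_conjBy (hK : IsCommutingInstrument ρ K) (X : Op d) :
    ((∑ j, conjBy (K j)) X).trace = X.trace := by
  have h := trace_sum_smul_conjBy K 1 X
  have h1 : effect K 1 = 1 := by rw [← hK.sum_eq_one]; simp [effect]
  rw [h1, one_mul] at h
  rw [← h]
  simp [LinearMap.sum_apply]

/-- Powers of `ρ` pass through the Kraus operators, so the similarity leaves the channel unchanged.
Normality makes it unital, and `hsNorm_kraus_le` applies. -/
theorem weightedNorm_sum_conjBy_le (hK : IsCommutingInstrument ρ K) (hρ : ρ.PosDef) (s : ℝ)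
    (X : Op d) : weightedNorm ρ s ((∑ j, conjBy (K j)) X) ≤ weightedNorm ρ s X := by
  have h : ofWeighted ρ s ((∑ j, conjBy (K j)) X) =
      ∑ j, K j * ofWeighted ρ s X * (K j).conjTranspose := by
    rw [LinearMap.sum_apply, map_sum]
    refine Finset.sum_congr rfl fun j _ => ?_
    rw [conjBy_apply, ofWeighted, sandwich_apply, sandwich_apply]
    set a := rpow ρ (-((1 - s) / 2))
    set b := rpow ρ (-(s / 2))
    have h1 : a * K j = K j * a := rpow_commute hρ.isHermitian (hK.commute_state j) _
    have h2 : b * (K j).conjTranspose = (K j).conjTranspose * b :=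
      rpow_commute hρ.isHermitian (hK.commute_state_conjTranspose hρ j) _
    calc _ = (a * K j) * X * ((K j).conjTranspose * b) := by simp only [mul_assoc]
      _ = (K j * a) * X * (b * (K j).conjTranspose) := by rw [h1, h2]
      _ = _ := by simp only [mul_assoc]
  rw [weightedNorm, weightedNorm, h]
  exact hsNorm_kraus_le K hK.sum_eq_one hK.sum_mul_conjTranspose _

/-- The effect commutes with `ρ`, so the powers `s / 2` and `(1 - s) / 2` merge into `1 / 2`: the
bound on the observable does not depend on `s`. -/
theorem norm_trace_effect_mul_le (hK : IsCommutingInstrument ρ K) (hρ : ρ.PosDef) (s : ℝ)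
    (y : J → ℝ) (X : Op d) :
    ‖(effect K y * X).trace‖ ≤ hsNorm (rpow ρ (1 / 2) * effect K y) * weightedNorm ρ s X := by
  have h : (effect K y * X).trace =
      ((rpow ρ (1 / 2) * effect K y).conjTranspose * ofWeighted ρ s X).trace := by
    conv_lhs => rw [← toWeighted_ofWeighted hρ s X, toWeighted, sandwich_apply]
    rw [Matrix.conjTranspose_mul, (effect_isHermitian K y).eq, (rpow_isHermitian _ _).eq]
    set Y := ofWeighted ρ s X
    have h1 := (rpow_commute hρ.isHermitian (hK.commute_state_effect hρ y) (s / 2)).eq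
    have h2 : s / 2 + (1 - s) / 2 = 1 / 2 := by ring
    rw [← mul_assoc, ← mul_assoc, Matrix.trace_mul_comm, ← mul_assoc, ← mul_assoc, h1,
      mul_assoc (effect K y), rpow_mul_rpow hρ, h2]
  rw [h]
  exact norm_trace_le _ _

theorem weightedNorm_state_mul_effect (hK : IsCommutingInstrument ρ K) (hρ : ρ.PosDef) (s : ℝ)
    (y : J → ℝ) : weightedNorm ρ s (ρ * effect K y) = hsNorm (rpow ρ (1 / 2) * effect K y) := by
  have h : ofWeighted ρ s (ρ * effect K y) = rpow ρ (1 / 2) * effect K y := by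
    rw [← ofWeighted_self hρ s, ofWeighted, sandwich_apply, sandwich_apply, mul_assoc, mul_assoc,
      mul_assoc, ← (rpow_commute hρ.isHermitian (hK.commute_state_effect hρ y) _).eq]
    simp only [mul_assoc]
  rw [weightedNorm, h]

/-- An operator Jensen inequality: the square of the mean effect is dominated by the effect of the
squared outcome, so the covariances are bounded by the outcome variance. -/
theorem hsNorm_effect_sq_le (hK : IsCommutingInstrument ρ K) (hρ : ρ.PosDef) (y : J → ℝ) :
    hsNorm (rpow ρ (1 / 2) * effect K y) ^ 2 ≤
      (effect K (fun j => y j ^ 2) * ρ).trace.re := by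
  set F := effect K y with hF
  have h1 : hsNorm (rpow ρ (1 / 2) * F) ^ 2 = (F * F * ρ).trace.re := by
    rw [hsNorm_sq, Matrix.conjTranspose_mul, (effect_isHermitian K y).eq,
      (rpow_isHermitian _ _).eq]
    have : F * rpow ρ (1 / 2) * (rpow ρ (1 / 2) * F) = F * (rpow ρ (1 / 2) * rpow ρ (1 / 2)) * F := by
      simp only [mul_assoc]
    rw [this, rpow_mul_rpow hρ, add_halves, rpow_one hρ, mul_assoc,
      (hK.commute_state_effect hρ y).eq, mul_assoc]
  have h2 : ∀ j, ((y j : ℂ) • (1 : Op d) - F).IsHermitian := by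
    intro j
    unfold Matrix.IsHermitian
    rw [Matrix.conjTranspose_sub, Matrix.conjTranspose_smul, (effect_isHermitian K y).eq]
    simp [hF]
  -- The deficit in the inequality is a sum of positive terms `(y j - F) K j† K j (y j - F)`.
  have h3 : ∑ j, (((y j : ℂ) • (1 : Op d) - F) * ((K j).conjTranspose * K j)) *
      ((y j : ℂ) • (1 : Op d) - F) = effect K (fun j => y j ^ 2) - F * F := by
    have h4 : ∀ j, (((y j : ℂ) • (1 : Op d) - F) * ((K j).conjTranspose * K j)) *
        ((y j : ℂ) • (1 : Op d) - F) =
        ((y j ^ 2 : ℝ) : ℂ) • ((K j).conjTranspose * K j)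
        - F * ((y j : ℂ) • ((K j).conjTranspose * K j))
        - ((y j : ℂ) • ((K j).conjTranspose * K j)) * F
        + F * ((K j).conjTranspose * K j) * F := by
      intro j
      push_cast
      simp only [sub_mul, mul_sub, smul_mul_assoc, mul_smul_comm, one_mul, mul_one, smul_smul,
        smul_sub, pow_two]
      abel
    simp only [h4, Finset.sum_add_distrib, Finset.sum_sub_distrib]
    rw [← Finset.mul_sum, ← Finset.sum_mul, ← Finset.sum_mul, ← Finset.mul_sum, hK.sum_eq_one,
      mul_one]
    change effect K (fun j => y j ^ 2) - F * F - F * F + F * F = _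
    abel
  have h5 : 0 ≤ ((effect K (fun j => y j ^ 2) - F * F) * ρ).trace.re := by
    rw [← h3, Matrix.sum_mul, Matrix.trace_sum, Complex.re_sum]
    refine Finset.sum_nonneg fun j _ => ?_
    set G := (y j : ℂ) • (1 : Op d) - F with hG
    have hGH : G.conjTranspose = G := h2 j
    have h6 : (G * ((K j).conjTranspose * K j) * G * ρ).trace =
        ((K j * G) * ρ * (K j * G).conjTranspose).trace := by
      rw [Matrix.conjTranspose_mul, hGH, Matrix.trace_mul_comm ((K j * G) * ρ)]
      simp only [mul_assoc]
    rw [h6]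
    exact (Complex.nonneg_iff.1 (hρ.posSemidef.mul_mul_conjTranspose_same (K j * G)).trace_nonneg).1
  rw [sub_mul, Matrix.trace_sub, Complex.sub_re] at h5
  linarith

end IsCommutingInstrument

theorem weightedSum_roundMap_apply (K : J → Op d) (N : SuperOp d) (r : ℕ) (y : J → ℝ) (X : Op d) :
    weightedSum (roundMap K N r) y X =
      (∑ i, conjBy (K i)) ((N ^ r) (∑ j, (y j : ℂ) • conjBy (K j) X)) := by
  rw [weightedSum_apply, map_sum, map_sum]
  simp [roundMap]

theorem weightedSum_roundMap_one_apply (K : J → Op d) (N : SuperOp d) (r : ℕ) (X : Op d) :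
    weightedSum (roundMap K N r) 1 X =
      (∑ i, conjBy (K i)) ((N ^ r) ((∑ i, conjBy (K i)) X)) := by
  rw [weightedSum_roundMap_apply]
  simp [LinearMap.sum_apply]

theorem trace_weightedSum_roundMap (hK : IsCommutingInstrument ρ K) (hN : IsChannel N) (r : ℕ)
    (y : J → ℝ) (X : Op d) :
    (weightedSum (roundMap K N r) y X).trace = (effect K y * X).trace := by
  rw [weightedSum_roundMap_apply, hK.trace_sum_conjBy, hN.pow_trace_apply, trace_sum_smul_conjBy]

theorem trace_weightedSum_roundMap_one (hK : IsCommutingInstrument ρ K) (hN : IsChannel N) (r : ℕ)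
    (X : Op d) : (weightedSum (roundMap K N r) 1 X).trace = X.trace := by
  rw [weightedSum_roundMap_one_apply, hK.trace_sum_conjBy, hN.pow_trace_apply, hK.trace_sum_conjBy]

theorem weightedSum_roundMap_one_state (hK : IsCommutingInstrument ρ K)
    (hN : IsGibbsSampler ρ s N) (r : ℕ) : weightedSum (roundMap K N r) 1 ρ = ρ := by
  have h := hK.sum_conjBy_eq_self fun j => (hK.commute_state j).symm
  rw [← LinearMap.sum_apply] at h
  rw [weightedSum_roundMap_one_apply, h, hN.pow_fixed, h]

/-- Both measurements of a round are contractions and keep the trace zero, so each round gains the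
full factor of the `r` sampler steps between them. -/
theorem weightedNorm_roundMap_pow_le (hK : IsCommutingInstrument ρ K) (hN : IsGibbsSampler ρ s N)
    (hρ : ρ.PosDef) {Δ : ℝ} (hΔ : Δ ≤ gap N) (r t : ℕ) {X : Op d} (hX : X.trace = 0) :
    weightedNorm ρ s ((weightedSum (roundMap K N r) 1 ^ t) X) ≤
      ((1 - Δ) ^ r) ^ t * weightedNorm ρ s X ∧
    ((weightedSum (roundMap K N r) 1 ^ t) X).trace = 0 := by
  have hq : 0 ≤ (1 - Δ) ^ r := pow_nonneg (by linarith [hN.gap_le_one]) _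
  induction t with
  | zero => simp [hX]
  | succ t ih =>
    rw [pow_succ', Module.End.mul_apply]
    refine ⟨?_, by rw [trace_weightedSum_roundMap_one hK hN.channel, ih.2]⟩
    set Y := (weightedSum (roundMap K N r) 1 ^ t) X
    rw [weightedSum_roundMap_one_apply, pow_succ', mul_assoc]
    refine (hK.weightedNorm_sum_conjBy_le hρ s _).trans ?_
    refine (hN.weightedNorm_pow_apply_le hρ hΔ (by rw [hK.trace_sum_conjBy, ih.2]) r).trans ?_
    exact mul_le_mul_of_nonneg_left ((hK.weightedNorm_sum_conjBy_le hρ s _).trans ih.1) hq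

/-- Exponential decay of the autocorrelations of a centred outcome. -/
theorem norm_autocorrelation_le (hK : IsCommutingInstrument ρ K) (hN : IsGibbsSampler ρ s N)
    (hρ : ρ.PosDef) {Δ : ℝ} (hΔ : Δ ≤ gap N) (r t : ℕ) {y : J → ℝ}
    (hy : (effect K y * ρ).trace = 0) :
    ‖(weightedSum (roundMap K N r) y ((weightedSum (roundMap K N r) 1 ^ t)
      (weightedSum (roundMap K N r) y ρ))).trace‖ ≤
      ((1 - Δ) ^ r) ^ (t + 1) * (effect K (fun j => y j ^ 2) * ρ).trace.re := by
  have hq : 0 ≤ (1 - Δ) ^ r := pow_nonneg (by linarith [hN.gap_le_one]) _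
  set h := hsNorm (rpow ρ (1 / 2) * effect K y) with hh
  set X := weightedSum (roundMap K N r) y ρ with hX
  have h0 : X.trace = 0 := by
    rw [hX, trace_weightedSum_roundMap hK hN.channel, hy]
  -- The round in which the earlier outcome is recorded already contributes one factor `(1 - Δ) ^
  -- r`; this gives the exponent `t + 1`.
  have h1 : weightedNorm ρ s X ≤ (1 - Δ) ^ r * h := by
    rw [hX, weightedSum_roundMap_apply, hK.sum_smul_conjBy_state]
    refine (hK.weightedNorm_sum_conjBy_le hρ s _).trans ?_
    rw [hh, ← hK.weightedNorm_state_mul_effect hρ s y]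
    refine hN.weightedNorm_pow_apply_le hρ hΔ ?_ r
    rw [Matrix.trace_mul_comm, hy]
  rw [trace_weightedSum_roundMap hK hN.channel]
  refine (hK.norm_trace_effect_mul_le hρ s y _).trans ?_
  have h2 := (weightedNorm_roundMap_pow_le hK hN hρ hΔ r t h0).1
  have hh0 : 0 ≤ h := hsNorm_nonneg _
  calc _ ≤ h * (((1 - Δ) ^ r) ^ t * ((1 - Δ) ^ r * h)) :=
        mul_le_mul_of_nonneg_left
          (h2.trans (mul_le_mul_of_nonneg_left h1 (pow_nonneg hq t))) hh0
    _ = ((1 - Δ) ^ r) ^ (t + 1) * h ^ 2 := by ring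
    _ ≤ _ := mul_le_mul_of_nonneg_left (hK.hsNorm_effect_sq_le hρ y) (pow_nonneg hq _)

/-- The variance of the sum of the outcomes of `k` rounds, started in the stationary state. -/
theorem norm_secondMoment_roundMap_le (hK : IsCommutingInstrument ρ K)
    (hN : IsGibbsSampler ρ s N) (hρ : ρ.PosDef) {Δ q : ℝ} (hΔ : Δ ≤ gap N) {r : ℕ}
    (hq : (1 - Δ) ^ r ≤ q) (hq1 : q < 1) {y : J → ℝ} (hy : (effect K y * ρ).trace = 0) {v : ℝ}
    (hv : (effect K (fun j => y j ^ 2) * ρ).trace.re ≤ v) (k : ℕ) :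
    ‖secondMoment (roundMap K N r) (Matrix.traceLinearMap (Fin d) ℂ ℂ) y k ρ‖ ≤
      k * (v * (1 + 2 * (q / (1 - q)))) := by
  have hΔ0 : 0 ≤ (1 - Δ) ^ r := pow_nonneg (by linarith [hN.gap_le_one]) _
  have hv0 : 0 ≤ (effect K (fun j => y j ^ 2) * ρ).trace.re :=
    (sq_nonneg _).trans (hK.hsNorm_effect_sq_le hρ y)
  have him : (effect K (fun j => y j ^ 2) * ρ).trace.im = 0 := by
    have h : star (effect K (fun j => y j ^ 2) * ρ).trace = (effect K (fun j => y j ^ 2) * ρ).trace := by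
      rw [← Matrix.trace_conjTranspose, Matrix.conjTranspose_mul, hρ.isHermitian.eq,
        (effect_isHermitian _ _).eq, Matrix.trace_mul_comm]
    exact Complex.conj_eq_iff_im.1 h
  refine norm_secondMoment_le y (fun X => trace_weightedSum_roundMap_one hK hN.channel r X)
    (weightedSum_roundMap_one_state hK hN r) (hv0.trans hv) (hΔ0.trans hq) hq1 ?_ (fun t => ?_) k
  · rw [Matrix.traceLinearMap_apply, trace_weightedSum_roundMap hK hN.channel]
    rw [← Complex.re_add_im (effect K _ * ρ).trace, him]
    simp only [Complex.ofReal_zero, zero_mul, add_zero, Complex.norm_real, Real.norm_eq_abs]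
    rwa [abs_of_nonneg hv0]
  · exact (norm_autocorrelation_le hK hN hρ hΔ r t hy).trans
      (mul_le_mul (pow_le_pow_left₀ hΔ0 hq _) hv hv0 (pow_nonneg (hΔ0.trans hq) _))

end Instrument

/-! ### Success probability of a protocol -/

section Positivity

variable {d : ℕ} {J : Type*} [Fintype J] {ρ : Op d} {K : J → Op d} {N : SuperOp d}

theorem posSemidef_roundMap_apply (hN : IsChannel N) (r : ℕ) (j : J) {X : Op d}
    (hX : X.PosSemidef) : (roundMap K N r j X).PosSemidef := by
  simp only [roundMap, Module.End.mul_apply, LinearMap.sum_apply, conjBy_apply]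
  exact Matrix.posSemidef_sum _ fun i _ =>
    (hN.pow_posSemidef_apply r (hX.mul_mul_conjTranspose_same _)).mul_mul_conjTranspose_same _

theorem posSemidef_trajectory_apply (hN : IsChannel N) (r : ℕ) (l : List J) {X : Op d}
    (hX : X.PosSemidef) : (trajectory (roundMap K N r) l X).PosSemidef := by
  induction l generalizing X with
  | nil => simpa [trajectory]
  | cons j l ih => exact ih (posSemidef_roundMap_apply hN r j hX)

theorem trace_trajectory_nonneg (hN : IsChannel N) (r : ℕ) (l : List J) {X : Op d}
    (hX : X.PosSemidef) : 0 ≤ (trajectory (roundMap K N r) l X).trace.re :=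
  (Complex.nonneg_iff.1 (posSemidef_trajectory_apply hN r l hX).trace_nonneg).1

theorem sum_trace_trajectory (hK : IsCommutingInstrument ρ K) (hN : IsChannel N) (r k : ℕ)
    (X : Op d) :
    ∑ e : Fin k → J, (trajectory (roundMap K N r) (List.ofFn e) X).trace.re = X.trace.re := by
  rw [← Complex.re_sum]
  exact congrArg Complex.re (sum_trajectory (Φ := roundMap K N r)
    (τ := Matrix.traceLinearMap (Fin d) ℂ ℂ)
    (fun X => trace_weightedSum_roundMap_one hK hN r X) k X)

end Positivity

namespace Protocol

variable {d : ℕ} {ρ O : Op d} {N : SuperOp d} {s : ℝ}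

theorem run_eq_trajectory (P : Protocol) (O : Op d) (N : SuperOp d)
    (l : List (Fin (2 ^ P.meas.ancillas))) (X : Op d) :
    P.run O N l X = trajectory (roundMap (P.meas.kraus O) N P.spacing) l X := by
  induction l generalizing X with
  | nil => rfl
  | cons j l ih =>
    rw [run, ih, trajectory, Module.End.mul_apply]
    congr 1
    simp [round, Measurement.channel, Measurement.branch, roundMap, LinearMap.sum_apply,
      conjBy_apply]

theorem prob_nonneg (P : Protocol) (hN : IsChannel N) {σ : Op d} (hσ : IsState σ)
    (e : Fin P.rounds → Fin (2 ^ P.meas.ancillas)) : 0 ≤ P.prob O N σ e := by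
  rw [prob, run_eq_trajectory]
  exact trace_trajectory_nonneg hN _ _ (hN.pow_posSemidef_apply _ hσ.1)

theorem successProb_nonneg (P : Protocol) (hN : IsChannel N) {σ : Op d} (hσ : IsState σ)
    (v ε : ℝ) : 0 ≤ P.successProb O N σ v ε :=
  Finset.sum_nonneg fun e _ => P.prob_nonneg hN hσ e

theorem effect_sub_const {J : Type*} [Fintype J] {K : J → Op d} (hK : IsCommutingInstrument ρ K)
    (y : J → ℝ) (μ : ℝ) : effect K (fun j => y j - μ) = effect K y - (μ : ℂ) • (1 : Op d) := by
  simp only [effect, Complex.ofReal_sub, sub_smul, Finset.sum_sub_distrib]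
  rw [← Finset.smul_sum, hK.sum_eq_one]

/-- A protocol succeeds if, in the stationary state, the expectation of a single outcome is close to
the target and its variance is at most `v`, and the number of rounds is large enough. -/
theorem one_sub_le_successProb (P : Protocol) (hK : IsCommutingInstrument ρ (P.meas.kraus O))
    (hN : IsGibbsSampler ρ s N) (hρ : ρ.PosDef) (hρ1 : ρ.trace = 1) {Δ η ε q μ v o : ℝ}
    (hΔ0 : 0 < Δ) (hΔ : Δ ≤ gap N) (hη : 0 < η) (hT : mixingTime ρ N η ≤ P.burnIn)
    (hq : (1 - Δ) ^ P.spacing ≤ q) (hq1 : q < 1) (hε : 0 < ε)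
    (hμ : (effect (P.meas.kraus O) P.meas.readout * ρ).trace = μ) (hbias : |μ - o| ≤ ε / 2)
    (hv : (effect (P.meas.kraus O) (fun j => (P.meas.readout j - μ) ^ 2) * ρ).trace.re ≤ v)
    (hrounds : 0 < P.rounds)
    (hcheb : v * (1 + 2 * (q / (1 - q))) ≤ η * (P.rounds * (ε / 2) ^ 2))
    {σ : Op d} (hσ : IsState σ) : 1 - 2 * η ≤ P.successProb O N σ o ε := by
  classical
  set Φ := roundMap (P.meas.kraus O) N P.spacing with hΦ
  set τ := Matrix.traceLinearMap (Fin d) ℂ ℂ with hτ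
  set good : Finset (Fin P.rounds → Fin (2 ^ P.meas.ancillas)) :=
    Finset.univ.filter (fun e => |P.output e - o| < ε) with hgood
  have hρs : IsState ρ := ⟨hρ.posSemidef, hρ1⟩
  set g : Op d →ₗ[ℂ] ℂ := ∑ e ∈ good, τ ∘ₗ trajectory Φ (List.ofFn e) with hg
  have hgX : ∀ X, (g X).re = ∑ e ∈ good, (trajectory Φ (List.ofFn e) X).trace.re := by
    intro X
    rw [hg, LinearMap.sum_apply, Complex.re_sum]
    rfl
  have hg0 : ∀ σ, IsState σ → 0 ≤ (g σ).re := fun σ hσ => by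
    rw [hgX]
    exact Finset.sum_nonneg fun e _ => trace_trajectory_nonneg hN.channel _ _ hσ.1
  have hg1 : ∀ σ, IsState σ → (g σ).re ≤ 1 := fun σ hσ => by
    rw [hgX]
    refine (Finset.sum_le_sum_of_subset_of_nonneg (Finset.subset_univ _) fun e _ _ =>
      trace_trajectory_nonneg hN.channel _ _ hσ.1).trans ?_
    rw [sum_trace_trajectory hK hN.channel, hσ.2, Complex.one_re]
  have hsucc : P.successProb O N σ o ε = (g ((N ^ P.burnIn) σ)).re := by
    rw [hgX, successProb]
    simp only [prob, run_eq_trajectory]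
    rw [hgood]
  -- The success probability is a linear functional `g` of the state after the burn-in, so its
  -- deviation from the stationary value is at most the trace distance.
  have hpert := abs_re_le_traceNorm g hg0 hg1 (X := (N ^ P.burnIn) σ - ρ)
    ((hN.channel.pow_posSemidef_apply _ hσ.1).isHermitian.sub hρ.isHermitian)
  have hmix := hN.traceNorm_le_of_mixingTime_le hρ hρs hΔ0 hΔ hη hT hσ
  have hpos : (0 : ℝ) < P.rounds := by exact_mod_cast hrounds
  have hstat : 1 - η ≤ (g ρ).re := by
    have hcent : (effect (P.meas.kraus O) (fun j => P.meas.readout j - μ) * ρ).trace = 0 := by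
      rw [effect_sub_const hK, sub_mul, Matrix.trace_sub, hμ, smul_mul_assoc, one_mul,
        Matrix.trace_smul, hρ1]
      simp
    have h1 := norm_secondMoment_roundMap_le hK hN hρ hΔ hq hq1 hcent hv P.rounds
    have h2 := one_sub_le_sum_filter
      (fun e : Fin P.rounds → Fin (2 ^ P.meas.ancillas) =>
        (trajectory Φ (List.ofFn e) ρ).trace.re)
      (fun e => ∑ t, (P.meas.readout (e t) - μ))
      (fun e => trace_trajectory_nonneg hN.channel _ _ hρ.posSemidef)
      (by rw [sum_trace_trajectory hK hN.channel, hρ1, Complex.one_re])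
      -- Half of `ε` is left for the fluctuation; the other half is used by the bias.
      (δ := P.rounds * (ε / 2)) (by positivity) (fun e => |P.output e - o| < ε)
      (fun e he => by
        have h3 : ∑ t, (P.meas.readout (e t) - μ) = P.rounds * (P.output e - μ) := by
          rw [Finset.sum_sub_distrib, output, mul_sub, mul_div_cancel₀ _ hpos.ne']
          simp
        rw [h3, abs_mul, abs_of_pos hpos] at he
        have h4 := lt_of_mul_lt_mul_left he hpos.le
        calc |P.output e - o| = |(P.output e - μ) + (μ - o)| := by ring_nf
          _ ≤ |P.output e - μ| + |μ - o| := abs_add_le _ _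
          _ < ε := by linarith)
    rw [hgX]
    refine le_trans ?_ h2
    rw [sub_le_sub_iff_left, div_le_iff₀ (by positivity)]
    have h5 : ∑ e : Fin P.rounds → Fin (2 ^ P.meas.ancillas),
        (∑ t, (P.meas.readout (e t) - μ)) ^ 2 * (trajectory Φ (List.ofFn e) ρ).trace.re =
        (secondMoment Φ τ (fun j => P.meas.readout j - μ) P.rounds ρ).re := by
      rw [secondMoment, Complex.re_sum]
      refine Finset.sum_congr rfl fun e _ => ?_
      rw [← Complex.ofReal_pow, Complex.re_ofReal_mul]
      rfl
    rw [h5]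
    refine (Complex.re_le_norm _).trans (h1.trans ?_)
    calc _ ≤ P.rounds * (η * (P.rounds * (ε / 2) ^ 2)) :=
          mul_le_mul_of_nonneg_left hcheb hpos.le
      _ = _ := by ring
  rw [hsucc]
  have h6 : (g ((N ^ P.burnIn) σ)).re = (g ρ).re + (g ((N ^ P.burnIn) σ - ρ)).re := by
    rw [map_sub, Complex.sub_re]; ring
  have h7 := (abs_le.1 (hpert.trans hmix)).1
  linarith

end Protocol

/-! ### Pointer measurements -/

section Pointer

variable {m : ℕ}

/-- The phase that the ancilla state `ℓ` acquires when the observable has the value `x`. -/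
def phase (m : ℕ) (θ x : ℝ) (ℓ : Fin (2 ^ m)) : ℂ :=
  Complex.exp (-Complex.I * ((θ * (((ℓ : ℕ) : ℝ) - 2 ^ m / 2) : ℝ) : ℂ) * x)

/-- The pointer measurement: prepare the ancillas with `U`, let them interact once with the
observable for the time `θ`, and measure in the basis given by `W`. -/
def pointer (U W : Matrix.unitaryGroup (Fin (2 ^ m)) ℂ) (θ : ℝ) (y : Fin (2 ^ m) → ℝ) :
    Measurement where
  ancillas := m
  gates := [.ancilla U, .evolve θ, .ancilla (star W)]
  readout := y

theorem pointer_time (U W : Matrix.unitaryGroup (Fin (2 ^ m)) ℂ) (θ : ℝ) (y : Fin (2 ^ m) → ℝ) :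
    (pointer U W θ y).time = |θ| * (2 ^ m / 2) := by
  simp [pointer, Measurement.time, Gate.time]

/-- The amplitude of the result `j` when the observable has the value `x`. -/
def amplitude (U W : Matrix.unitaryGroup (Fin (2 ^ m)) ℂ) (θ : ℝ) (j : Fin (2 ^ m)) (x : ℝ) : ℂ :=
  ∑ ℓ, (star (W ℓ j) * U ℓ ⟨0, by positivity⟩) * phase m θ x ℓ

theorem kronecker_mul_blockDiagonal_mul_kronecker_apply {d l : ℕ}
    (A B : Matrix (Fin l) (Fin l) ℂ) (V : Fin l → Op d) (a b : Fin d) (j z : Fin l) :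
    ((((1 : Op d) ⊗ₖ B) * (Matrix.blockDiagonal V * (((1 : Op d) ⊗ₖ A) * 1)) :
      Matrix (Fin d × Fin l) (Fin d × Fin l) ℂ)) (a, j) (b, z) =
      ∑ ℓ, B j ℓ * A ℓ z * V ℓ a b := by
  rw [mul_one, Matrix.mul_apply, Fintype.sum_prod_type]
  simp only [Matrix.mul_apply, Fintype.sum_prod_type, Matrix.kroneckerMap_apply,
    Matrix.blockDiagonal_apply, Matrix.one_apply]
  simp only [mul_ite, ite_mul, mul_zero, zero_mul, one_mul]
  simp only [Finset.sum_ite_irrel, Finset.sum_ite_eq, Finset.sum_ite_eq', Finset.mem_univ, if_true,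
    Finset.sum_const_zero]
  exact Finset.sum_congr rfl fun ℓ _ => by ring

/-- The Kraus operators of a pointer measurement. -/
def pointerKraus (U W : Matrix.unitaryGroup (Fin (2 ^ m)) ℂ) (θ : ℝ) {d : ℕ} (O : Op d)
    (j : Fin (2 ^ m)) : Op d :=
  ∑ ℓ : Fin (2 ^ m), (star (W ℓ j) * U ℓ ⟨0, by positivity⟩) •
    NormedSpace.exp ((-Complex.I * ((θ * (((ℓ : ℕ) : ℝ) - 2 ^ m / 2) : ℝ) : ℂ)) • O)

theorem pointer_kraus (U W : Matrix.unitaryGroup (Fin (2 ^ m)) ℂ) (θ : ℝ)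
    (y : Fin (2 ^ m) → ℝ) {d : ℕ} (O : Op d) :
    (pointer U W θ y).kraus O = pointerKraus U W θ O := by
  funext j
  ext a b
  unfold pointerKraus
  rw [Matrix.sum_apply]
  exact kronecker_mul_blockDiagonal_mul_kronecker_apply _ _ _ a b j _

theorem exp_smul_eq {d : ℕ} {O : Op d} (hO : O.IsHermitian) (c : ℂ) :
    NormedSpace.exp (c • O) = (hO.eigenvectorUnitary : Op d) *
      Matrix.diagonal (fun a => Complex.exp (c * hO.eigenvalues a)) *
      (hO.eigenvectorUnitary : Op d).conjTranspose := by
  have h1 : c • O = (Unitary.toUnits hO.eigenvectorUnitary : Op d) *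
      Matrix.diagonal (fun a => c * hO.eigenvalues a) *
      ((Unitary.toUnits hO.eigenvectorUnitary)⁻¹ : (Op d)ˣ) := by
    have h2 : Matrix.diagonal (fun a => c * (hO.eigenvalues a : ℂ)) =
        c • Matrix.diagonal (RCLike.ofReal ∘ hO.eigenvalues) := by
      ext i j
      by_cases h : i = j <;> simp [h]
    conv_lhs => rw [hO.spectral_theorem, Unitary.conjStarAlgAut_apply]
    rw [h2, mul_smul_comm, smul_mul_assoc]
    rfl
  rw [h1, Matrix.exp_units_conj, Matrix.exp_diagonal]
  congr 2
  congr 1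
  ext a
  rw [Pi.coe_exp, Complex.exp_eq_exp_ℂ]

theorem pointerKraus_eq (U W : Matrix.unitaryGroup (Fin (2 ^ m)) ℂ) (θ : ℝ) {d : ℕ} {O : Op d}
    (hO : O.IsHermitian) (j : Fin (2 ^ m)) :
    pointerKraus U W θ O j = (hO.eigenvectorUnitary : Op d) *
      Matrix.diagonal (fun a => amplitude U W θ j (hO.eigenvalues a)) *
      (hO.eigenvectorUnitary : Op d).conjTranspose := by
  have h : Matrix.diagonal (fun a => amplitude U W θ j (hO.eigenvalues a)) =
      ∑ ℓ, (star (W ℓ j) * U ℓ ⟨0, by positivity⟩) •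
        Matrix.diagonal (fun a => phase m θ (hO.eigenvalues a) ℓ) := by
    ext a b
    rw [Matrix.sum_apply]
    by_cases hab : a = b <;> simp [hab, amplitude]
  rw [pointerKraus, h, Finset.mul_sum, Finset.sum_mul]
  refine Finset.sum_congr rfl fun ℓ _ => ?_
  rw [exp_smul_eq hO, mul_smul_comm, smul_mul_assoc]
  rfl

/-- The ancilla state after the interaction. -/
def pointerState (ψ : Fin (2 ^ m) → ℂ) (θ x : ℝ) (ℓ : Fin (2 ^ m)) : ℂ := ψ ℓ * phase m θ x ℓ

theorem norm_phase (θ x : ℝ) (ℓ : Fin (2 ^ m)) : ‖phase m θ x ℓ‖ = 1 := by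
  have : phase m θ x ℓ =
      Complex.exp (((-(θ * (((ℓ : ℕ) : ℝ) - 2 ^ m / 2) * x) : ℝ) : ℂ) * Complex.I) := by
    rw [phase]; congr 1; push_cast; ring
  rw [this, Complex.norm_exp_ofReal_mul_I]

theorem amplitude_eq_mulVec (U W : Matrix.unitaryGroup (Fin (2 ^ m)) ℂ) (θ x : ℝ)
    (j : Fin (2 ^ m)) : amplitude U W θ j x =
      Matrix.mulVec (W : Matrix (Fin (2 ^ m)) (Fin (2 ^ m)) ℂ).conjTranspose
        (pointerState (fun ℓ => U ℓ ⟨0, by positivity⟩) θ x) j := by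
  simp only [amplitude, Matrix.mulVec, dotProduct, pointerState, Matrix.conjTranspose_apply]
  exact Finset.sum_congr rfl fun ℓ _ => by ring

theorem sum_norm_sq_mulVec (W : Matrix.unitaryGroup (Fin (2 ^ m)) ℂ) (φ : Fin (2 ^ m) → ℂ) :
    ∑ j, ‖Matrix.mulVec (W : Matrix (Fin (2 ^ m)) (Fin (2 ^ m)) ℂ).conjTranspose φ j‖ ^ 2 =
      ∑ ℓ, ‖φ ℓ‖ ^ 2 := by
  have h : ∀ u : Fin (2 ^ m) → ℂ, ((∑ ℓ, ‖u ℓ‖ ^ 2 : ℝ) : ℂ) = star u ⬝ᵥ u := by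
    intro u
    rw [dotProduct, Complex.ofReal_sum]
    refine Finset.sum_congr rfl fun ℓ _ => ?_
    rw [Pi.star_apply, RCLike.star_def, Complex.conj_mul', Complex.ofReal_pow]
  apply Complex.ofReal_injective
  rw [h, h, Matrix.star_mulVec, Matrix.conjTranspose_conjTranspose, ← Matrix.dotProduct_mulVec,
    Matrix.mulVec_mulVec]
  have : (W : Matrix (Fin (2 ^ m)) (Fin (2 ^ m)) ℂ) *
      (W : Matrix (Fin (2 ^ m)) (Fin (2 ^ m)) ℂ).conjTranspose = 1 := Unitary.coe_mul_star_self W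
  rw [this, Matrix.one_mulVec]

theorem conjTranspose_eigenvectorUnitary_mulVec {A : Matrix (Fin (2 ^ m)) (Fin (2 ^ m)) ℂ}
    (hA : A.IsHermitian) (φ : Fin (2 ^ m) → ℂ) (j : Fin (2 ^ m)) :
    Matrix.mulVec (hA.eigenvectorUnitary : Matrix (Fin (2 ^ m)) (Fin (2 ^ m)) ℂ).conjTranspose
      (Matrix.mulVec A φ) j = hA.eigenvalues j *
      Matrix.mulVec (hA.eigenvectorUnitary : Matrix (Fin (2 ^ m)) (Fin (2 ^ m)) ℂ).conjTranspose
        φ j := by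
  set W := (hA.eigenvectorUnitary : Matrix (Fin (2 ^ m)) (Fin (2 ^ m)) ℂ) with hW
  have h1 : W.conjTranspose * W = 1 := Unitary.coe_star_mul_self _
  have h2 : W.conjTranspose * A = Matrix.diagonal (RCLike.ofReal ∘ hA.eigenvalues) *
      W.conjTranspose := by
    conv_lhs => rw [hA.spectral_theorem, Unitary.conjStarAlgAut_apply, ← hW, ← mul_assoc,
      ← mul_assoc, h1, one_mul]
    rfl
  rw [Matrix.mulVec_mulVec, h2, ← Matrix.mulVec_mulVec, Matrix.mulVec_diagonal]
  rfl

/-- Measuring in the eigenbasis of `A` and reporting eigenvalues has the quadratic form of `A` as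
its mean. The bias can thus be computed without knowing the spectrum of `A`. -/
theorem dotProduct_mulVec_eq_sum {A : Matrix (Fin (2 ^ m)) (Fin (2 ^ m)) ℂ}
    (hA : A.IsHermitian) (φ : Fin (2 ^ m) → ℂ) :
    star φ ⬝ᵥ Matrix.mulVec A φ = ((∑ j, hA.eigenvalues j * ‖Matrix.mulVec
      (hA.eigenvectorUnitary : Matrix (Fin (2 ^ m)) (Fin (2 ^ m)) ℂ).conjTranspose φ j‖ ^ 2 : ℝ)
        : ℂ) := by
  set W := (hA.eigenvectorUnitary : Matrix (Fin (2 ^ m)) (Fin (2 ^ m)) ℂ) with hW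
  have h1 : W * W.conjTranspose = 1 := Unitary.coe_mul_star_self _
  have h2 : star φ ⬝ᵥ Matrix.mulVec A φ =
      star (Matrix.mulVec W.conjTranspose φ) ⬝ᵥ Matrix.mulVec W.conjTranspose
        (Matrix.mulVec A φ) := by
    rw [Matrix.star_mulVec, Matrix.conjTranspose_conjTranspose, ← Matrix.dotProduct_mulVec,
      Matrix.mulVec_mulVec _ W, h1, Matrix.one_mulVec]
  rw [h2, dotProduct, Complex.ofReal_sum]
  refine Finset.sum_congr rfl fun j _ => ?_
  rw [conjTranspose_eigenvectorUnitary_mulVec, Pi.star_apply, mul_left_comm, RCLike.star_def,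
    Complex.conj_mul', Complex.ofReal_mul, Complex.ofReal_pow]

theorem exists_unitary_first_column (ψ : Fin (2 ^ m) → ℂ) (hψ : ∑ ℓ, ‖ψ ℓ‖ ^ 2 = 1) :
    ∃ U : Matrix.unitaryGroup (Fin (2 ^ m)) ℂ, ∀ ℓ, U ℓ ⟨0, by positivity⟩ = ψ ℓ := by
  set z : Fin (2 ^ m) := ⟨0, by positivity⟩ with hz
  set v : Fin (2 ^ m) → EuclideanSpace ℂ (Fin (2 ^ m)) := fun _ => WithLp.toLp 2 ψ with hv
  have hn : ‖(WithLp.toLp 2 ψ : EuclideanSpace ℂ (Fin (2 ^ m)))‖ = 1 := by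
    rw [EuclideanSpace.norm_eq, Real.sqrt_eq_one]
    exact hψ
  -- The family `v` is constant, but it is prescribed only on the singleton `{z}`, where
  -- orthonormality reduces to the norm being `1`.
  obtain ⟨b, hb⟩ := Orthonormal.exists_orthonormalBasis_extension_of_card_eq (𝕜 := ℂ)
    (ι := Fin (2 ^ m)) (by simp) (v := v) (s := {z})
    ⟨fun i => hn, fun i j hij => (hij (Subsingleton.elim i j)).elim⟩
  refine ⟨⟨(EuclideanSpace.basisFun (Fin (2 ^ m)) ℂ).toBasis.toMatrix b,
    (EuclideanSpace.basisFun (Fin (2 ^ m)) ℂ).toMatrix_orthonormalBasis_mem_unitary b⟩, fun ℓ => ?_⟩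
  change (EuclideanSpace.basisFun (Fin (2 ^ m)) ℂ).toBasis.toMatrix b ℓ z = ψ ℓ
  rw [Module.Basis.toMatrix_apply, hb z rfl]
  simp [hv]

end Pointer

/-! ### Outcome statistics of pointer measurements -/

section Statistics

variable {m d : ℕ} {O ρ : Op d}

/-- The distribution of the observable `O` in the state `ρ`, over the eigenvectors of `O`. -/
def spectralWeight (hO : O.IsHermitian) (ρ : Op d) (a : Fin d) : ℝ :=
  ((hO.eigenvectorUnitary : Op d).conjTranspose * ρ * (hO.eigenvectorUnitary : Op d)) a a |>.re

theorem spectralWeight_nonneg (hO : O.IsHermitian) (hρ : ρ.PosSemidef) (a : Fin d) :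
    0 ≤ spectralWeight hO ρ a :=
  (Complex.nonneg_iff.1 (hρ.conjTranspose_mul_mul_same _).diag_nonneg).1

theorem ofReal_spectralWeight (hO : O.IsHermitian) (hρ : ρ.PosSemidef) (a : Fin d) :
    (spectralWeight hO ρ a : ℂ) =
      ((hO.eigenvectorUnitary : Op d).conjTranspose * ρ * (hO.eigenvectorUnitary : Op d)) a a := by
  have h := Complex.nonneg_iff.1 ((hρ.conjTranspose_mul_mul_same
    (hO.eigenvectorUnitary : Op d)).diag_nonneg (i := a))
  exact Complex.ext rfl h.2

theorem trace_conj_diagonal_mul (hO : O.IsHermitian) (hρ : ρ.PosSemidef) (f : Fin d → ℝ) :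
    ((hO.eigenvectorUnitary : Op d) * Matrix.diagonal (fun a => (f a : ℂ)) *
      (hO.eigenvectorUnitary : Op d).conjTranspose * ρ).trace =
      ((∑ a, spectralWeight hO ρ a * f a : ℝ) : ℂ) := by
  set U := (hO.eigenvectorUnitary : Op d) with hU
  have h : (U * Matrix.diagonal (fun a => (f a : ℂ)) * U.conjTranspose * ρ).trace =
      ((U.conjTranspose * ρ * U) * Matrix.diagonal (fun a => (f a : ℂ))).trace := by
    rw [Matrix.trace_mul_comm (U.conjTranspose * ρ * U), mul_assoc, mul_assoc,
      Matrix.trace_mul_comm]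
    simp only [mul_assoc]
  rw [h, Matrix.trace, Complex.ofReal_sum]
  refine Finset.sum_congr rfl fun a _ => ?_
  rw [Matrix.diag_apply, Matrix.mul_diagonal, Complex.ofReal_mul, ofReal_spectralWeight hO hρ]

theorem eigenvectorUnitary_mul_conjTranspose (hO : O.IsHermitian) :
    (hO.eigenvectorUnitary : Op d) * (hO.eigenvectorUnitary : Op d).conjTranspose = 1 :=
  Unitary.coe_mul_star_self _

theorem conjTranspose_mul_eigenvectorUnitary (hO : O.IsHermitian) :
    (hO.eigenvectorUnitary : Op d).conjTranspose * (hO.eigenvectorUnitary : Op d) = 1 :=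
  Unitary.coe_star_mul_self _

theorem conj_diagonal_mul_conj_diagonal (hO : O.IsHermitian) (f g : Fin d → ℂ) :
    ((hO.eigenvectorUnitary : Op d) * Matrix.diagonal f *
      (hO.eigenvectorUnitary : Op d).conjTranspose) *
    ((hO.eigenvectorUnitary : Op d) * Matrix.diagonal g *
      (hO.eigenvectorUnitary : Op d).conjTranspose) =
    (hO.eigenvectorUnitary : Op d) * Matrix.diagonal (fun a => f a * g a) *
      (hO.eigenvectorUnitary : Op d).conjTranspose := by
  set U := (hO.eigenvectorUnitary : Op d) with hU
  calc _ = U * Matrix.diagonal f * (U.conjTranspose * U) * Matrix.diagonal g * U.conjTranspose := by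
        simp only [mul_assoc]
    _ = U * (Matrix.diagonal f * Matrix.diagonal g) * U.conjTranspose := by
        rw [hU, conjTranspose_mul_eigenvectorUnitary]; simp only [mul_assoc, mul_one]
    _ = _ := by rw [Matrix.diagonal_mul_diagonal]

theorem conjTranspose_conj_diagonal (hO : O.IsHermitian) (f : Fin d → ℂ) :
    ((hO.eigenvectorUnitary : Op d) * Matrix.diagonal f *
      (hO.eigenvectorUnitary : Op d).conjTranspose).conjTranspose =
    (hO.eigenvectorUnitary : Op d) * Matrix.diagonal (fun a => star (f a)) *
      (hO.eigenvectorUnitary : Op d).conjTranspose := by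
  rw [Matrix.conjTranspose_mul, Matrix.conjTranspose_mul, Matrix.conjTranspose_conjTranspose,
    Matrix.diagonal_conjTranspose, mul_assoc]
  rfl

theorem self_eq_conj_diagonal (hO : O.IsHermitian) :
    O = (hO.eigenvectorUnitary : Op d) *
      Matrix.diagonal (fun a => ((hO.eigenvalues a : ℝ) : ℂ)) *
      (hO.eigenvectorUnitary : Op d).conjTranspose := by
  conv_lhs => rw [hO.spectral_theorem, Unitary.conjStarAlgAut_apply]
  rfl

theorem expect_eq_sum (hO : O.IsHermitian) (hρ : ρ.PosSemidef) :
    expect ρ O = ∑ a, spectralWeight hO ρ a * hO.eigenvalues a := by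
  have h := trace_conj_diagonal_mul hO hρ hO.eigenvalues
  rw [← self_eq_conj_diagonal] at h
  rw [expect, h, Complex.ofReal_re]

theorem expect_sq_eq_sum (hO : O.IsHermitian) (hρ : ρ.PosSemidef) :
    expect ρ (O * O) = ∑ a, spectralWeight hO ρ a * hO.eigenvalues a ^ 2 := by
  have h := trace_conj_diagonal_mul hO hρ (fun a => hO.eigenvalues a ^ 2)
  have h2 : O * O = (hO.eigenvectorUnitary : Op d) *
      Matrix.diagonal (fun a => ((hO.eigenvalues a ^ 2 : ℝ) : ℂ)) *
      (hO.eigenvectorUnitary : Op d).conjTranspose := by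
    conv_lhs => rw [self_eq_conj_diagonal hO, conj_diagonal_mul_conj_diagonal]
    simp only [pow_two, Complex.ofReal_mul]
  rw [← h2] at h
  rw [expect, h, Complex.ofReal_re]

theorem sum_spectralWeight (hO : O.IsHermitian) (hρ : ρ.PosSemidef) (h1 : ρ.trace = 1) :
    ∑ a, spectralWeight hO ρ a = 1 := by
  have h := trace_conj_diagonal_mul hO hρ (fun _ => 1)
  rw [Complex.ofReal_one, Matrix.diagonal_one, mul_one, eigenvectorUnitary_mul_conjTranspose,
    one_mul, h1] at h
  simpa using (Complex.ofReal_injective h).symm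

theorem abs_eigenvalues_le_opNorm (hO : O.IsHermitian) (a : Fin d) :
    |hO.eigenvalues a| ≤ opNorm O := by
  have h := (Matrix.toEuclideanCLM (𝕜 := ℂ) O).le_opNorm (hO.eigenvectorBasis a)
  have h2 : Matrix.toEuclideanCLM (𝕜 := ℂ) O (hO.eigenvectorBasis a) =
      (hO.eigenvalues a : ℂ) • hO.eigenvectorBasis a := by
    have h3 := hO.mulVec_eigenvectorBasis a
    ext i
    exact (congrFun h3 i).trans rfl
  rw [h2, norm_smul, hO.eigenvectorBasis.norm_eq_one, mul_one, mul_one, Complex.norm_real,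
    Real.norm_eq_abs] at h
  exact h

variable (U W : Matrix.unitaryGroup (Fin (2 ^ m)) ℂ) (θ : ℝ)

/-- The probability of the result `j` when the observable has the value `x`. -/
def likelihood (j : Fin (2 ^ m)) (x : ℝ) : ℝ := ‖amplitude U W θ j x‖ ^ 2

theorem sum_likelihood (x : ℝ) : ∑ j, likelihood U W θ j x = 1 := by
  simp only [likelihood, amplitude_eq_mulVec, sum_norm_sq_mulVec, pointerState, norm_mul,
    norm_phase, mul_one]
  have h := congrFun (congrFun (Unitary.coe_star_mul_self U) ⟨0, by positivity⟩) ⟨0, by positivity⟩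
  rw [Matrix.mul_apply, Matrix.one_apply_eq] at h
  apply Complex.ofReal_injective
  rw [Complex.ofReal_sum, Complex.ofReal_one, ← h]
  refine Finset.sum_congr rfl fun ℓ _ => ?_
  rw [Matrix.star_apply, RCLike.star_def, Complex.conj_mul', Complex.ofReal_pow]

theorem effect_pointer (hO : O.IsHermitian) (w : Fin (2 ^ m) → ℝ) :
    effect (pointerKraus U W θ O) w = (hO.eigenvectorUnitary : Op d) *
      Matrix.diagonal (fun a => ((∑ j, w j * likelihood U W θ j (hO.eigenvalues a) : ℝ) : ℂ)) *
      (hO.eigenvectorUnitary : Op d).conjTranspose := by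
  have h : Matrix.diagonal (fun a => ((∑ j, w j * likelihood U W θ j (hO.eigenvalues a) : ℝ) : ℂ)) =
      ∑ j, (w j : ℂ) • Matrix.diagonal (fun a => star (amplitude U W θ j (hO.eigenvalues a)) *
        amplitude U W θ j (hO.eigenvalues a)) := by
    ext a b
    rw [Matrix.sum_apply]
    by_cases hab : a = b
    · subst hab
      simp [likelihood, Complex.conj_mul']
    · simp [hab]
  rw [h, effect, Finset.mul_sum, Finset.sum_mul]
  refine Finset.sum_congr rfl fun j _ => ?_
  rw [pointerKraus_eq U W θ hO, conjTranspose_conj_diagonal, conj_diagonal_mul_conj_diagonal,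
    mul_smul_comm, smul_mul_assoc]

theorem trace_effect_pointer (hO : O.IsHermitian) (hρ : ρ.PosSemidef) (w : Fin (2 ^ m) → ℝ) :
    (effect (pointerKraus U W θ O) w * ρ).trace = ((∑ a, spectralWeight hO ρ a *
      ∑ j, w j * likelihood U W θ j (hO.eigenvalues a) : ℝ) : ℂ) := by
  rw [effect_pointer U W θ hO, trace_conj_diagonal_mul hO hρ]

/-- Every Kraus operator is diagonal in the eigenbasis of `O` and is a combination of exponentials
of `O`. This is where commutation of the observable with the Gibbs state enters. -/
theorem isCommutingInstrument_pointer (hO : O.IsHermitian) (hρO : Commute ρ O) :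
    IsCommutingInstrument ρ (pointerKraus U W θ O) where
  sum_eq_one := by
    have h := effect_pointer U W θ hO 1
    simp only [Pi.one_apply, one_mul, sum_likelihood] at h
    rw [Complex.ofReal_one, Matrix.diagonal_one, mul_one, eigenvectorUnitary_mul_conjTranspose] at h
    rw [← h]
    simp [effect]
  normal j := by
    unfold Commute SemiconjBy
    rw [pointerKraus_eq U W θ hO, conjTranspose_conj_diagonal,
      conj_diagonal_mul_conj_diagonal, conj_diagonal_mul_conj_diagonal]
    simp only [mul_comm]
  commute_state j := by
    rw [pointerKraus]
    exact Commute.sum_right _ _ _ fun ℓ _ => ((hρO.smul_right _).exp_right).smul_right _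

/-- A pointer measurement that is accurate on the interval `[-κ, κ]`: bias at most `ε / 2` and mean
square error at most `2`. -/
structure IsAccurate (y : Fin (2 ^ m) → ℝ) (κ ε : ℝ) : Prop where
  bias : ∀ x, |x| ≤ κ → |∑ j, y j * likelihood U W θ j x - x| ≤ ε / 2
  error : ∀ x, |x| ≤ κ → ∑ j, (y j - x) ^ 2 * likelihood U W θ j x ≤ 2

variable {U W θ} {y : Fin (2 ^ m) → ℝ}

theorem IsAccurate.abs_mean_sub_le {κ ε : ℝ} (h : IsAccurate U W θ y κ ε) (hO : O.IsHermitian)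
    (hρ : ρ.PosSemidef) (h1 : ρ.trace = 1) (hκ : opNorm O ≤ κ) :
    |∑ a, spectralWeight hO ρ a * ∑ j, y j * likelihood U W θ j (hO.eigenvalues a) -
      expect ρ O| ≤ ε / 2 := by
  rw [expect_eq_sum hO hρ, ← Finset.sum_sub_distrib]
  calc _ ≤ ∑ a, spectralWeight hO ρ a * (ε / 2) := by
        refine (Finset.abs_sum_le_sum_abs _ _).trans (Finset.sum_le_sum fun a _ => ?_)
        rw [← mul_sub, abs_mul, abs_of_nonneg (spectralWeight_nonneg hO hρ a)]
        exact mul_le_mul_of_nonneg_left (h.bias _ ((abs_eigenvalues_le_opNorm hO a).trans hκ))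
          (spectralWeight_nonneg hO hρ a)
    _ = ε / 2 := by rw [← Finset.sum_mul, sum_spectralWeight hO hρ h1, one_mul]

/-- From `(y - μ)² ≤ 2 (y - x)² + 2 (x - μ)²` the bound is `2 * 2 + 2 (variance + 1 / 4)`, which is
below `5 (variance + 1)` because the variance is nonnegative. -/
theorem IsAccurate.variance_le {κ ε : ℝ} (h : IsAccurate U W θ y κ ε) (hO : O.IsHermitian)
    (hρ : ρ.PosSemidef) (h1 : ρ.trace = 1) (hκ : opNorm O ≤ κ) {μ : ℝ}
    (hμ : |μ - expect ρ O| ≤ 1 / 2) :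
    ∑ a, spectralWeight hO ρ a * ∑ j, (y j - μ) ^ 2 * likelihood U W θ j (hO.eigenvalues a) ≤
      5 * (variance ρ O + 1) := by
  have hp := spectralWeight_nonneg hO hρ
  have hL : ∀ j x, 0 ≤ likelihood U W θ j x := fun j x => sq_nonneg _
  have hvar : ∑ a, spectralWeight hO ρ a * (hO.eigenvalues a - μ) ^ 2 =
      variance ρ O + (μ - expect ρ O) ^ 2 := by
    have e1 : ∑ a, spectralWeight hO ρ a * (hO.eigenvalues a - μ) ^ 2 =
        expect ρ (O * O) - 2 * μ * expect ρ O + μ ^ 2 := by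
      calc _ = ∑ a, (spectralWeight hO ρ a * hO.eigenvalues a ^ 2 -
            2 * μ * (spectralWeight hO ρ a * hO.eigenvalues a) +
            spectralWeight hO ρ a * μ ^ 2) := Finset.sum_congr rfl fun a _ => by ring
        _ = _ := by
            rw [Finset.sum_add_distrib, Finset.sum_sub_distrib, ← Finset.mul_sum, ← Finset.sum_mul,
              sum_spectralWeight hO hρ h1, one_mul, ← expect_eq_sum, ← expect_sq_eq_sum] <;>
              assumption
    rw [e1, variance]; ring
  have hvar0 : 0 ≤ variance ρ O := by
    have e2 : ∑ a, spectralWeight hO ρ a * (hO.eigenvalues a - expect ρ O) ^ 2 = variance ρ O := by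
      calc _ = ∑ a, (spectralWeight hO ρ a * hO.eigenvalues a ^ 2 -
            2 * expect ρ O * (spectralWeight hO ρ a * hO.eigenvalues a) +
            spectralWeight hO ρ a * expect ρ O ^ 2) := Finset.sum_congr rfl fun a _ => by ring
        _ = expect ρ (O * O) - 2 * expect ρ O * expect ρ O + 1 * expect ρ O ^ 2 := by
            rw [Finset.sum_add_distrib, Finset.sum_sub_distrib, ← Finset.mul_sum, ← Finset.sum_mul,
              sum_spectralWeight hO hρ h1, ← expect_eq_sum, ← expect_sq_eq_sum] <;> assumption
        _ = _ := by rw [variance]; ring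
    rw [← e2]
    exact Finset.sum_nonneg fun a _ => mul_nonneg (hp a) (sq_nonneg _)
  have hstep : ∀ a, ∑ j, (y j - μ) ^ 2 * likelihood U W θ j (hO.eigenvalues a) ≤
      4 + 2 * (hO.eigenvalues a - μ) ^ 2 := by
    intro a
    set x := hO.eigenvalues a
    calc _ ≤ ∑ j, (2 * ((y j - x) ^ 2 * likelihood U W θ j x) +
          2 * (x - μ) ^ 2 * likelihood U W θ j x) := by
          refine Finset.sum_le_sum fun j _ => ?_
          have : (y j - μ) ^ 2 ≤ 2 * (y j - x) ^ 2 + 2 * (x - μ) ^ 2 := by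
            nlinarith [sq_nonneg ((y j - x) - (x - μ))]
          calc _ ≤ (2 * (y j - x) ^ 2 + 2 * (x - μ) ^ 2) * likelihood U W θ j x :=
                mul_le_mul_of_nonneg_right this (hL j x)
            _ = _ := by ring
      _ = 2 * ∑ j, (y j - x) ^ 2 * likelihood U W θ j x + 2 * (x - μ) ^ 2 := by
          rw [Finset.sum_add_distrib, ← Finset.mul_sum, ← Finset.mul_sum, sum_likelihood, mul_one]
      _ ≤ _ := by
          have := h.error x ((abs_eigenvalues_le_opNorm hO a).trans hκ)
          linarith
  calc _ ≤ ∑ a, spectralWeight hO ρ a * (4 + 2 * (hO.eigenvalues a - μ) ^ 2) :=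
        Finset.sum_le_sum fun a _ => mul_le_mul_of_nonneg_left (hstep a) (hp a)
    _ = 4 + 2 * (variance ρ O + (μ - expect ρ O) ^ 2) := by
        rw [← hvar, Finset.mul_sum]
        simp only [mul_add]
        rw [Finset.sum_add_distrib, ← Finset.sum_mul, sum_spectralWeight hO hρ h1, one_mul]
        congr 1
        exact Finset.sum_congr rfl fun a _ => by ring
    _ ≤ _ := by
        have : (μ - expect ρ O) ^ 2 ≤ (1 / 2) ^ 2 := by
          rw [← sq_abs]
          exact pow_le_pow_left₀ (abs_nonneg _) hμ 2
        linarith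

end Statistics

/-! ### Trigonometric approximation of the identity near zero -/

/-- Coefficients of the polynomial `z ↦ logTaylor D ((z - 1) / 2)`. -/
def sawtoothCoeff (D k : ℕ) : ℝ :=
  ∑ n ∈ Finset.range D, (-1) ^ (n + 1) / n * ((-1) ^ (n - k) * n.choose k / 2 ^ n)

theorem sum_choose_extend {R : Type*} [CommRing R] {D n : ℕ} (hn : n < D) (f : ℕ → R) :
    ∑ k ∈ Finset.range D, f k * (n.choose k : R) =
      ∑ k ∈ Finset.range (n + 1), f k * (n.choose k : R) := by
  symm
  refine Finset.sum_subset (Finset.range_subset_range.2 hn) fun k _ hk => ?_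
  rw [Nat.choose_eq_zero_of_lt (by simpa using hk), Nat.cast_zero, mul_zero]

/-- Each power of `(z - 1) / 2` is expanded by the binomial theorem. The term `n = 0` vanishes on
both sides because division by zero gives zero. -/
theorem sum_sawtoothCoeff_mul_pow (D : ℕ) (z : ℂ) :
    ∑ k ∈ Finset.range D, (sawtoothCoeff D k : ℂ) * z ^ k =
      Complex.logTaylor D ((z - 1) / 2) := by
  simp only [sawtoothCoeff, Complex.ofReal_sum, Finset.sum_mul]
  rw [Finset.sum_comm, Complex.logTaylor]
  refine Finset.sum_congr rfl fun n hn => ?_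
  have h1 : ∑ k ∈ Finset.range D, (((-1) ^ (n + 1) / n * ((-1) ^ (n - k) * n.choose k / 2 ^ n) : ℝ)
      : ℂ) * z ^ k = (-1) ^ (n + 1) / n / 2 ^ n *
      ∑ k ∈ Finset.range D, (z ^ k * (-1) ^ (n - k)) * (n.choose k : ℂ) := by
    rw [Finset.mul_sum]
    refine Finset.sum_congr rfl fun k _ => ?_
    push_cast
    ring
  rw [h1, sum_choose_extend (Finset.mem_range.1 hn), ← add_pow, div_pow, ← sub_eq_add_neg]
  ring

/-- The coefficients of `((z - 1) / 2) ^ n` have absolute sum `1`, and at most `D` such powers occur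
with weights at most `1`. -/
theorem sum_abs_sawtoothCoeff_le (D : ℕ) :
    ∑ k ∈ Finset.range D, |sawtoothCoeff D k| ≤ D := by
  calc _ ≤ ∑ k ∈ Finset.range D, ∑ n ∈ Finset.range D, (1 / 2 ^ n : ℝ) * (1 * n.choose k) := by
        refine Finset.sum_le_sum fun k _ => (Finset.abs_sum_le_sum_abs _ _).trans
          (Finset.sum_le_sum fun n _ => ?_)
        rw [abs_mul, abs_div, abs_div, abs_mul, abs_pow, abs_pow, abs_neg, abs_one, one_pow,
          one_pow, Nat.abs_cast, Nat.abs_cast, abs_of_pos (by positivity : (0 : ℝ) < 2 ^ n)]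
        have h : (1 / n : ℝ) ≤ 1 := by
          rcases Nat.eq_zero_or_pos n with h | h
          · simp [h]
          · rw [div_le_one (by exact_mod_cast h)]
            exact_mod_cast h
        calc _ ≤ 1 * (1 * (n.choose k : ℝ) / 2 ^ n) :=
              mul_le_mul_of_nonneg_right h (by positivity)
          _ = _ := by ring
    _ = ∑ n ∈ Finset.range D, (1 : ℝ) := by
        rw [Finset.sum_comm]
        refine Finset.sum_congr rfl fun n hn => ?_
        rw [← Finset.mul_sum, sum_choose_extend (Finset.mem_range.1 hn) fun _ => (1 : ℝ)]
        simp only [one_mul]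
        rw [← Nat.cast_sum, Nat.sum_range_choose]
        push_cast
        rw [one_div, inv_mul_cancel₀ (by positivity)]
    _ = D := by simp

/-- For `z = exp (i φ)` one has `1 + (z - 1) / 2 = cos (φ / 2) exp (i φ / 2)`, whose logarithm has
imaginary part `φ / 2`. Since `|(z - 1) / 2| ≤ 1 / 4`, the Taylor error is geometric with ratio `1 /
4`; the constant is `2 * 4 / 3 ≤ 3`. -/
theorem abs_sum_sawtoothCoeff_sub_le {D : ℕ} (hD : 1 ≤ D) {φ : ℝ} (hφ : |φ| ≤ 1 / 2) :
    |∑ k ∈ Finset.range D, sawtoothCoeff D k * (2 * Real.sin (k * φ)) - φ| ≤ 3 / 4 ^ D := by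
  obtain ⟨n, rfl⟩ : ∃ n, D = n + 1 := ⟨D - 1, by omega⟩
  set z : ℂ := Complex.exp (φ * Complex.I) with hz
  set w : ℂ := (z - 1) / 2 with hw
  have hwn : ‖w‖ ≤ 1 / 4 := by
    have h := Real.norm_exp_I_mul_ofReal_sub_one_le (x := φ)
    rw [mul_comm, ← hz, Real.norm_eq_abs] at h
    rw [hw, norm_div, Complex.norm_ofNat]
    linarith
  have hcos : 0 < Real.cos (φ / 2) := by
    have h := abs_le.1 hφ
    refine Real.cos_pos_of_mem_Ioo ⟨?_, ?_⟩ <;> linarith [Real.pi_gt_three]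
  have hlog : (Complex.log (1 + w)).im = φ / 2 := by
    have h1 : 1 + w = (Real.cos (φ / 2) : ℝ) *
        (Complex.cos ((φ / 2 : ℝ) : ℂ) + Complex.sin ((φ / 2 : ℝ) : ℂ) * Complex.I) := by
      rw [← Complex.exp_mul_I, hw, hz, Complex.ofReal_cos, Complex.cos, div_mul_eq_mul_div, add_mul,
        ← Complex.exp_add, ← Complex.exp_add]
      have e1 : ((φ / 2 : ℝ) : ℂ) * Complex.I + ((φ / 2 : ℝ) : ℂ) * Complex.I = φ * Complex.I := by
        push_cast; ring
      have e2 : -((φ / 2 : ℝ) : ℂ) * Complex.I + ((φ / 2 : ℝ) : ℂ) * Complex.I = 0 := by ring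
      rw [e1, e2, Complex.exp_zero]
      ring
    have h := abs_le.1 hφ
    rw [Complex.log_im, h1, Complex.arg_mul_cos_add_sin_mul_I hcos]
    constructor <;> linarith [Real.pi_gt_three]
  have him : (Complex.logTaylor (n + 1) w).im =
      ∑ k ∈ Finset.range (n + 1), sawtoothCoeff (n + 1) k * Real.sin (k * φ) := by
    rw [hw, ← sum_sawtoothCoeff_mul_pow, Complex.im_sum]
    refine Finset.sum_congr rfl fun k _ => ?_
    rw [Complex.im_ofReal_mul, hz, ← Complex.exp_nat_mul]
    have : (k : ℂ) * (φ * Complex.I) = ((k * φ : ℝ) : ℂ) * Complex.I := by push_cast; ring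
    rw [this, Complex.exp_ofReal_mul_I_im]
  have h2 := Complex.norm_log_sub_logTaylor_le n (z := w) (by linarith)
  have h3 := (Complex.abs_im_le_norm _).trans h2
  rw [Complex.sub_im, hlog, him] at h3
  have h4 : ‖w‖ ^ (n + 1) * (1 - ‖w‖)⁻¹ / (n + 1) ≤ (1 / 4) ^ (n + 1) * (4 / 3) := by
    have h5 : (1 - ‖w‖)⁻¹ ≤ 4 / 3 := by
      rw [inv_le_comm₀ (by linarith) (by norm_num)]
      linarith
    have h6 : 0 ≤ (1 - ‖w‖)⁻¹ := inv_nonneg.2 (by linarith)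
    refine (div_le_self (mul_nonneg (by positivity) h6) ?_).trans
      (mul_le_mul (pow_le_pow_left₀ (norm_nonneg _) hwn _) h5 h6 (by positivity))
    have : (0 : ℝ) ≤ n := Nat.cast_nonneg n
    linarith
  have h7 : ∑ k ∈ Finset.range (n + 1), sawtoothCoeff (n + 1) k * (2 * Real.sin (k * φ)) =
      2 * ∑ k ∈ Finset.range (n + 1), sawtoothCoeff (n + 1) k * Real.sin (k * φ) := by
    rw [Finset.mul_sum]
    exact Finset.sum_congr rfl fun k _ => by ring
  rw [h7, abs_sub_comm]
  have h8 : |φ - 2 * ∑ k ∈ Finset.range (n + 1), sawtoothCoeff (n + 1) k * Real.sin (k * φ)| =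
      2 * |φ / 2 - ∑ k ∈ Finset.range (n + 1), sawtoothCoeff (n + 1) k * Real.sin (k * φ)| := by
    rw [← abs_two, ← abs_mul, abs_two]
    congr 1
    ring
  rw [h8]
  have h9 : (1 / 4 : ℝ) ^ (n + 1) = 1 / 4 ^ (n + 1) := by rw [div_pow, one_pow]
  rw [h9] at h4
  have h10 : (0 : ℝ) < 1 / 4 ^ (n + 1) := by positivity
  have h11 : (3 : ℝ) / 4 ^ (n + 1) = 3 * (1 / 4 ^ (n + 1)) := by ring
  rw [h11]
  linarith

/-! ### The triangular window -/

section Window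

/-- A triangular bump on the integers, supported in `[0, L)`. -/
def tent (L : ℕ) (i : ℤ) : ℝ := max 0 (min ((i : ℝ) + 1) (L - i))

variable {L : ℕ}

theorem tent_nonneg (i : ℤ) : 0 ≤ tent L i := le_max_left _ _

theorem tent_le (i : ℤ) : tent L i ≤ L := by
  refine max_le (Nat.cast_nonneg L) ?_
  by_cases h : 0 ≤ i
  · refine (min_le_right _ _).trans ?_
    have : (0 : ℝ) ≤ i := by exact_mod_cast h
    linarith
  · refine (min_le_left _ _).trans ?_
    have h1 : i + 1 ≤ 0 := by omega
    have : (i : ℝ) + 1 ≤ 0 := by exact_mod_cast h1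
    exact this.trans (Nat.cast_nonneg L)

theorem tent_eq_zero {i : ℤ} (h : i < 0 ∨ (L : ℤ) ≤ i) : tent L i = 0 := by
  refine max_eq_left ?_
  rcases h with h | h
  · refine (min_le_left _ _).trans ?_
    exact_mod_cast (by omega : i + 1 ≤ 0)
  · refine (min_le_right _ _).trans ?_
    have : (L : ℝ) ≤ i := by exact_mod_cast h
    linarith

theorem abs_tent_sub_le (i j : ℤ) : |tent L i - tent L j| ≤ |(i : ℝ) - j| := by
  refine (abs_max_sub_max_le_max _ _ _ _).trans (max_le (by simp) ?_)
  refine (abs_min_sub_min_le_max _ _ _ _).trans (max_le ?_ ?_)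
  · simp
  · rw [abs_sub_comm]; simp

theorem tent_reflect (i : ℤ) : tent L (L - 1 - i) = tent L i := by
  unfold tent
  rw [min_comm]
  push_cast
  congr 2 <;> ring

/-- On the middle half, `2 M` points, the tent is at least `M`. Having slope at most `1` and square
sum of order `L ^ 3` is what makes the normalized window vary slowly. -/
theorem sum_tent_sq_ge {M : ℕ} (hL : L = 4 * M) :
    (L : ℝ) ^ 3 / 32 ≤ ∑ ℓ : Fin L, tent L ((ℓ : ℕ) : ℤ) ^ 2 := by
  rw [Fin.sum_univ_eq_sum_range (fun ℓ => tent L (ℓ : ℤ) ^ 2) L]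
  have h1 : ∑ ℓ ∈ Finset.Ico M (3 * M), (M : ℝ) ^ 2 ≤ ∑ ℓ ∈ Finset.range L, tent L (ℓ : ℤ) ^ 2 := by
    refine (Finset.sum_le_sum fun ℓ hℓ => ?_).trans
      (Finset.sum_le_sum_of_subset_of_nonneg (s := Finset.Ico M (3 * M)) ?_
        fun _ _ _ => sq_nonneg _)
    · rw [Finset.mem_Ico] at hℓ
      refine pow_le_pow_left₀ (Nat.cast_nonneg M) (le_max_of_le_right (le_min ?_ ?_)) 2
      · have : (M : ℝ) ≤ ℓ := by exact_mod_cast hℓ.1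
        push_cast
        linarith
      · have : (ℓ : ℝ) ≤ 3 * M := by exact_mod_cast hℓ.2.le
        rw [hL]
        push_cast
        linarith
    · intro ℓ hℓ
      rw [Finset.mem_Ico] at hℓ
      rw [Finset.mem_range]
      omega
  refine le_trans (le_of_eq ?_) h1
  rw [Finset.sum_const, Nat.card_Ico, nsmul_eq_mul, hL]
  have : 3 * M - M = 2 * M := by omega
  rw [this]
  push_cast
  ring

end Window

/-! ### The pointer observable -/

section PointerObservable

/-- The normalization of the triangular window on `2 ^ m` points. -/
def windowScale (m : ℕ) : ℝ := (Real.sqrt (∑ ℓ : Fin (2 ^ m), tent (2 ^ m) ((ℓ : ℕ) : ℤ) ^ 2))⁻¹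

/-- The normalized triangular window. -/
def window (m : ℕ) (i : ℤ) : ℝ := windowScale m * tent (2 ^ m) i

/-- The overlap of the window with its translate by `k`. -/
def overlap (m k : ℕ) : ℝ := ∑ ℓ : Fin (2 ^ m), window m (ℓ : ℕ) * window m ((ℓ : ℕ) + k)

variable {m : ℕ}

theorem windowScale_nonneg : 0 ≤ windowScale m := inv_nonneg.2 (Real.sqrt_nonneg _)

theorem pow_eq_four_mul (hm : 2 ≤ m) : 2 ^ m = 4 * 2 ^ (m - 2) := by
  obtain ⟨n, rfl⟩ := Nat.exists_eq_add_of_le hm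
  rw [Nat.add_sub_cancel_left, pow_add]
  norm_num

theorem sum_tent_sq_pos (hm : 2 ≤ m) :
    0 < ∑ ℓ : Fin (2 ^ m), tent (2 ^ m) ((ℓ : ℕ) : ℤ) ^ 2 := by
  refine lt_of_lt_of_le ?_ (sum_tent_sq_ge (pow_eq_four_mul hm))
  positivity

theorem windowScale_sq_le (hm : 2 ≤ m) : windowScale m ^ 2 ≤ 32 / (2 ^ m : ℝ) ^ 3 := by
  have h := sum_tent_sq_ge (pow_eq_four_mul hm)
  rw [windowScale, inv_pow, Real.sq_sqrt (sum_tent_sq_pos hm).le, ← inv_div]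
  refine inv_anti₀ (by positivity) ?_
  push_cast at h
  exact h

theorem sum_window_sq (hm : 2 ≤ m) : ∑ ℓ : Fin (2 ^ m), window m (ℓ : ℕ) ^ 2 = 1 := by
  simp only [window, mul_pow]
  rw [← Finset.mul_sum, windowScale, inv_pow, Real.sq_sqrt (sum_tent_sq_pos hm).le]
  exact inv_mul_cancel₀ (sum_tent_sq_pos hm).ne'

theorem window_nonneg (i : ℤ) : 0 ≤ window m i := mul_nonneg windowScale_nonneg (tent_nonneg i)

theorem window_le (i : ℤ) : window m i ≤ windowScale m * 2 ^ m := by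
  have h := tent_le (L := 2 ^ m) i
  push_cast at h
  exact mul_le_mul_of_nonneg_left h windowScale_nonneg

theorem window_eq_zero {i : ℤ} (h : i < 0 ∨ 2 ^ m ≤ i) : window m i = 0 := by
  rw [window, tent_eq_zero (by push_cast; exact h), mul_zero]

theorem abs_window_sub_le (i j : ℤ) : |window m i - window m j| ≤ windowScale m * |(i : ℝ) - j| := by
  rw [window, window, ← mul_sub, abs_mul, abs_of_nonneg windowScale_nonneg]
  exact mul_le_mul_of_nonneg_left (abs_tent_sub_le i j) windowScale_nonneg

/-- By the reflection symmetry of the tent, left and right translates have the same overlap, so a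
single normalization per `k` serves both off-diagonals. -/
theorem sum_window_mul_window_sub (k : ℕ) :
    ∑ ℓ : Fin (2 ^ m), window m (ℓ : ℕ) * window m ((ℓ : ℕ) - k) = overlap m k := by
  have hr : ∀ i : ℤ, window m (2 ^ m - 1 - i) = window m i := by
    intro i
    have h := tent_reflect (L := 2 ^ m) i
    push_cast at h
    rw [window, window, h]
  rw [overlap, ← Equiv.sum_comp Fin.revPerm]
  refine Finset.sum_congr rfl fun ℓ _ => ?_
  have h1 : ((((Fin.revPerm ℓ : Fin (2 ^ m)) : ℕ) : ℤ)) = 2 ^ m - 1 - (ℓ : ℕ) := by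
    rw [Fin.revPerm_apply, Fin.val_rev, Nat.cast_sub (by omega)]
    push_cast
    ring
  rw [h1, hr, ← hr ((ℓ : ℕ) + (k : ℤ))]
  congr 2
  ring

theorem abs_one_sub_overlap_le (hm : 2 ≤ m) (k : ℕ) : |1 - overlap m k| ≤ 32 * k / 2 ^ m := by
  have hL : (0 : ℝ) < 2 ^ m := by positivity
  rw [← sum_window_sq hm, overlap, ← Finset.sum_sub_distrib]
  have hc := windowScale_nonneg (m := m)
  calc _ ≤ ∑ ℓ : Fin (2 ^ m), (windowScale m * 2 ^ m) * (windowScale m * k) := by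
        refine (Finset.abs_sum_le_sum_abs _ _).trans (Finset.sum_le_sum fun ℓ _ => ?_)
        rw [pow_two, ← mul_sub, abs_mul, abs_of_nonneg (window_nonneg _)]
        refine mul_le_mul (window_le _) ?_ (abs_nonneg _) (by positivity)
        refine (abs_window_sub_le _ _).trans (le_of_eq ?_)
        congr 1
        push_cast
        rw [sub_add_cancel_left, abs_neg, Nat.abs_cast]
    _ = windowScale m ^ 2 * (2 ^ m) ^ 2 * k := by
        rw [Finset.sum_const, Finset.card_univ, Fintype.card_fin, nsmul_eq_mul]
        push_cast
        ring
    _ ≤ 32 / (2 ^ m : ℝ) ^ 3 * (2 ^ m) ^ 2 * k := by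
        gcongr
        exact windowScale_sq_le hm
    _ = _ := by field_simp

/-- The pointer observable: a band matrix, constant along diagonals, with symbol `∑ Q k sin (k φ)`
up to the overlaps of the window. -/
def pointerObservable (m D : ℕ) (θ : ℝ) (Q : ℕ → ℝ) : Matrix (Fin (2 ^ m)) (Fin (2 ^ m)) ℂ :=
  Matrix.of fun ℓ ℓ' => ∑ k ∈ Finset.range D, ((Q k / (θ * overlap m k) : ℝ) : ℂ) * (-Complex.I) *
    ((if (ℓ : ℕ) = ℓ' + k then 1 else 0) - (if (ℓ' : ℕ) = ℓ + k then 1 else 0))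

theorem pointerObservable_isHermitian (m D : ℕ) (θ : ℝ) (Q : ℕ → ℝ) :
    (pointerObservable m D θ Q).IsHermitian := by
  ext ℓ ℓ'
  rw [Matrix.conjTranspose_apply]
  simp only [pointerObservable, Matrix.of_apply, star_sum]
  refine Finset.sum_congr rfl fun k _ => ?_
  rw [RCLike.star_def, map_mul, map_mul, Complex.conj_ofReal, map_neg, Complex.conj_I, map_sub,
    apply_ite (starRingEnd ℂ), apply_ite (starRingEnd ℂ), map_one, map_zero]
  ring

theorem sum_ite_shift_down (u : ℤ → ℂ) (hu : ∀ i : ℤ, i < 0 ∨ 2 ^ m ≤ i → u i = 0)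
    (ℓ : Fin (2 ^ m)) (k : ℕ) :
    ∑ ℓ' : Fin (2 ^ m), (if (ℓ : ℕ) = ℓ' + k then 1 else 0) * u (ℓ' : ℕ) = u ((ℓ : ℕ) - k) := by
  by_cases h : k ≤ ℓ
  · rw [Finset.sum_eq_single (⟨ℓ - k, by omega⟩ : Fin (2 ^ m))]
    · rw [if_pos (by simp only; omega), one_mul, Nat.cast_sub h]
    · intro b _ hb
      rw [if_neg, zero_mul]
      intro h1
      exact hb (Fin.ext (by simp only; omega))
    · simp
  · rw [hu _ (Or.inl (by omega))]
    refine Finset.sum_eq_zero fun ℓ' _ => ?_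
    rw [if_neg (by omega), zero_mul]

theorem sum_ite_shift_up (u : ℤ → ℂ) (hu : ∀ i : ℤ, i < 0 ∨ 2 ^ m ≤ i → u i = 0)
    (ℓ : Fin (2 ^ m)) (k : ℕ) :
    ∑ ℓ' : Fin (2 ^ m), (if (ℓ' : ℕ) = ℓ + k then 1 else 0) * u (ℓ' : ℕ) = u ((ℓ : ℕ) + k) := by
  by_cases h : (ℓ : ℕ) + k < 2 ^ m
  · rw [Finset.sum_eq_single (⟨ℓ + k, h⟩ : Fin (2 ^ m))]
    · rw [if_pos rfl, one_mul]
      push_cast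
      rfl
    · intro b _ hb
      rw [if_neg, zero_mul]
      exact fun h1 => hb (Fin.ext h1)
    · simp
  · rw [hu _ (Or.inr (by exact_mod_cast not_lt.1 h))]
    refine Finset.sum_eq_zero fun ℓ' _ => ?_
    rw [if_neg (by omega), zero_mul]

/-- The state of the ancillas after the interaction. -/
abbrev windowState (m : ℕ) (θ x : ℝ) : Fin (2 ^ m) → ℂ :=
  pointerState (fun ℓ => ((window m (ℓ : ℕ) : ℝ) : ℂ)) θ x

/-- A translation by `k` multiplies the plane wave by `exp (± i k θ x)` and shifts the window. The
window vanishes outside the register, so the truncated shifts of the finite matrix cause no boundary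
terms. -/
theorem pointerObservable_mulVec (D : ℕ) (θ x : ℝ) (Q : ℕ → ℝ) (ℓ : Fin (2 ^ m)) :
    Matrix.mulVec (pointerObservable m D θ Q) (windowState m θ x) ℓ = phase m θ x ℓ *
      ∑ k ∈ Finset.range D, ((Q k / (θ * overlap m k) : ℝ) : ℂ) * (-Complex.I) *
        (Complex.exp ((k * (θ * x) : ℝ) * Complex.I) * window m ((ℓ : ℕ) - k) -
          Complex.exp (-((k * (θ * x) : ℝ) * Complex.I)) * window m ((ℓ : ℕ) + k)) := by
  set E : ℤ → ℂ := fun i =>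
    Complex.exp (-Complex.I * ((θ * ((i : ℝ) - 2 ^ m / 2) : ℝ) : ℂ) * x) with hE
  set u : ℤ → ℂ := fun i => (window m i : ℂ) * E i with hu
  have hu0 : ∀ i : ℤ, i < 0 ∨ 2 ^ m ≤ i → u i = 0 := fun i hi => by
    rw [hu]
    simp only [window_eq_zero hi, Complex.ofReal_zero, zero_mul]
  have hst : ∀ ℓ' : Fin (2 ^ m), windowState m θ x ℓ' = u (ℓ' : ℕ) := fun ℓ' => by
    simp only [hu, hE, windowState, pointerState, phase, Int.cast_natCast]
  have hdown : ∀ k : ℕ, u ((ℓ : ℕ) - k) = phase m θ x ℓ *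
      (Complex.exp ((k * (θ * x) : ℝ) * Complex.I) * window m ((ℓ : ℕ) - k)) := fun k => by
    have : E ((ℓ : ℕ) - k) = phase m θ x ℓ * Complex.exp ((k * (θ * x) : ℝ) * Complex.I) := by
      rw [phase, ← Complex.exp_add]
      simp only [hE]
      congr 1
      push_cast
      ring
    simp only [hu, this]
    ring
  have hup : ∀ k : ℕ, u ((ℓ : ℕ) + k) = phase m θ x ℓ *
      (Complex.exp (-((k * (θ * x) : ℝ) * Complex.I)) * window m ((ℓ : ℕ) + k)) := fun k => by
    have : E ((ℓ : ℕ) + k) = phase m θ x ℓ * Complex.exp (-((k * (θ * x) : ℝ) * Complex.I)) := by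
      rw [phase, ← Complex.exp_add]
      simp only [hE]
      congr 1
      push_cast
      ring
    simp only [hu, this]
    ring
  simp only [Matrix.mulVec, dotProduct, pointerObservable, Matrix.of_apply, hst, Finset.sum_mul]
  rw [Finset.sum_comm, Finset.mul_sum]
  refine Finset.sum_congr rfl fun k _ => ?_
  simp only [mul_assoc, sub_mul]
  rw [← Finset.mul_sum, ← Finset.mul_sum, Finset.sum_sub_distrib, sum_ite_shift_down u hu0,
    sum_ite_shift_up u hu0, hdown, hup]
  ring

theorem neg_I_mul_exp_sub (φ : ℝ) :
    -Complex.I * (Complex.exp (φ * Complex.I) - Complex.exp (-(φ * Complex.I))) =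
      ((2 * Real.sin φ : ℝ) : ℂ) := by
  rw [Complex.ofReal_mul, Complex.ofReal_sin, Complex.sin]
  push_cast
  rw [neg_mul]
  ring_nf

theorem star_phase_mul_phase (θ x : ℝ) (ℓ : Fin (2 ^ m)) :
    star (phase m θ x ℓ) * phase m θ x ℓ = 1 := by
  rw [RCLike.star_def, Complex.conj_mul', norm_phase]
  simp

/-- The overlaps produced by the inner product cancel those in the matrix, so the mean is exactly
the trigonometric polynomial and the width of the window does not contribute to the bias. -/
theorem dotProduct_pointerObservable {D : ℕ} {θ : ℝ}
    (ho : ∀ k ∈ Finset.range D, overlap m k ≠ 0) (x : ℝ) (Q : ℕ → ℝ) :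
    star (windowState m θ x) ⬝ᵥ Matrix.mulVec (pointerObservable m D θ Q) (windowState m θ x) =
      ((θ⁻¹ * ∑ k ∈ Finset.range D, Q k * (2 * Real.sin (k * (θ * x))) : ℝ) : ℂ) := by
  have h1 : ∀ ℓ, star (windowState m θ x ℓ) *
      Matrix.mulVec (pointerObservable m D θ Q) (windowState m θ x) ℓ =
      ∑ k ∈ Finset.range D, ((Q k / (θ * overlap m k) : ℝ) : ℂ) * (-Complex.I) *
        (Complex.exp ((k * (θ * x) : ℝ) * Complex.I) *
            ((window m (ℓ : ℕ) * window m ((ℓ : ℕ) - k) : ℝ) : ℂ) -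
          Complex.exp (-((k * (θ * x) : ℝ) * Complex.I)) *
            ((window m (ℓ : ℕ) * window m ((ℓ : ℕ) + k) : ℝ) : ℂ)) := by
    intro ℓ
    have h2 : ∀ w p S : ℂ, star (w * p) * (p * S) = (star p * p) * (star w * S) := by
      intro w p S
      rw [star_mul']
      ring
    rw [pointerObservable_mulVec, windowState, pointerState, h2, star_phase_mul_phase, one_mul]
    rw [Finset.mul_sum]
    refine Finset.sum_congr rfl fun k _ => ?_
    rw [RCLike.star_def, Complex.conj_ofReal]
    push_cast
    ring
  rw [dotProduct]
  simp only [Pi.star_apply, h1]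
  rw [Finset.sum_comm, Finset.mul_sum, Complex.ofReal_sum]
  refine Finset.sum_congr rfl fun k hk => ?_
  rw [← Finset.mul_sum, Finset.sum_sub_distrib, ← Finset.mul_sum, ← Finset.mul_sum,
    ← Complex.ofReal_sum, ← Complex.ofReal_sum, sum_window_mul_window_sub]
  change _ * _ * (_ * ((overlap m k : ℝ) : ℂ) - _ * ((overlap m k : ℝ) : ℂ)) = _
  rw [← sub_mul, mul_assoc, ← mul_assoc (-Complex.I), neg_I_mul_exp_sub, ← Complex.ofReal_mul,
    ← Complex.ofReal_mul]
  congr 1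
  have := ho k hk
  rw [← div_div]
  field_simp

end PointerObservable

/-! ### Accuracy of the pointer measurement -/

section Accuracy

variable {m : ℕ}

theorem half_le_overlap (hm : 2 ≤ m) {D k : ℕ} (hD : 64 * (D : ℝ) ≤ 2 ^ m) (hk : k < D) :
    1 / 2 ≤ overlap m k := by
  have h := (abs_le.1 (abs_one_sub_overlap_le hm k)).2
  have h1 : 32 * (k : ℝ) / 2 ^ m ≤ 1 / 2 := by
    rw [div_le_iff₀ (by positivity)]
    have : (k : ℝ) ≤ D := by exact_mod_cast hk.le
    linarith
  linarith

/-- Translation changes the window by at most `windowScale m * k`, the normalization by at most `32`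
times that, and dividing by an overlap of at least `1 / 2` doubles the total: `66 = 2 * 33`. -/
theorem abs_window_div_overlap_sub_le (hm : 2 ≤ m) {D k : ℕ} (hD : 64 * (D : ℝ) ≤ 2 ^ m)
    (hk : k < D) {i j : ℤ} (hij : |(i : ℝ) - j| ≤ k) :
    |window m i / overlap m k - window m j| ≤ 66 * windowScale m * D := by
  have ho := half_le_overlap hm hD hk
  have ho' := abs_one_sub_overlap_le hm k
  have hc := windowScale_nonneg (m := m)
  have hkD : (k : ℝ) ≤ D := by exact_mod_cast hk.le
  have hL : (0 : ℝ) < 2 ^ m := by positivity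
  have h1 : window m i / overlap m k - window m j =
      ((window m i - window m j) + window m j * (1 - overlap m k)) / overlap m k := by
    have : overlap m k ≠ 0 := by linarith
    field_simp
    ring
  rw [h1, abs_div, abs_of_pos (by linarith : 0 < overlap m k), div_le_iff₀ (by linarith)]
  have h2 : |window m i - window m j| ≤ windowScale m * k :=
    (abs_window_sub_le i j).trans (mul_le_mul_of_nonneg_left hij hc)
  have h3 : |window m j * (1 - overlap m k)| ≤ 32 * (windowScale m * k) := by
    rw [abs_mul, abs_of_nonneg (window_nonneg j)]
    refine (mul_le_mul (window_le j) ho' (abs_nonneg _) (by positivity)).trans (le_of_eq ?_)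
    field_simp
  calc _ ≤ 33 * (windowScale m * k) := (abs_add_le _ _).trans (by linarith)
    _ ≤ 33 * (windowScale m * D) := by gcongr
    _ = 66 * windowScale m * D * (1 / 2) := by ring
    _ ≤ _ := by gcongr

/-- The pointer state is an approximate eigenvector with eigenvalue `x`. The first error is the
change of the window under both translations (`132 = 2 * 66`), weighted by coefficients of absolute
sum at most `D`; the second is the error of the polynomial. -/
theorem norm_pointerObservable_mulVec_sub_le (hm : 2 ≤ m) {D : ℕ} (hD : 64 * (D : ℝ) ≤ 2 ^ m)
    {θ : ℝ} (hθ : 0 < θ) {Q : ℕ → ℝ} (hQ : ∑ k ∈ Finset.range D, |Q k| ≤ D) {x δ : ℝ}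
    (hx : |θ⁻¹ * ∑ k ∈ Finset.range D, Q k * (2 * Real.sin (k * (θ * x))) - x| ≤ δ)
    (ℓ : Fin (2 ^ m)) :
    ‖Matrix.mulVec (pointerObservable m D θ Q) (windowState m θ x) ℓ -
      x * windowState m θ x ℓ‖ ≤ 132 * windowScale m * D ^ 2 / θ + δ * window m (ℓ : ℕ) := by
  have hc := windowScale_nonneg (m := m)
  set S := θ⁻¹ * ∑ k ∈ Finset.range D, Q k * (2 * Real.sin (k * (θ * x))) with hS
  set F : ℕ → ℂ := fun k => ((Q k / θ : ℝ) : ℂ) * (-Complex.I) *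
    (Complex.exp ((k * (θ * x) : ℝ) * Complex.I) *
        ((window m ((ℓ : ℕ) - k) / overlap m k - window m (ℓ : ℕ) : ℝ) : ℂ) -
      Complex.exp (-((k * (θ * x) : ℝ) * Complex.I)) *
        ((window m ((ℓ : ℕ) + k) / overlap m k - window m (ℓ : ℕ) : ℝ) : ℂ)) with hF
  have h1 : Matrix.mulVec (pointerObservable m D θ Q) (windowState m θ x) ℓ -
      x * windowState m θ x ℓ = phase m θ x ℓ *
        (∑ k ∈ Finset.range D, F k + ((S - x : ℝ) : ℂ) * window m (ℓ : ℕ)) := by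
    have h2 : (S : ℂ) * window m (ℓ : ℕ) = ∑ k ∈ Finset.range D, ((Q k / θ : ℝ) : ℂ) *
        (-Complex.I * (Complex.exp ((k * (θ * x) : ℝ) * Complex.I) -
          Complex.exp (-((k * (θ * x) : ℝ) * Complex.I)))) * window m (ℓ : ℕ) := by
      simp only [neg_I_mul_exp_sub]
      rw [hS, ← Finset.sum_mul, Finset.mul_sum, Complex.ofReal_sum]
      congr 1
      refine Finset.sum_congr rfl fun k _ => ?_
      push_cast
      ring
    rw [pointerObservable_mulVec, windowState, pointerState, Complex.ofReal_sub, sub_mul, h2,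
      add_sub_left_comm, ← add_sub_assoc, ← Finset.sum_add_distrib, mul_sub]
    congr 1
    · congr 1
      refine Finset.sum_congr rfl fun k hk => ?_
      have ho : ((overlap m k : ℝ) : ℂ) ≠ 0 := by
        have := half_le_overlap hm hD (Finset.mem_range.1 hk)
        exact_mod_cast (by linarith : overlap m k ≠ 0)
      have hθ' : (θ : ℂ) ≠ 0 := by exact_mod_cast hθ.ne'
      simp only [hF, Complex.ofReal_sub, Complex.ofReal_div, Complex.ofReal_mul (r := θ)]
      field_simp
      ring
    · ring
  have hexp : ∀ t : ℝ, ‖Complex.exp (-(t * Complex.I))‖ = 1 := by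
    intro t
    rw [← neg_mul, ← Complex.ofReal_neg, Complex.norm_exp_ofReal_mul_I]
  have h3 : ∀ k ∈ Finset.range D, ‖F k‖ ≤ |Q k| * (132 * windowScale m * D / θ) := by
    intro k hk
    have hk' := Finset.mem_range.1 hk
    have h4 := abs_window_div_overlap_sub_le hm hD hk' (i := (ℓ : ℕ) - k) (j := (ℓ : ℕ))
      (by push_cast; rw [sub_sub_cancel_left, abs_neg, Nat.abs_cast])
    have h5 := abs_window_div_overlap_sub_le hm hD hk' (i := (ℓ : ℕ) + k) (j := (ℓ : ℕ))
      (by push_cast; rw [add_sub_cancel_left, Nat.abs_cast])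
    rw [hF, norm_mul, norm_mul, norm_neg, Complex.norm_I, mul_one, Complex.norm_real,
      Real.norm_eq_abs, abs_div, abs_of_pos hθ]
    have h6 : ‖Complex.exp ((k * (θ * x) : ℝ) * Complex.I) *
        ((window m ((ℓ : ℕ) - k) / overlap m k - window m (ℓ : ℕ) : ℝ) : ℂ) -
      Complex.exp (-((k * (θ * x) : ℝ) * Complex.I)) *
        ((window m ((ℓ : ℕ) + k) / overlap m k - window m (ℓ : ℕ) : ℝ) : ℂ)‖ ≤
        132 * windowScale m * D := by
      refine (norm_sub_le _ _).trans ?_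
      rw [norm_mul, norm_mul, hexp, Complex.norm_exp_ofReal_mul_I, one_mul, one_mul,
        Complex.norm_real, Complex.norm_real, Real.norm_eq_abs, Real.norm_eq_abs]
      linarith
    calc _ ≤ |Q k| / θ * (132 * windowScale m * D) :=
          mul_le_mul_of_nonneg_left h6 (by positivity)
      _ = _ := by ring
  rw [h1, norm_mul, norm_phase, one_mul]
  refine (norm_add_le _ _).trans (add_le_add ?_ ?_)
  · refine (norm_sum_le _ _).trans ((Finset.sum_le_sum h3).trans ?_)
    rw [← Finset.sum_mul]
    calc _ ≤ (D : ℝ) * (132 * windowScale m * D / θ) :=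
          mul_le_mul_of_nonneg_right hQ (by positivity)
      _ = _ := by ring
  · rw [norm_mul, Complex.norm_real, Complex.norm_real, Real.norm_eq_abs, Real.norm_eq_abs,
      abs_of_nonneg (window_nonneg _)]
    exact mul_le_mul_of_nonneg_right hx (window_nonneg _)

/-- This norm is the mean square error of the outcome. The window contribution is of order `D ^ 4 /
(θ 2 ^ m) ^ 2`, which fixes how large `θ * 2 ^ m` must be. -/
theorem sum_norm_sq_pointerObservable_sub_le (hm : 2 ≤ m) {D : ℕ} (hD : 64 * (D : ℝ) ≤ 2 ^ m)
    {θ : ℝ} (hθ : 0 < θ) (hθD : 2048 * (D : ℝ) ^ 2 ≤ θ * 2 ^ m) {Q : ℕ → ℝ}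
    (hQ : ∑ k ∈ Finset.range D, |Q k| ≤ D) {x δ : ℝ} (hδ : δ ≤ 1 / 2)
    (hx : |θ⁻¹ * ∑ k ∈ Finset.range D, Q k * (2 * Real.sin (k * (θ * x))) - x| ≤ δ) :
    ∑ ℓ, ‖Matrix.mulVec (pointerObservable m D θ Q) (windowState m θ x) ℓ -
      x * windowState m θ x ℓ‖ ^ 2 ≤ 2 := by
  have hc := windowScale_nonneg (m := m)
  have hδ0 : 0 ≤ δ := (abs_nonneg _).trans hx
  have hL : (0 : ℝ) < 2 ^ m := by positivity
  set b := 132 * windowScale m * D ^ 2 / θ with hb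
  have hb2 : 2 ^ m * b ^ 2 ≤ 1 / 2 := by
    have h1 : (2048 * (D : ℝ) ^ 2) ^ 2 ≤ (θ * 2 ^ m) ^ 2 :=
      pow_le_pow_left₀ (by positivity) hθD 2
    calc 2 ^ m * b ^ 2 = 17424 * (D : ℝ) ^ 4 * 2 ^ m / θ ^ 2 * windowScale m ^ 2 := by
          rw [hb]; field_simp; ring
      _ ≤ 17424 * (D : ℝ) ^ 4 * 2 ^ m / θ ^ 2 * (32 / (2 ^ m : ℝ) ^ 3) := by
          gcongr
          exact windowScale_sq_le hm
      _ = 557568 * (D : ℝ) ^ 4 / (θ * 2 ^ m) ^ 2 := by field_simp; ring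
      _ ≤ 1 / 2 := by
          rw [div_le_iff₀ (by positivity)]
          nlinarith [pow_nonneg (Nat.cast_nonneg (α := ℝ) D) 4]
  calc _ ≤ ∑ ℓ : Fin (2 ^ m), (2 * b ^ 2 + 2 * δ ^ 2 * window m (ℓ : ℕ) ^ 2) := by
        refine Finset.sum_le_sum fun ℓ _ => ?_
        refine (pow_le_pow_left₀ (norm_nonneg _)
          (norm_pointerObservable_mulVec_sub_le hm hD hθ hQ hx ℓ) 2).trans ?_
        rw [← hb]
        nlinarith [sq_nonneg (b - δ * window m (ℓ : ℕ))]
    _ = 2 * (2 ^ m * b ^ 2) + 2 * δ ^ 2 := by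
        rw [Finset.sum_add_distrib, ← Finset.mul_sum _ _ (2 * δ ^ 2), sum_window_sq hm, Finset.sum_const,
          Finset.card_univ, Fintype.card_fin, nsmul_eq_mul]
        push_cast
        ring
    _ ≤ 2 := by nlinarith

/-- With enough ancillas there is a pointer measurement that is accurate on `[-κ, κ]`. -/
theorem exists_isAccurate {κ ε : ℝ} (hκ : 2 ≤ κ) (hε : 0 < ε) (hε2 : ε ≤ 1 / 2) {D : ℕ}
    (hD1 : 1 ≤ D) (hD : 12 * κ / ε ≤ 4 ^ D) (hm : 4096 * κ * (D : ℝ) ^ 2 ≤ 2 ^ m) :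
    ∃ (U W : Matrix.unitaryGroup (Fin (2 ^ m)) ℂ) (y : Fin (2 ^ m) → ℝ),
      IsAccurate U W (1 / (2 * κ)) y κ ε := by
  -- This scale puts `θ x` into `[-1/2, 1/2]`, where the polynomial approximates the identity;
  -- undoing it multiplies the error by `2 κ`, hence the requirement on `4 ^ D`.
  set θ := 1 / (2 * κ) with hθdef
  have hκ0 : 0 < κ := by linarith
  have hθ : 0 < θ := by positivity
  have hDr : (1 : ℝ) ≤ D := by exact_mod_cast hD1
  have hD2 : (D : ℝ) ≤ (D : ℝ) ^ 2 := by nlinarith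
  have hm2 : 2 ≤ m := by
    by_contra h
    have h1 : (2 : ℝ) ^ m ≤ 2 ^ 2 := pow_le_pow_right₀ (by norm_num) (by omega)
    have h2 : 4096 * 2 * 1 ≤ 4096 * κ * (D : ℝ) ^ 2 := by
      gcongr
      linarith
    linarith
  have hD64 : 64 * (D : ℝ) ≤ 2 ^ m := by
    refine le_trans ?_ hm
    have h2 : 4096 * 2 * (D : ℝ) ^ 2 ≤ 4096 * κ * (D : ℝ) ^ 2 := by gcongr
    linarith
  have hθD : 2048 * (D : ℝ) ^ 2 ≤ θ * 2 ^ m := by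
    rw [hθdef, one_div, inv_mul_eq_div, le_div_iff₀ (by positivity)]
    linarith
  set Q := sawtoothCoeff D
  have happ : ∀ x, |x| ≤ κ →
      |θ⁻¹ * ∑ k ∈ Finset.range D, Q k * (2 * Real.sin (k * (θ * x))) - x| ≤ ε / 2 := by
    intro x hx
    have h1 : |θ * x| ≤ 1 / 2 := by
      rw [abs_mul, abs_of_pos hθ, hθdef, one_div, inv_mul_eq_div, div_le_iff₀ (by positivity)]
      linarith
    have h2 := abs_sum_sawtoothCoeff_sub_le hD1 h1
    have h3 : θ⁻¹ * ∑ k ∈ Finset.range D, Q k * (2 * Real.sin (k * (θ * x))) - x =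
        θ⁻¹ * (∑ k ∈ Finset.range D, Q k * (2 * Real.sin (k * (θ * x))) - θ * x) := by
      rw [mul_sub, inv_mul_cancel_left₀ hθ.ne']
    have h4 : θ⁻¹ = 2 * κ := by rw [hθdef, one_div, inv_inv]
    rw [h3, abs_mul, abs_of_pos (inv_pos.2 hθ), h4]
    calc _ ≤ 2 * κ * (3 / 4 ^ D) := mul_le_mul_of_nonneg_left h2 (by positivity)
      _ ≤ ε / 2 := by
          rw [div_le_iff₀ hε] at hD
          rw [mul_div_assoc', div_le_iff₀ (by positivity)]
          linarith
  set A := pointerObservable m D θ Q with hA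
  have hAH : A.IsHermitian := pointerObservable_isHermitian m D θ Q
  obtain ⟨U, hU⟩ := exists_unitary_first_column
    (fun ℓ : Fin (2 ^ m) => ((window m (ℓ : ℕ) : ℝ) : ℂ)) (by
      simp only [Complex.norm_real, Real.norm_eq_abs, sq_abs]
      exact sum_window_sq hm2)
  have hU' : (fun ℓ => U ℓ ⟨0, by positivity⟩) =
      fun ℓ : Fin (2 ^ m) => ((window m (ℓ : ℕ) : ℝ) : ℂ) := funext hU
  refine ⟨U, hAH.eigenvectorUnitary, hAH.eigenvalues, ⟨fun x hx => ?_, fun x hx => ?_⟩⟩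
  · have h1 := dotProduct_mulVec_eq_sum hAH (windowState m θ x)
    have h2 := Complex.ofReal_injective ((dotProduct_pointerObservable (θ := θ) (fun k hk => by
      have := half_le_overlap hm2 hD64 (Finset.mem_range.1 hk)
      linarith) x Q).symm.trans h1)
    simp only [likelihood, amplitude_eq_mulVec, hU']
    rw [← h2]
    exact happ x hx
  · have h1 := sum_norm_sq_pointerObservable_sub_le hm2 hD64 hθ hθD (sum_abs_sawtoothCoeff_le D)
      (by linarith) (happ x hx)
    rw [← sum_norm_sq_mulVec hAH.eigenvectorUnitary] at h1
    refine le_trans (le_of_eq ?_) h1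
    refine Finset.sum_congr rfl fun j _ => ?_
    have h2 : (fun ℓ => Matrix.mulVec A (windowState m θ x) ℓ - x * windowState m θ x ℓ) =
        Matrix.mulVec A (windowState m θ x) - (x : ℂ) • windowState m θ x := rfl
    rw [← hA, h2, Matrix.mulVec_sub, Matrix.mulVec_smul, Pi.sub_apply, Pi.smul_apply,
      conjTranspose_eigenvectorUnitary_mulVec, smul_eq_mul, ← sub_mul, norm_mul, mul_pow,
      ← Complex.ofReal_sub, Complex.norm_real, Real.norm_eq_abs, sq_abs, likelihood,
      amplitude_eq_mulVec, hU']

end Accuracy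

/-! ### Choice of parameters -/

section Parameters

/-- The ceiling of the natural logarithm suffices because `exp 1 ≤ 4`. Additive constants are
absorbed since both logarithms are at least `log 2`. -/
theorem exists_degree {κ ε : ℝ} (hκ : 2 ≤ κ) (hε : 0 < ε) (hε2 : ε ≤ 1 / 2) :
    ∃ D : ℕ, 1 ≤ D ∧ 12 * κ / ε ≤ 4 ^ D ∧ (D : ℝ) ≤ 7 * (Real.log κ + Real.log ε⁻¹) := by
  have hκ0 : 0 < κ := by linarith
  have hx : 0 < 12 * κ / ε := by positivity
  have hx1 : 1 < 12 * κ / ε := by rw [lt_div_iff₀ hε]; linarith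
  have hl2 := Real.log_two_gt_d9
  have hu : Real.log 2 ≤ Real.log κ := Real.log_le_log (by norm_num) hκ
  have hw : Real.log 2 ≤ Real.log ε⁻¹ :=
    Real.log_le_log (by norm_num) (by rw [le_inv_comm₀ (by norm_num) hε]; linarith)
  have hlog : Real.log (12 * κ / ε) ≤ 4 * Real.log 2 + Real.log κ + Real.log ε⁻¹ := by
    rw [div_eq_mul_inv, Real.log_mul (by positivity) (by positivity),
      Real.log_mul (by norm_num) (by positivity)]
    have h12 : Real.log 12 ≤ Real.log (2 ^ 4) := Real.log_le_log (by norm_num) (by norm_num)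
    rw [Real.log_pow] at h12
    push_cast at h12
    linarith
  have hpos : 0 < Real.log (12 * κ / ε) := Real.log_pos hx1
  refine ⟨⌈Real.log (12 * κ / ε)⌉₊, Nat.one_le_iff_ne_zero.2 (Nat.ceil_pos.2 hpos).ne', ?_, ?_⟩
  · calc 12 * κ / ε = Real.exp (Real.log (12 * κ / ε)) := (Real.exp_log hx).symm
      _ ≤ Real.exp (⌈Real.log (12 * κ / ε)⌉₊ * 1) := by
          rw [mul_one]
          exact Real.exp_le_exp.2 (Nat.le_ceil _)
      _ = Real.exp 1 ^ ⌈Real.log (12 * κ / ε)⌉₊ := Real.exp_nat_mul _ _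
      _ ≤ 4 ^ _ := by
          gcongr
          linarith [Real.exp_one_lt_d9]
  · have h := (Nat.ceil_lt_add_one hpos.le).le
    linarith

/-- There is an accurate pointer measurement with few ancillas and short evolution time. -/
theorem exists_pointer {κ ε : ℝ} (hκ : 2 ≤ κ) (hε : 0 < ε) (hε2 : ε ≤ 1 / 2) :
    ∃ (m : ℕ) (U W : Matrix.unitaryGroup (Fin (2 ^ m)) ℂ) (θ : ℝ) (y : Fin (2 ^ m) → ℝ),
      IsAccurate U W θ y κ ε ∧
      (m : ℝ) ≤ 200 * (Real.log κ + Real.log (Real.log ε⁻¹)) ∧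
      |θ| * (2 ^ m / 2) ≤ 200704 * (Real.log ε⁻¹ ^ 2 + Real.log κ ^ 2) := by
  obtain ⟨D, hD1, hD, hDle⟩ := exists_degree hκ hε hε2
  have hκ0 : 0 < κ := by linarith
  have hl2 := Real.log_two_gt_d9
  have hl2' := Real.log_two_lt_d9
  have hu : Real.log 2 ≤ Real.log κ := Real.log_le_log (by norm_num) hκ
  have hw : Real.log 2 ≤ Real.log ε⁻¹ :=
    Real.log_le_log (by norm_num) (by rw [le_inv_comm₀ (by norm_num) hε]; linarith)
  set u := Real.log κ with hudef
  set w := Real.log ε⁻¹ with hwdef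
  have hw0 : 0 < w := by linarith
  have hDr : (1 : ℝ) ≤ D := by exact_mod_cast hD1
  set X := 4096 * κ * (D : ℝ) ^ 2 with hX
  have hX1 : 1 ≤ X := by
    have : (1 : ℝ) ≤ (D : ℝ) ^ 2 := one_le_pow₀ hDr
    nlinarith
  -- The least suitable power of two exceeds the requirement by at most a factor `2`, which keeps
  -- the evolution time of order `D ^ 2`.
  obtain ⟨n, hn1, hn2⟩ := exists_nat_pow_near hX1 (by norm_num : (1 : ℝ) < 2)
  obtain ⟨U, W, y, hacc⟩ := exists_isAccurate (m := n + 1) hκ hε hε2 hD1 hD hn2.le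
  have h2m : (2 : ℝ) ^ (n + 1) ≤ 2 * X := by rw [pow_succ]; linarith
  refine ⟨n + 1, U, W, 1 / (2 * κ), y, hacc, ?_, ?_⟩
  -- The iterated logarithm is negative for `ε` near `1 / 2`. It stays above `-0.45`, less than `log
  -- κ` in absolute value, so the sum has a positive lower bound that absorbs constants.
  · have hlogw : 1 - w⁻¹ ≤ Real.log w := Real.one_sub_inv_le_log_of_pos hw0
    have hw1 : w⁻¹ ≤ 1.4428 := by
      rw [inv_le_comm₀ hw0 (by norm_num)]
      refine le_trans ?_ hw
      refine le_trans ?_ hl2.le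
      norm_num
    have hlogD : Real.log D ≤ Real.log 14 + u + Real.log w := by
      have h1 : (D : ℝ) ≤ 14 * κ * w := by
        refine hDle.trans ?_
        have h2 : u ≤ κ - 1 := Real.log_le_sub_one_of_pos hκ0
        nlinarith
      rw [hudef, ← Real.log_mul (by norm_num) hκ0.ne',
        ← Real.log_mul (by positivity) hw0.ne']
      exact Real.log_le_log (by linarith) h1
    have hlogX : Real.log (2 * X) = Real.log 8192 + u + 2 * Real.log D := by
      have : 2 * X = 8192 * κ * (D : ℝ) ^ 2 := by rw [hX]; ring
      rw [this, Real.log_mul (by positivity) (by positivity),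
        Real.log_mul (by norm_num) hκ0.ne', Real.log_pow]
      push_cast
      rfl
    have h14 : Real.log 14 ≤ 4 * Real.log 2 := by
      have h := Real.log_le_log (by norm_num) (by norm_num : (14 : ℝ) ≤ 2 ^ 4)
      rw [Real.log_pow] at h
      push_cast at h
      exact h
    have h8192 : Real.log 8192 = 13 * Real.log 2 := by
      have : (8192 : ℝ) = 2 ^ 13 := by norm_num
      rw [this, Real.log_pow]
      push_cast
      rfl
    have hm : ((n + 1 : ℕ) : ℝ) * Real.log 2 ≤ Real.log (2 * X) := by
      rw [← Real.log_pow]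
      exact Real.log_le_log (by positivity) h2m
    have hm2 : ((n + 1 : ℕ) : ℝ) * 0.6931471803 ≤ ((n + 1 : ℕ) : ℝ) * Real.log 2 :=
      mul_le_mul_of_nonneg_left hl2.le (Nat.cast_nonneg _)
    linarith
  · rw [abs_of_pos (by positivity)]
    have h1 : (1 / (2 * κ)) * ((2 : ℝ) ^ (n + 1) / 2) ≤ 2048 * (D : ℝ) ^ 2 := by
      calc _ ≤ (1 / (2 * κ)) * (2 * X / 2) := by gcongr
        _ = _ := by rw [hX]; field_simp; ring
    -- With `(u + w)² ≤ 2 (u² + w²)` the constant is `2048 * 49 * 2 = 200704`.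
    have h2 : (D : ℝ) ^ 2 ≤ (7 * (u + w)) ^ 2 := pow_le_pow_left₀ (by linarith) hDle 2
    nlinarith [sq_nonneg (u - w)]

end Parameters

/-- A protocol with an accurate pointer measurement and sufficiently many rounds estimates thermal
expectations. -/
theorem estimates_pointer {m : ℕ} {U W : Matrix.unitaryGroup (Fin (2 ^ m)) ℂ} {θ : ℝ}
    {y : Fin (2 ^ m) → ℝ} {κ ε η V Δ q : ℝ} {T K r : ℕ} (h : IsAccurate U W θ y κ ε) (hε : 0 < ε)
    (hε2 : ε ≤ 1 / 2) (hη : 0 < η) (hΔ : 0 < Δ)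
    (hK : η < 1 / 2 → Δ ≤ 1 → 0 < K ∧ (1 - Δ) ^ r ≤ q ∧ q < 1 ∧ 0 ≤ 1 + 2 * (q / (1 - q)) ∧
      5 * (V + 1) * (1 + 2 * (q / (1 - q))) ≤ η * (K * (ε / 2) ^ 2)) :
    Estimates ⟨pointer U W θ y, T, K, r⟩ κ ε η V Δ T := by
  intro n H O β s N hH hO hOH hκ _ _ hN hV hgap hT σ hσ
  -- For `η ≥ 1 / 2` the required probability is not positive, so even zero rounds are allowed.
  by_cases hη2 : η < 1 / 2
  · obtain ⟨hK0, hq, hq1, hq2, hcheb⟩ := hK hη2 (hgap.trans hN.gap_le_one)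
    have hρ := gibbs_posDef hH β
    have hρ1 := gibbs_trace hH β
    set ρ := gibbs H β
    have hI : IsCommutingInstrument ρ (pointerKraus U W θ O) :=
      isCommutingInstrument_pointer U W θ hO (gibbs_commute hOH β)
    set μ := ∑ a, spectralWeight hO ρ a * ∑ j, y j * likelihood U W θ j (hO.eigenvalues a)
    have hbias : |μ - expect ρ O| ≤ ε / 2 := h.abs_mean_sub_le hO hρ.posSemidef hρ1 hκ
    have hvar := h.variance_le hO hρ.posSemidef hρ1 hκ (hbias.trans (by linarith : ε / 2 ≤ 1 / 2))
    have key := Protocol.one_sub_le_successProb (O := O) (ρ := ρ) (N := N) (s := s)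
      (⟨pointer U W θ y, T, K, r⟩ : Protocol) (Δ := Δ) (η := η) (ε := ε) (q := q) (μ := μ)
      (v := 5 * (V + 1)) (o := expect ρ O)
    simp only [pointer_kraus] at key
    refine key hI hN hρ hρ1 hΔ hgap hη hT hq hq1 hε
      (trace_effect_pointer U W θ hO hρ.posSemidef y) hbias ?_ hK0 hcheb hσ
    have h2 := trace_effect_pointer U W θ hO hρ.posSemidef (fun j => (y j - μ) ^ 2)
    refine (congrArg Complex.re h2).trans_le ?_
    rw [Complex.ofReal_re]
    exact hvar.trans (by linarith)
  · exact le_trans (by linarith) (Protocol.successProb_nonneg _ hN.channel hσ _ _)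

/-- Rounding the number of rounds down avoids an additive one in the costs and loses at most a
factor `2`. -/
theorem half_le_floor {x : ℝ} (hx : 1 ≤ x) : x / 2 ≤ (⌊x⌋₊ : ℝ) := by
  have h1 := Nat.lt_floor_add_one x
  have h2 : (1 : ℝ) ≤ ⌊x⌋₊ := by exact_mod_cast (Nat.one_le_floor_iff x).2 hx
  linarith

end ThermalEst

end

/-! ### Assembly: numbers of rounds and costs of the two protocols -/

theorem corollary6p4 :
    ∃ (C : ℝ) (a : ℕ), 0 < C ∧
      ∀ (κ ε η V Δ : ℝ) (T : ℕ),
        2 ≤ κ → 0 < ε → ε ≤ 1 / 2 → 0 < η → 0 ≤ V → 0 < Δ →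
        ∃ P P' : ThermalEst.Protocol,
          -- measuring after every application of the sampler
          P.spacing = 1 ∧
          (P.ancillas : ℝ) ≤ C * (Real.log κ + Real.log (Real.log ε⁻¹)) ∧
          (P.samplerTime : ℝ) ≤ T + C * ((V + 1) / (ε ^ 2 * η * Δ)) ∧
          P.evolutionTime ≤
            C * ((V + 1) / (ε ^ 2 * η * Δ)) * (Real.log ε⁻¹ ^ a + Real.log κ ^ a) ∧
          ThermalEst.Estimates P κ ε η V Δ T ∧
          -- the same measurement, performed only once every `⌈1 / Δ⌉` applications
          P'.meas = P.meas ∧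
          P'.spacing = ⌈1 / Δ⌉₊ ∧
          (P'.samplerTime : ℝ) ≤ T + C * ((V + 1) / (ε ^ 2 * η * Δ)) ∧
          P'.evolutionTime ≤
            C * ((V + 1) / (ε ^ 2 * η)) * (Real.log ε⁻¹ ^ a + Real.log κ ^ a) ∧
          ThermalEst.Estimates P' κ ε η V Δ T := by
  refine ⟨10 ^ 8, 2, by norm_num, fun κ ε η V Δ T hκ hε hε2 hη hV hΔ => ?_⟩
  obtain ⟨m, U, W, θ, y, hacc, hm, htime⟩ := ThermalEst.exists_pointer hκ hε hε2
  set S := Real.log ε⁻¹ ^ 2 + Real.log κ ^ 2 with hS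
  have hS0 : 0 ≤ S := by positivity
  set X := (V + 1) / (ε ^ 2 * η * Δ) with hX
  set X' := (V + 1) / (ε ^ 2 * η) with hX'
  have hV1 : 0 < V + 1 := by linarith
  have hX0 : 0 < X := by positivity
  have hX0' : 0 < X' := by positivity
  have hXX : X = X' / Δ := by rw [hX, hX', div_div]
  -- In the only nontrivial range of `η` this keeps the rounded numbers of rounds positive.
  have hsmall : η < 1 / 2 → 1 ≤ X' := fun h => by
    rw [hX', le_div_iff₀ (by positivity), one_mul]
    have h1 : ε ^ 2 ≤ 1 := pow_le_one₀ hε.le (by linarith)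
    nlinarith
  have hlog0 : (0 : ℝ) ≤ Real.log κ + Real.log (Real.log ε⁻¹) := by
    have : (0 : ℝ) ≤ m := Nat.cast_nonneg m
    linarith
  set K := ⌊80 * X⌋₊ with hK
  -- For `Δ > 1` no sampler qualifies, since gaps are at most `1`. Zero rounds are needed there
  -- because `⌈1 / Δ⌉ = 1` no longer scales like `1 / Δ`.
  set K' := if Δ ≤ 1 then ⌊120 * X'⌋₊ else 0 with hK'
  have hKle : (K : ℝ) ≤ 80 * X := Nat.floor_le (by positivity)
  have hKle' : (K' : ℝ) ≤ 120 * X' := by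
    rw [hK']
    split_ifs
    · exact Nat.floor_le (by positivity)
    · rw [Nat.cast_zero]; positivity
  have hcost : ∀ (k : ℕ) (b : ℝ), (k : ℝ) ≤ 120 * b → 0 < b →
      2 * (k : ℝ) * (ThermalEst.pointer U W θ y).time ≤ 10 ^ 8 * b * S := by
    intro k b hk hb
    rw [ThermalEst.pointer_time]
    calc _ ≤ 2 * (120 * b) * (200704 * S) := by gcongr
      _ ≤ _ := by nlinarith [mul_nonneg hb.le hS0]
  refine ⟨⟨ThermalEst.pointer U W θ y, T, K, 1⟩, ⟨ThermalEst.pointer U W θ y, T, K', ⌈1 / Δ⌉₊⟩, rfl,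
    ?_, ?_, hcost K X (by linarith) hX0, ?_, rfl, rfl, ?_, hcost K' X' hKle' hX0', ?_⟩
  · change (m : ℝ) ≤ _
    linarith
  · change (((T + K * 1 : ℕ)) : ℝ) ≤ _
    push_cast
    linarith
  · refine ThermalEst.estimates_pointer (q := 1 - Δ) hacc hε hε2 hη hΔ fun hη2 hΔ1 => ?_
    have hX1 : 1 ≤ X := by
      rw [hXX, le_div_iff₀ hΔ]
      linarith [hsmall hη2]
    have hfl : 80 * X / 2 ≤ (K : ℝ) := ThermalEst.half_le_floor (by linarith)
    have hq : 1 + 2 * ((1 - Δ) / (1 - (1 - Δ))) = (2 - Δ) / Δ := by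
      rw [sub_sub_cancel]
      field_simp
      ring
    have hKpos : (0 : ℝ) < K := by linarith
    refine ⟨by exact_mod_cast hKpos, by rw [pow_one], by linarith, ?_, ?_⟩
    · rw [hq]
      exact div_nonneg (by linarith) hΔ.le
    · rw [hq]
      have h1 : X * (ε ^ 2 * η) = (V + 1) / Δ := by rw [hX]; field_simp
      -- The choice `80` makes half of it cover `5 * 2 * 4 = 40`: outcome variance, correlation
      -- factor and the square of `ε / 2`.
      calc 5 * (V + 1) * ((2 - Δ) / Δ) ≤ 5 * (V + 1) * (2 / Δ) := by gcongr; linarith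
        _ = η * ((80 * X / 2) * (ε / 2) ^ 2) := by linear_combination (-10) * h1
        _ ≤ _ := by gcongr
  · change (((T + K' * ⌈1 / Δ⌉₊ : ℕ)) : ℝ) ≤ _
    push_cast
    by_cases hΔ1 : Δ ≤ 1
    · have h1 : (⌈1 / Δ⌉₊ : ℝ) ≤ 2 / Δ := by
        have h2 := (Nat.ceil_lt_add_one (by positivity : 0 ≤ 1 / Δ)).le
        have h3 : 1 ≤ 1 / Δ := by rw [le_div_iff₀ hΔ]; linarith
        have h4 : 2 / Δ = 1 / Δ + 1 / Δ := by ring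
        linarith
      have h5 : (K' : ℝ) * ⌈1 / Δ⌉₊ ≤ 120 * X' * (2 / Δ) := by gcongr
      have h6 : 120 * X' * (2 / Δ) = 240 * X := by rw [hXX]; ring
      linarith
    · have : K' = 0 := if_neg hΔ1
      rw [this, Nat.cast_zero, zero_mul]
      linarith
  · refine ThermalEst.estimates_pointer (q := 1 / 2) hacc hε hε2 hη hΔ fun hη2 hΔ1 => ?_
    have hK1 : K' = ⌊120 * X'⌋₊ := if_pos hΔ1
    have hfl : 120 * X' / 2 ≤ (K' : ℝ) := by
      rw [hK1]
      exact ThermalEst.half_le_floor (by linarith [hsmall hη2])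
    have hKpos : (0 : ℝ) < K' := by linarith
    refine ⟨by exact_mod_cast hKpos, ?_, by norm_num, by norm_num, ?_⟩
    -- About `1 / Δ` sampler steps reduce correlations by a factor `exp (-1)`, below `1 / 2`.
    · calc (1 - Δ) ^ ⌈1 / Δ⌉₊ ≤ Real.exp (-Δ) ^ ⌈1 / Δ⌉₊ :=
            pow_le_pow_left₀ (by linarith) (Real.one_sub_le_exp_neg Δ) _
        _ = Real.exp (⌈1 / Δ⌉₊ * -Δ) := (Real.exp_nat_mul _ _).symm
        _ ≤ Real.exp (-1) := by
            apply Real.exp_le_exp.2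
            have h1 := Nat.le_ceil (1 / Δ)
            rw [div_le_iff₀ hΔ] at h1
            linarith
        _ ≤ 1 / 2 := by
            rw [Real.exp_neg, one_div]
            exact inv_anti₀ (by norm_num) (by linarith [Real.add_one_le_exp 1])
    · have h1 : X' * (ε ^ 2 * η) = V + 1 := by rw [hX']; field_simp
      -- The correlation factor is now `3`, and `120 = 2 * 5 * 3 * 4`.
      calc 5 * (V + 1) * (1 + 2 * (1 / 2 / (1 - 1 / 2))) = η * ((120 * X' / 2) * (ε / 2) ^ 2) := by
            linear_combination (-15) * h1
        _ ≤ _ := by gcongr
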